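/- Let $n\ge 0$, let $V=\mathbb R^{2n}$ with its standard symplectic form $\Omega$, and let $M=\mathbb R\times V\times\mathbb R$, with coordinates $x=(a,v,\ell)$ and Lebesgue measure, be the split solvable Ricci-type symplectic symmetric space with symmetries $$s_{(a,v,\ell)}(a',v',\ell')=\big(2a-a',\;2\cosh(a-a')v-v',\;2\cosh(2(a-a'))\ell+\Omega(v,v')\sinh(a-a')-\ell'\big)$$ and invariant symplectic form $\omega=2\,da\wedge d\ell+\Omega$. Put $d=\dim M=2n+2$. Let $\mathcal S$ be the Schwartz space and $\mathcal S'$ the space of tempered distributions on $M$, let $\mathcal F u(a,v,\xi)=\int e^{-i\xi\ell}u(a,v,\ell)\,d\ell$, and let $\varphi_\theta(\xi)=\frac{\sinh(2\theta\xi)}{2\theta}$ ($\varphi_0=\mathrm{id}$), $\phi_\theta(a,v,\xi)=\big(a,\frac{1}{\cosh(\theta\xi)}v,\varphi_\theta(\xi)\big)$. For $\theta\ne0$ let $\star^0_\theta$ be the Weyl product on $\mathcal S$, $$u\star^0_\theta v(x)=\frac{4}{(4\pi\theta)^{d}}\int_{M\times M}e^{\frac{i}{2\theta}(\omega(x,y)+\omega(y,z)+\omega(z,x))}u(y)v(z)\,dy\,dz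 .$$ Let $\Theta$ be the set of smooth families $\tau=(\tau_\theta)_{\theta\in\mathbb R}$ of functions $\tau_\theta:\mathbb R\to\mathbb C$ such that, for each $\theta$, $\exp\circ\tau_\theta$ is an invertible Schwartz multiplier, i.e. $e^{\tau_\theta}$ and $e^{-\tau_\theta}$ both belong to $\mathcal O_M(\mathbb R)$. For $f:\mathbb R\to\mathbb C$ write $(\varphi_\theta^\star f)_{1/\theta}(t)=f(\varphi_\theta(t/\theta))$, regard it as the two-point function $(x,y)\mapsto (\varphi_\theta^\star f)_{1/\theta}(a_y-a_x)$ on $M$, and let $\delta_{\rm op}=-\sigma_{12}\circ\delta\circ\sigma_{12}$, where $\sigma_{12}$ exchanges the first two arguments and $\delta c(x_0,\dots,x_q)=\sum_j(-1)^jc(x_0,\dots,\hat x_j,\dots,x_q)$. Put $$S=\Omega(w_0,w_1)+\Omega(w_1,w_2)+\Omega(w_2,w_0)-\sinh(2(a_0-a_1))\ell_2-\sinh(2(a_1-a_2))\ell_0-\sinh(2(a_2-a_0))\ell_1,$$ where $w_0=\cosh(a_1-a_2)v_0$, $w_1=\cosh(a_2-a_0)v_1$, $w_2=\cosh(a_0-a_1)v_2$,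 and $${\bf A}_1=\cosh(2(a_1-a_2))\,[\cosh(a_2-a_0)\cosh(a_0-a_1)]^{d-2},$$ $${\bf A}_{\rm can}=\sqrt{\cosh(2(a_0-a_1))\cosh(2(a_1-a_2))\cosh(2(a_2-a_0))}\;[\cosh(a_0-a_1)\cosh(a_1-a_2)\cosh(a_2-a_0)]^{\frac{d-2}{2}} .$$ **Theorem.** Let $\tau\in\Theta$. (i) For every $\theta\in\mathbb R$, $T_{\theta,\tau}=\mathcal F^{-1}\circ\mathcal M_{\exp\tau_\theta}\circ(\phi_\theta^{-1})^\star\circ\mathcal F:\mathcal S\to\mathcal S'$ is a well-defined linear injection, and $\mathcal S\subset\mathcal E_{\theta,\tau}:=T_{\theta,\tau}(\mathcal S)$. Let now $\theta\neq0$. (ii) The Weyl product maps $\mathcal S\times\mathcal S$ to $\mathcal S$, and $a\star_{\theta,\tau}b:=T_{\theta,\tau}(T_{\theta,\tau}^{-1}a\star^0_\theta T_{\theta,\tau}^{-1}b)$ is an associative product on $\mathcal E_{\theta,\tau}$. For $u,v\in C_c^\infty(M)$, $u\star_{\theta,\tau}v$ is the Schwartz function $$u\star_{\theta,\tau}v(x_0)=\frac{4}{(4\pi\theta)^{d}}\int_{M\times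 M}{\bf A}_1\exp\Big[\frac{i}{2\theta}S+\delta_{\rm op}\big(\sigma_{12}(\varphi_\theta^\star\tau_\theta)_{1/\theta}\big)\Big](x_0,x_1,x_2)\,u(x_1)v(x_2)\,dx_1dx_2 .$$ (iii) Let $\mathcal H_{\theta,\tau}$ be the Hilbert completion of $\mathcal E_{\theta,\tau}$ for $(a|b)=\int_M T_{\theta,\tau}^{-1}(a)\,\overline{T_{\theta,\tau}^{-1}(b)}$. The product $\star_{\theta,\tau}$ and the involution $a^*=T_{\theta,\tau}\big(\overline{T_{\theta,\tau}^{-1}a}\big)$ extend to $\mathcal H_{\theta,\tau}$ and make it an associative Hilbert algebra; in particular $(a\star_{\theta,\tau}c\,|\,b)=(a\,|\,b\star_{\theta,\tau}c^*)$. If $\tau_\theta(-\xi)=\overline{\tau_\theta(\xi)}$ for all $\xi$, then $a^*=\overline a$. The transvection group (generated by products of two symmetries) acts on $\mathcal H_{\theta,\tau}$ by unitary automorphisms extending $u\mapsto u\circ g^{-1}$ on $C_c^\infty(M)$; if $\tau_\theta$ is even (that is, if the two-point function of $\tau_\theta$ is invariant under all symmetries), so does the group generated by all symmetries. (iv) One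 has $\mathcal H_{\theta,\tau}=L^2(M)$ (as Hilbert spaces of distributions) if and only if $|\exp\tau_\theta|^2=|\mathrm{Jac}_{\phi_\theta^{-1}}|$. In this case $T_{\theta,\tau}$ extends to a unitary automorphism of $L^2(M)$ and, with $\psi_\theta=\mathrm{Im}\,\tau_\theta$, for $u,v\in C^\infty_c(M)$, $$u\star_{\theta,\tau}v(x_0)=\frac{4}{(4\pi\theta)^{d}}\int_{M\times M}{\bf A}_{\rm can}\exp\Big[\frac{i}{2\theta}S+i\,\delta_{\rm op}\big(\sigma_{12}(\varphi_\theta^\star\psi_\theta)_{1/\theta}\big)\Big](x_0,x_1,x_2)\,u(x_1)v(x_2)\,dx_1dx_2 .$$ Every smooth real-valued family $\psi$ with $e^{i\psi_\theta}\in\mathcal O_M(\mathbb R)$ for all $\theta$ occurs: there is $\tau\in\Theta$ with $\mathrm{Im}\,\tau_\theta=\psi_\theta$ and $|\exp\tau_\theta|^2=|\mathrm{Jac}_{\phi_\theta^{-1}}|$ for all $\theta$. -/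

import Mathlib

open MeasureTheory SchwartzMap
open scoped ContDiff InnerProductSpace ENNReal

noncomputable section

namespace RicciQuant

/-! ### The symplectic symmetric space -/

/-- The standard symplectic vector space `(V, Ω)` of dimension `2n` (positions, momenta). -/
abbrev V (n : ℕ) : Type := EuclideanSpace ℝ (Fin n) × EuclideanSpace ℝ (Fin n)

/-- The symplectic form of `V`. -/
def Om {n : ℕ} (v w : V n) : ℝ := ⟪v.1, w.2⟫_ℝ - ⟪v.2, w.1⟫_ℝ

/-- The symmetric space `M`, in its global coordinates `(a, v, ℓ)`.  The same space carries the
variables `(a, v, ξ)` of partially Fourier transformed functions. -/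
abbrev M (n : ℕ) : Type := ℝ × V n × ℝ

instance {n : ℕ} : (volume : Measure (V n)).IsAddHaarMeasure :=
  Measure.prod.instIsAddHaarMeasure (volume : Measure (EuclideanSpace ℝ (Fin n))) volume

instance {n : ℕ} : (volume : Measure (V n × ℝ)).IsAddHaarMeasure :=
  Measure.prod.instIsAddHaarMeasure (volume : Measure (V n)) volume

instance {n : ℕ} : (volume : Measure (M n)).IsAddHaarMeasure :=
  Measure.prod.instIsAddHaarMeasure (volume : Measure ℝ) (volume : Measure (V n × ℝ))

/-- The geodesic symmetry at `x = (a, v, ℓ)`. -/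
def symFun {n : ℕ} (x y : M n) : M n :=
  (2 * x.1 - y.1,
   (2 * Real.cosh (x.1 - y.1)) • x.2.1 - y.2.1,
   2 * Real.cosh (2 * (x.1 - y.1)) * x.2.2
     + Om x.2.1 y.2.1 * Real.sinh (x.1 - y.1) - y.2.2)

theorem symFun_symFun {n : ℕ} (x y : M n) : symFun x (symFun x y) = y := by
  obtain ⟨a, ⟨p, q⟩, l⟩ := x
  obtain ⟨b, ⟨r, s⟩, m⟩ := y
  have h : a - (2 * a - b) = -(a - b) := by ring
  have hO : ∀ c : ℝ, Om (p, q) (c • (p, q) - (r, s)) = -Om (p, q) (r, s) := by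
    intro c
    simp only [Om, Prod.smul_mk, Prod.mk_sub_mk, inner_sub_right, inner_smul_right]
    rw [real_inner_comm p q]
    ring
  simp only [symFun, h, hO, Prod.mk.injEq, mul_neg, Real.cosh_neg, Real.sinh_neg]
  refine ⟨by ring, by simp, by ring⟩

/-- The symmetry at `x` as a bijection of `M`. -/
def sym {n : ℕ} (x : M n) : Equiv.Perm (M n) where
  toFun := symFun x
  invFun := symFun x
  left_inv := symFun_symFun x
  right_inv := symFun_symFun x

/-- The group generated by all symmetries. -/
def symmetryGroup (n : ℕ) : Subgroup (Equiv.Perm (M n)) :=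
  Subgroup.closure (Set.range sym)

/-- The transvection group, generated by the products of two symmetries. -/
def transvectionGroup (n : ℕ) : Subgroup (Equiv.Perm (M n)) :=
  Subgroup.closure (Set.range fun p : M n × M n => sym p.1 * sym p.2)

/-- The invariant symplectic form `2 da ∧ dℓ + Ω` (constant coefficients in these coordinates). -/
def omega {n : ℕ} (x y : M n) : ℝ := 2 * (x.1 * y.2.2 - x.2.2 * y.1) + Om x.2.1 y.2.1

/-! ### Cochains -/

/-- The coboundary `(δc)(x₀,…,x_q) = ∑ (-1)^j c(x₀,…,x̂_j,…,x_q)`. -/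
def coboundary {X : Type} {q : ℕ} (c : (Fin q → X) → ℂ) : (Fin (q + 1) → X) → ℂ :=
  fun x => ∑ j : Fin (q + 1), (-1) ^ (j : ℕ) * c (fun i => x (j.succAbove i))

/-- `σ₁₂`: exchange of the first two arguments. -/
def sigma12 {X : Type} {q : ℕ} (c : (Fin (q + 2) → X) → ℂ) : (Fin (q + 2) → X) → ℂ :=
  fun x => c (fun i => x (Equiv.swap 0 1 i))

/-- `δ_op = -σ₁₂ ∘ δ ∘ σ₁₂`. -/
def deltaOp {X : Type} {q : ℕ} (c : (Fin (q + 2) → X) → ℂ) : (Fin (q + 3) → X) → ℂ :=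
  fun x => -sigma12 (q := q + 1) (coboundary (sigma12 c)) x

/-- The leafwise constant two-point function on `M` defined by a function of the variable `a`. -/
def cochain {n : ℕ} (f : ℝ → ℂ) : (Fin 2 → M n) → ℂ := fun x => f ((x 1).1 - (x 0).1)

/-! ### The twisting map -/

/-- `ξ ↦ sinh(2θξ)/(2θ)` (the identity for `θ = 0`). -/
def phi (θ ξ : ℝ) : ℝ := if θ = 0 then ξ else Real.sinh (2 * θ * ξ) / (2 * θ)

/-- The inverse of `phi θ`. -/
def phiInv (θ ξ : ℝ) : ℝ := if θ = 0 then ξ else Real.arsinh (2 * θ * ξ) / (2 * θ)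

theorem phiInv_phi (θ ξ : ℝ) : phiInv θ (phi θ ξ) = ξ := by
  unfold phi phiInv
  split_ifs with h
  · rfl
  · have h2 : 2 * θ ≠ 0 := mul_ne_zero two_ne_zero h
    rw [mul_div_cancel₀ _ h2, Real.arsinh_sinh, mul_div_cancel_left₀ _ h2]

theorem phi_phiInv (θ ξ : ℝ) : phi θ (phiInv θ ξ) = ξ := by
  unfold phi phiInv
  split_ifs with h
  · rfl
  · have h2 : 2 * θ ≠ 0 := mul_ne_zero two_ne_zero h
    rw [mul_div_cancel₀ _ h2, Real.sinh_arsinh, mul_div_cancel_left₀ _ h2]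

/-- The twisting map `(a, v, ξ) ↦ (a, v / cosh(θξ), sinh(2θξ)/(2θ))`. -/
def twist (n : ℕ) (θ : ℝ) : M n ≃ M n where
  toFun x := (x.1, (Real.cosh (θ * x.2.2))⁻¹ • x.2.1, phi θ x.2.2)
  invFun x := (x.1, Real.cosh (θ * phiInv θ x.2.2) • x.2.1, phiInv θ x.2.2)
  left_inv x := by
    simp [phiInv_phi, smul_smul, mul_inv_cancel₀ (Real.cosh_pos _).ne']
  right_inv x := by
    simp [phi_phiInv, smul_smul, inv_mul_cancel₀ (Real.cosh_pos _).ne']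

/-- `|Jac φ_θ⁻¹|`. -/
def jacInv (n : ℕ) (θ : ℝ) (x : M n) : ℝ := |(fderiv ℝ (twist n θ).symm x).det|

/-- `(φ_θ^* f)_{1/θ}`, i.e. `t ↦ f(φ_θ(t/θ))`. -/
def pullScale (θ : ℝ) (f : ℝ → ℂ) : ℝ → ℂ := fun t => f (phi θ (t / θ))

/-! ### Schwartz multipliers -/

/-- The class `Θ`: smooth families `θ ↦ τ_θ` of functions on the line such that `exp ∘ τ_θ` is an
invertible Schwartz multiplier (it and its inverse belong to `O_M`). -/
structure IsTheta (τ : ℝ → ℝ → ℂ) : Prop where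
  smooth : ContDiff ℝ ∞ (fun p : ℝ × ℝ => τ p.1 p.2)
  mult : ∀ θ, (fun ξ => Complex.exp (τ θ ξ)).HasTemperateGrowth
  mult_inv : ∀ θ, (fun ξ => Complex.exp (-τ θ ξ)).HasTemperateGrowth

/-! ### Partial Fourier transform, the map `T` and the space `E` -/

/-- The partial Fourier transform in the variable `ℓ`. -/
def pFourier {n : ℕ} (u : M n → ℂ) : M n → ℂ :=
  fun x => ∫ l : ℝ, Complex.exp (-(Complex.I * x.2.2 * l)) * u (x.1, x.2.1, l)

/-- The inverse partial Fourier transform. -/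
def pFourierInv {n : ℕ} (u : M n → ℂ) : M n → ℂ :=
  fun x => (2 * Real.pi : ℂ)⁻¹ *
    ∫ t : ℝ, Complex.exp (Complex.I * x.2.2 * t) * u (x.1, x.2.1, t)

/-- The function `exp(τ) · (φ_θ⁻¹)^* (F u)` of the variables `(a, v, ξ)`. -/
def symbolT {n : ℕ} (θ : ℝ) (f : ℝ → ℂ) (u : M n → ℂ) : M n → ℂ :=
  fun x => Complex.exp (f x.2.2) * pFourier u ((twist n θ).symm x)

/-- A Schwartz function as a tempered distribution. -/
abbrev toDist {n : ℕ} (u : 𝓢(M n, ℂ)) : 𝓢'(M n, ℂ) :=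
  toTemperedDistributionCLM (M n) ℂ volume u

/-- `L` is the operator `F⁻¹ ∘ M_{exp τ} ∘ (φ_θ⁻¹)^* ∘ F : 𝓢 → 𝓢'`.  The inverse partial Fourier
transform of the tempered function `w` is the distribution `g ↦ ∫ w · F⁻¹ g`. -/
def IsT {n : ℕ} (θ : ℝ) (f : ℝ → ℂ) (L : 𝓢(M n, ℂ) →ₗ[ℂ] 𝓢'(M n, ℂ)) : Prop :=
  ∀ u g : 𝓢(M n, ℂ),
    Integrable (fun x => symbolT θ f u x * pFourierInv g x) ∧
    L u g = ∫ x, symbolT θ f u x * pFourierInv g x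

open Classical in
/-- The operator `T_{θ,τ}`, with `f = τ_θ` (the value `0` is never used: existence is part of the
theorem). -/
def T (n : ℕ) (θ : ℝ) (f : ℝ → ℂ) : 𝓢(M n, ℂ) →ₗ[ℂ] 𝓢'(M n, ℂ) :=
  if h : ∃ L, IsT (n := n) θ f L then h.choose else 0

/-- `E_{θ,τ} = T_{θ,τ}(𝓢)`. -/
def E (n : ℕ) (θ : ℝ) (f : ℝ → ℂ) : Submodule ℂ 𝓢'(M n, ℂ) := LinearMap.range (T n θ f)

/-- The inverse `T_{θ,τ}⁻¹ : E_{θ,τ} → 𝓢`. -/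
def Tinv {n : ℕ} {θ : ℝ} {f : ℝ → ℂ} (a : E n θ f) : 𝓢(M n, ℂ) :=
  (LinearMap.mem_range.mp a.2).choose

theorem T_Tinv {n : ℕ} {θ : ℝ} {f : ℝ → ℂ} (a : E n θ f) : T n θ f (Tinv a) = a :=
  (LinearMap.mem_range.mp a.2).choose_spec

/-! ### The Weyl product and the transported products -/

/-- The constant `4 / (4πθ)^{dim M}`, `dim M = 2n + 2`, for Lebesgue measure `da dv dℓ`. -/
def weylConst (n : ℕ) (θ : ℝ) : ℂ := 4 / (4 * Real.pi * θ : ℂ) ^ (2 * n + 2)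

/-- `B` is the Weyl product of the symplectic vector space `(M, omega)`, normalized so that the
constant function `1` is a unit. -/
def IsWeyl {n : ℕ} (θ : ℝ)
    (B : 𝓢(M n, ℂ) →ₗ[ℂ] 𝓢(M n, ℂ) →ₗ[ℂ] 𝓢(M n, ℂ)) : Prop :=
  ∀ (u v : 𝓢(M n, ℂ)) (x : M n),
    B u v x = weylConst n θ * ∫ p : M n × M n,
      Complex.exp (Complex.I / (2 * θ) * (omega x p.1 + omega p.1 p.2 + omega p.2 x : ℝ))
        * u p.1 * v p.2

open Classical in
/-- The Weyl product on `𝓢` (the value `0` is never used: existence is part of the theorem). -/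
def weyl (n : ℕ) (θ : ℝ) : 𝓢(M n, ℂ) →ₗ[ℂ] 𝓢(M n, ℂ) →ₗ[ℂ] 𝓢(M n, ℂ) :=
  if h : ∃ B, IsWeyl (n := n) θ B then h.choose else 0

/-- The product `a ⋆ b = T (T⁻¹ a ⋆⁰ T⁻¹ b)` on `E_{θ,τ}`. -/
def star {n : ℕ} {θ : ℝ} {f : ℝ → ℂ} (a b : E n θ f) : E n θ f :=
  ⟨T n θ f (weyl n θ (Tinv a) (Tinv b)), LinearMap.mem_range_self _ _⟩

/-- The pairing `(a | b) = ∫ T⁻¹(a) · conj (T⁻¹(b))`. -/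
def pairing {n : ℕ} {θ : ℝ} {f : ℝ → ℂ} (a b : E n θ f) : ℂ :=
  ∫ x, Tinv a x * (starRingEnd ℂ) (Tinv b x)

/-- Complex conjugation on `𝓢`. -/
def conjS {n : ℕ} (u : 𝓢(M n, ℂ)) : 𝓢(M n, ℂ) :=
  SchwartzMap.postcompCLM (𝕜 := ℝ) (Complex.conjCLE : ℂ →L[ℝ] ℂ) u

/-! ### Phase and amplitudes -/

/-- The phase `S`. -/
def phaseS {n : ℕ} (x : Fin 3 → M n) : ℝ :=
  let w0 := Real.cosh ((x 1).1 - (x 2).1) • (x 0).2.1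
  let w1 := Real.cosh ((x 2).1 - (x 0).1) • (x 1).2.1
  let w2 := Real.cosh ((x 0).1 - (x 1).1) • (x 2).2.1
  (Om w0 w1 + Om w1 w2 + Om w2 w0)
    - (Real.sinh (2 * ((x 0).1 - (x 1).1)) * (x 2).2.2
      + Real.sinh (2 * ((x 1).1 - (x 2).1)) * (x 0).2.2
      + Real.sinh (2 * ((x 2).1 - (x 0).1)) * (x 1).2.2)

/-- The amplitude `A₁` (here `dim 𝕊 - 2 = 2n`). -/
def ampA1 {n : ℕ} (x : Fin 3 → M n) : ℝ :=
  Real.cosh (2 * ((x 1).1 - (x 2).1))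
    * (Real.cosh ((x 2).1 - (x 0).1) * Real.cosh ((x 0).1 - (x 1).1)) ^ (2 * n)

/-- The amplitude `A_can` (here `(dim 𝕊 - 2) / 2 = n`). -/
def ampCan {n : ℕ} (x : Fin 3 → M n) : ℝ :=
  Real.sqrt (Real.cosh (2 * ((x 0).1 - (x 1).1)) * Real.cosh (2 * ((x 1).1 - (x 2).1))
      * Real.cosh (2 * ((x 2).1 - (x 0).1)))
    * (Real.cosh ((x 0).1 - (x 1).1) * Real.cosh ((x 1).1 - (x 2).1)
      * Real.cosh ((x 2).1 - (x 0).1)) ^ n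

/-- On compactly supported `u`, `v`, the product of `E_{θ,τ}` is the function given by the kernel
`4/(4πθ)^{dim M} · A · exp(i S/(2θ) + δ_op(σ₁₂ (φ_θ^* g)_{1/θ}))`. -/
def HasKernel {n : ℕ} (θ : ℝ) (f : ℝ → ℂ) (A : (Fin 3 → M n) → ℝ) (g : ℝ → ℂ) : Prop :=
  ∀ u v : 𝓢(M n, ℂ), HasCompactSupport u → HasCompactSupport v →
    ∃ (hu : toDist u ∈ E n θ f) (hv : toDist v ∈ E n θ f) (w : 𝓢(M n, ℂ)),
      (star ⟨toDist u, hu⟩ ⟨toDist v, hv⟩ : 𝓢'(M n, ℂ)) = toDist w ∧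
      ∀ x : M n, w x = weylConst n θ * ∫ p : M n × M n,
        (A ![x, p.1, p.2] : ℂ)
          * Complex.exp (Complex.I / (2 * θ) * (phaseS ![x, p.1, p.2] : ℝ)
              + deltaOp (sigma12 (cochain (pullScale θ g))) ![x, p.1, p.2])
          * u p.1 * v p.2

/-! ### Hilbert algebras -/

section Hilbert

variable {H : Type} [NormedAddCommGroup H] [InnerProductSpace ℂ H]

/-- A Hilbert algebra structure on a Hilbert space: a bounded associative product and an isometric
antilinear anti-multiplicative involution, adjoint to left and right multiplication, with dense
span of products.  (Mathlib's inner product is conjugate linear in the first slot.) -/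
structure IsHilbertAlgebra (mul : H →L[ℂ] H →L[ℂ] H) (inv : H →ₗ⋆[ℂ] H) : Prop where
  assoc : ∀ a b c, mul (mul a b) c = mul a (mul b c)
  inv_inv : ∀ a, inv (inv a) = a
  inv_mul : ∀ a b, inv (mul a b) = mul (inv b) (inv a)
  inner_inv : ∀ a b, ⟪inv a, inv b⟫_ℂ = ⟪b, a⟫_ℂ
  inner_left : ∀ a b c, ⟪mul a b, c⟫_ℂ = ⟪b, mul (inv a) c⟫_ℂ
  inner_right : ∀ a b c, ⟪mul a b, c⟫_ℂ = ⟪a, mul c (inv b)⟫_ℂ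
  dense : Dense (Submodule.span ℂ (Set.range fun p : H × H => mul p.1 p.2) : Set H)

variable {n : ℕ} {θ : ℝ} {f : ℝ → ℂ}

/-- `ι : E → H` exhibits the Hilbert space `H` as the completion of `(E, (·|·))`. -/
structure IsHilbertCompletion [CompleteSpace H] (ι : E n θ f →ₗ[ℂ] H) : Prop where
  dense : DenseRange ι
  inner_eq : ∀ a b, ⟪ι b, ι a⟫_ℂ = pairing a b

/-- The group `G` acts on `H` by unitary automorphisms of the Hilbert algebra, extending
`u ↦ u ∘ g⁻¹` on smooth compactly supported functions. -/
def ActsByUnitaryAutomorphisms (G : Subgroup (Equiv.Perm (M n))) (ι : E n θ f →ₗ[ℂ] H)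
    (mul : H →L[ℂ] H →L[ℂ] H) (inv : H →ₗ⋆[ℂ] H) : Prop :=
  ∃ U : G →* (H ≃ₗᵢ[ℂ] H), ∀ g : G,
    (∀ a b, U g (mul a b) = mul (U g a) (U g b)) ∧
    (∀ a, U g (inv a) = inv (U g a)) ∧
    ∀ u : 𝓢(M n, ℂ), HasCompactSupport u →
      ∃ w : 𝓢(M n, ℂ), (∀ x, w x = u ((g : Equiv.Perm (M n)).symm x)) ∧
        ∃ (hu : toDist u ∈ E n θ f) (hw : toDist w ∈ E n θ f),
          U g (ι ⟨toDist u, hu⟩) = ι ⟨toDist w, hw⟩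

/-- `H = L²(M)` as Hilbert spaces of distributions: there is a unitary from `H` onto `L²(M)` which
maps every `a ∈ E` to a square integrable function representing the distribution `a`. -/
def EqualsL2 (ι : E n θ f →ₗ[ℂ] H) : Prop :=
  ∃ U : H ≃ₗᵢ[ℂ] Lp ℂ 2 (volume : Measure (M n)),
    ∀ a : E n θ f, Lp.toTemperedDistribution (U (ι a)) = (a : 𝓢'(M n, ℂ))

/-- `T` extends to a unitary automorphism of `L²(M)`. -/
def ExtendsToUnitary (n : ℕ) (θ : ℝ) (f : ℝ → ℂ) : Prop :=
  ∃ U : Lp ℂ 2 (volume : Measure (M n)) ≃ₗᵢ[ℂ] Lp ℂ 2 (volume : Measure (M n)),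
    ∀ u : 𝓢(M n, ℂ), Lp.toTemperedDistribution (U (u.toLp 2 volume)) = T n θ f u

end Hilbert

end RicciQuant

end

/-!
The coordinate `ℓ` enters the phase of the Weyl product linearly, so after partial Fourier
transformation in `ℓ` and in half of the coordinates of `V`, followed by a linear change of
variables, a symbol on `M` becomes an integral kernel on the configuration space `Cf n = ℝ × ℝⁿ`
(`kappa`). This map is a topological isomorphism of Schwartz spaces, isometric up to a constant
for the `L²` norms (`inner_kappa`); it turns the Weyl product into a multiple of the composition
of kernels (`kappa_weyl`) and complex conjugation into the adjoint (`adjK_kappa`). Hence the Weyl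
product preserves `𝓢` and is associative, and its `L²` completion is the Hilbert algebra of
Hilbert–Schmidt kernels (`isHilbertAlgebra_smul_mulHS`). Linear changes of variables multiply the
measures by constants whose values are never needed: the same constant governs the Weyl product
and every kernel formula derived from it, and the normalization `4 / (4πθ)^{2n+2}` is imposed at
the end (`weylScale`).

The twisting map `φ_θ` grows exponentially, but its derivative, its Jacobian and its inverse are
temperate functions of the *image* point. Pullback by such a map preserves `𝓢` (`pullbackCLM`), so
`T⁻¹` restricts to a continuous operator `Ti` of `𝓢` and `T` has a transpose `Tt` on `𝓢`. The
identities `T (Ti w) = w` (`T_Ti`) and `⟨T u, g⟩ = ⟨u, Tt g⟩` (`T_apply_eq_integral_Tt`) give the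
inclusion `𝓢 ⊂ E` and the continuity of `T`. `Ti` is not onto `𝓢`, but its range contains every
function whose partial Fourier transform has bounded support in `ξ` (`exists_Ti_eq`); therefore
the range is dense, and so are the images of the compactly supported functions
(`dense_Ti_hasCompactSupport`).

The kernel of the transported product comes from one general formula
(`exists_integral_pF_symbProd`): if the partial Fourier transforms of `U` and `V` arise from those
of `u` and `v` by `(a, x, η) ↦ (a, x / c(η), ϕ(η))` and a factor `ε(η)`, then the partial Fourier
transform of their product is an explicit integral against `u ⊗ v`. For `c = 1` and `ϕ = id` it is
the Weyl product, for `c = cosh` and `ϕ = φ_θ` the kernel with amplitude `A₁`. The frequency `ξ`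
of the product is `θ⁻¹` times a difference of `a`-coordinates of the factors, so for factors of
compact support it is bounded and `exists_Ti_eq` shows that the product is a Schwartz function.

The symmetry at `x` acts on kernels as conjugation by a unitary operator `h ↦ exp(i symPhase) · (h
∘ symConf)`, up to the factor `exp(τ(-ξ) - τ(ξ))`, which depends only on the difference of the
first coordinates (`kappa_Ti_sym`). The symmetry reverses that difference, so the factors cancel
in a product of two symmetries, and they are `1` if `τ` is even. Conjugation by a unitary operator
respects composition, adjoints and inner products, and this yields unitary automorphisms of the
completion (`actsByUnitaryAutomorphisms`).

Finally, by Plancherel and the change of variables `φ_θ`, the norm of the completion is the `L²`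
norm on the Fourier side with density `(|exp τ|² |Jac φ_θ|)⁻¹` (`normDensity`). It is the `L²`
norm exactly when this density is `1` (`tracial_iff`), and then `T` extends to a unitary operator
(`exists_unitary_T`). In that case the real part of `τ` is half the logarithm of the Jacobian of
`φ_θ⁻¹`; its coboundary turns `A₁` into `A_can` (`ampA1_mul_exp_eq`), while the imaginary part
remains arbitrary (`tracialFamily`).
-/

noncomputable section

set_option linter.unusedSectionVars false

namespace RicciQuant

/-! ### Operators on Schwartz spaces -/

section Schwartz

variable {D D' : Type} [NormedAddCommGroup D] [NormedSpace ℝ D]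
  [NormedAddCommGroup D'] [NormedSpace ℝ D']

theorem exists_seminorm_bound_comp {F G : Type} [NormedAddCommGroup F] [NormedSpace ℝ F]
    [NormedAddCommGroup G] [NormedSpace ℝ G] (T : 𝓢(D, F) →L[ℝ] 𝓢(D', G))
    (s : Finset (ℕ × ℕ)) :
    ∃ (t : Finset (ℕ × ℕ)) (C : ℝ), 0 ≤ C ∧ ∀ f,
      (s.sup (schwartzSeminormFamily ℝ D' G)) (T f)
        ≤ C * (t.sup (schwartzSeminormFamily ℝ D F)) f := by
  have hc : Continuous ((s.sup (schwartzSeminormFamily ℝ D' G)).comp T.toLinearMap) := by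
    have h1 : Continuous fun f => (s.sup (schwartzSeminormFamily ℝ D' G)) f := by
      refine Seminorm.continuous_of_le (q := ∑ i ∈ s, schwartzSeminormFamily ℝ D' G i) ?_
        (Seminorm.finset_sup_le_sum _ _)
      have h2 : (fun f => (∑ i ∈ s, schwartzSeminormFamily ℝ D' G i) f)
          = fun f => ∑ i ∈ s, schwartzSeminormFamily ℝ D' G i f := by
        ext f
        simp
      change Continuous fun f => (∑ i ∈ s, schwartzSeminormFamily ℝ D' G i) f
      rw [h2]
      exact continuous_finsetSum _ fun i _ =>
        (schwartz_withSeminorms ℝ D' G).continuous_seminorm i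
    exact h1.comp T.continuous
  obtain ⟨t, C, -, h⟩ := Seminorm.bound_of_continuous (schwartz_withSeminorms ℝ D F) _ hc
  exact ⟨t, C, C.2, fun f => h f⟩

/-- Seminorm bounds for a family of operators `A` that intertwines differentiation with a
continuous operator `G`: the bounds on the derivatives follow from those on the values. -/
theorem seminorm_bound_of_hasFDerivAt
    (A : ∀ (F : Type) [NormedAddCommGroup F] [NormedSpace ℂ F] [CompleteSpace F],
      𝓢(D, F) → D' → F)
    (G : ∀ (F : Type) [NormedAddCommGroup F] [NormedSpace ℂ F] [CompleteSpace F],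
      𝓢(D, F) →L[ℝ] 𝓢(D, D' →L[ℝ] F))
    (hd : ∀ (F : Type) [NormedAddCommGroup F] [NormedSpace ℂ F] [CompleteSpace F] (f : 𝓢(D, F))
      (x : D'), HasFDerivAt (A F f) (A (D' →L[ℝ] F) (G F f) x) x)
    (hb : ∀ (F : Type) [NormedAddCommGroup F] [NormedSpace ℂ F] [CompleteSpace F] (k : ℕ),
      ∃ (s : Finset (ℕ × ℕ)) (C : ℝ), 0 ≤ C ∧ ∀ (f : 𝓢(D, F)) (x : D'),
        ‖x‖ ^ k * ‖A F f x‖ ≤ C * (s.sup (schwartzSeminormFamily ℝ D F)) f) (n : ℕ) :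
    ∀ (F : Type) [NormedAddCommGroup F] [NormedSpace ℂ F] [CompleteSpace F] (k : ℕ),
      ∃ (s : Finset (ℕ × ℕ)) (C : ℝ), 0 ≤ C ∧ ∀ (f : 𝓢(D, F)), ContDiff ℝ n (A F f) ∧ ∀ (x : D'),
        ‖x‖ ^ k * ‖iteratedFDeriv ℝ n (A F f) x‖
          ≤ C * (s.sup (schwartzSeminormFamily ℝ D F)) f := by
  induction n with
  | zero =>
    intro F _ _ _ k
    obtain ⟨s, C, hC, h⟩ := hb F k
    refine ⟨s, C, hC, fun f => ⟨?_, fun x => ?_⟩⟩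
    · rw [Nat.cast_zero, contDiff_zero]
      exact continuous_iff_continuousAt.2 fun x => (hd F f x).continuousAt
    · simpa using h f x
  | succ n ih =>
    intro F _ _ _ k
    obtain ⟨s, C, hC, h⟩ := ih (D' →L[ℝ] F) k
    obtain ⟨t, C', hC', h'⟩ := exists_seminorm_bound_comp (G F) s
    have hfd : ∀ f : 𝓢(D, F), fderiv ℝ (A F f) = A (D' →L[ℝ] F) (G F f) := fun f =>
      funext fun x => (hd F f x).fderiv
    refine ⟨t, C * C', by positivity, fun f => ⟨?_, fun x => ?_⟩⟩
    · rw [Nat.cast_add, Nat.cast_one, contDiff_succ_iff_fderiv]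
      refine ⟨fun x => (hd F f x).differentiableAt, by simp, ?_⟩
      rw [hfd]
      exact (h _).1
    · rw [← norm_iteratedFDeriv_fderiv, hfd]
      calc _ ≤ C * (s.sup (schwartzSeminormFamily ℝ D (D' →L[ℝ] F))) (G F f) := (h _).2 x
        _ ≤ C * (C' * (t.sup (schwartzSeminormFamily ℝ D F)) f) := by gcongr; exact h' f
        _ = _ := by ring

theorem finset_sup_schwartzSeminormFamily_complex {F : Type} [NormedAddCommGroup F]
    [NormedSpace ℂ F] (s : Finset (ℕ × ℕ)) (f : 𝓢(D, F)) :
    (s.sup (schwartzSeminormFamily ℝ D F)) f = (s.sup (schwartzSeminormFamily ℂ D F)) f := by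
  rw [Seminorm.finset_sup_apply, Seminorm.finset_sup_apply]
  rfl

/-- The continuous operator between Schwartz spaces defined by a family of operators that
intertwines differentiation with a continuous operator. -/
def clmOfHasFDerivAt
    (A : ∀ (F : Type) [NormedAddCommGroup F] [NormedSpace ℂ F] [CompleteSpace F],
      𝓢(D, F) → D' → F)
    (G : ∀ (F : Type) [NormedAddCommGroup F] [NormedSpace ℂ F] [CompleteSpace F],
      𝓢(D, F) →L[ℝ] 𝓢(D, D' →L[ℝ] F))
    (hd : ∀ (F : Type) [NormedAddCommGroup F] [NormedSpace ℂ F] [CompleteSpace F] (f : 𝓢(D, F))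
      (x : D'), HasFDerivAt (A F f) (A (D' →L[ℝ] F) (G F f) x) x)
    (hb : ∀ (F : Type) [NormedAddCommGroup F] [NormedSpace ℂ F] [CompleteSpace F] (k : ℕ),
      ∃ (s : Finset (ℕ × ℕ)) (C : ℝ), 0 ≤ C ∧ ∀ (f : 𝓢(D, F)) (x : D'),
        ‖x‖ ^ k * ‖A F f x‖ ≤ C * (s.sup (schwartzSeminormFamily ℝ D F)) f)
    (hadd : ∀ (f g : 𝓢(D, ℂ)) x, A ℂ (f + g) x = A ℂ f x + A ℂ g x)
    (hsmul : ∀ (c : ℂ) (f : 𝓢(D, ℂ)) x, A ℂ (c • f) x = c • A ℂ f x) :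
    𝓢(D, ℂ) →L[ℂ] 𝓢(D', ℂ) :=
  mkCLM (A ℂ) hadd hsmul
    (fun f => contDiff_infty.2 fun n =>
      ((seminorm_bound_of_hasFDerivAt A G hd hb n ℂ 0).choose_spec.choose_spec.2 f).1)
    (fun n => by
      obtain ⟨s, C, hC, h⟩ := seminorm_bound_of_hasFDerivAt A G hd hb n.2 ℂ n.1
      refine ⟨s, C, hC, fun f x => ?_⟩
      rw [← finset_sup_schwartzSeminormFamily_complex]
      exact (h f).2 x)

/-! ### Pullback by diffeomorphisms whose derivative is temperate in the target variable -/

section Pullback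

variable (Φ : D' → D) (J : D → D' →L[ℝ] D)

/-- Pullback of Schwartz functions by a map `Φ` whose derivative is `J ∘ Φ` with `J` of temperate
growth.  The map `Φ` itself may grow exponentially. -/
def pullbackCLM (hJ : J.HasTemperateGrowth) (hΦ : ∀ x, HasFDerivAt Φ (J (Φ x)) x)
    (hup : ∃ (k : ℕ) (C : ℝ), ∀ x, ‖x‖ ≤ C * (1 + ‖Φ x‖) ^ k) : 𝓢(D, ℂ) →L[ℂ] 𝓢(D', ℂ) :=
  clmOfHasFDerivAt (fun F _ _ _ f x => f (Φ x))
    (fun F _ _ _ => (bilinLeftCLM (ContinuousLinearMap.compL ℝ D' D F) hJ).comp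
      (fderivCLM ℝ D F))
    (fun F _ _ _ f x => (f.hasFDerivAt (Φ x)).comp x (hΦ x))
    (fun F _ _ _ k => by
      obtain ⟨m, C, h⟩ := hup
      have hC : 0 ≤ C := by
        have h0 := (norm_nonneg _).trans (h 0)
        exact nonneg_of_mul_nonneg_left h0 (by positivity)
      refine ⟨Finset.Iic (m * k, 0), C ^ k * 2 ^ (m * k), by positivity, fun f x => ?_⟩
      have h1 := one_add_le_sup_seminorm_apply (𝕜 := ℝ) (m := (m * k, 0)) (k := m * k) (n := 0)
        le_rfl le_rfl f (Φ x)
      rw [norm_iteratedFDeriv_zero] at h1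
      calc ‖x‖ ^ k * ‖f (Φ x)‖ ≤ (C * (1 + ‖Φ x‖) ^ m) ^ k * ‖f (Φ x)‖ := by
            gcongr; exact h x
        _ = C ^ k * ((1 + ‖Φ x‖) ^ (m * k) * ‖f (Φ x)‖) := by rw [mul_pow, ← pow_mul]; ring
        _ ≤ C ^ k * (2 ^ (m * k) *
            ((Finset.Iic (m * k, 0)).sup (schwartzSeminormFamily ℝ D F)) f) := by
            exact mul_le_mul_of_nonneg_left h1 (by positivity)
        _ = _ := by ring)
    (fun _ _ _ => rfl) (fun _ _ _ => rfl)

end Pullback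

/-! ### Tensor products -/

theorem norm_iteratedFDeriv_comp_clm_le {F : Type} [NormedAddCommGroup F] [NormedSpace ℝ F]
    (L : D' →L[ℝ] D) (hL : ‖L‖ ≤ 1) (f : 𝓢(D, F)) (i : ℕ) (x : D') :
    ‖iteratedFDeriv ℝ i (fun x => f (L x)) x‖ ≤ ‖iteratedFDeriv ℝ i f (L x)‖ := by
  have h := L.iteratedFDeriv_comp_right (f.smooth ⊤) x (i := i) (mod_cast le_top)
  have h2 : (fun x => f (L x)) = f ∘ L := rfl
  rw [h2, h]
  refine (ContinuousMultilinearMap.norm_compContinuousLinearMap_le _ _).trans ?_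
  refine mul_le_of_le_one_right (norm_nonneg _) ?_
  exact Finset.prod_le_one (fun _ _ => norm_nonneg _) (fun _ _ => hL)

/-- The tensor product `(x, y) ↦ f x * g y` of two Schwartz functions. -/
def tens (f : 𝓢(D, ℂ)) (g : 𝓢(D', ℂ)) : 𝓢(D × D', ℂ) where
  toFun z := f z.1 * g z.2
  smooth' := (f.smooth ⊤ |>.comp contDiff_fst).mul (g.smooth ⊤ |>.comp contDiff_snd)
  decay' k n := by
    refine ⟨∑ i ∈ Finset.range (n + 1), (n.choose i : ℝ) *
      (SchwartzMap.seminorm ℝ k i f * SchwartzMap.seminorm ℝ 0 (n - i) g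
        + SchwartzMap.seminorm ℝ 0 i f * SchwartzMap.seminorm ℝ k (n - i) g), fun z => ?_⟩
    have h1 := norm_iteratedFDeriv_mul_le (𝕜 := ℝ) (n := n) (N := ∞)
      (f := fun z : D × D' => f z.1) (g := fun z : D × D' => g z.2)
      ((f.smooth ⊤).comp contDiff_fst) ((g.smooth ⊤).comp contDiff_snd) z
      (mod_cast le_top)
    refine (mul_le_mul_of_nonneg_left h1 (by positivity)).trans ?_
    rw [Finset.mul_sum]
    refine Finset.sum_le_sum fun i _ => ?_
    have hf := norm_iteratedFDeriv_comp_clm_le (ContinuousLinearMap.fst ℝ D D')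
      (ContinuousLinearMap.norm_fst_le _ _ _) f i z
    have hg := norm_iteratedFDeriv_comp_clm_le (ContinuousLinearMap.snd ℝ D D')
      (ContinuousLinearMap.norm_snd_le _ _ _) g (n - i) z
    simp only [ContinuousLinearMap.coe_fst', ContinuousLinearMap.coe_snd'] at hf hg
    have hz : ‖z‖ ^ k ≤ ‖z.1‖ ^ k + ‖z.2‖ ^ k := by
      rw [Prod.norm_def]
      rcases max_cases ‖z.1‖ ‖z.2‖ with h | h <;> rw [h.1] <;>
        simp [pow_nonneg]
    have f1 := le_seminorm ℝ k i f z.1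
    have f2 := le_seminorm ℝ 0 i f z.1
    have g1 := le_seminorm ℝ 0 (n - i) g z.2
    have g2 := le_seminorm ℝ k (n - i) g z.2
    rw [pow_zero, one_mul] at f2 g1
    calc _ ≤ (‖z.1‖ ^ k + ‖z.2‖ ^ k) * ((n.choose i : ℝ) * ‖iteratedFDeriv ℝ i f z.1‖ *
          ‖iteratedFDeriv ℝ (n - i) g z.2‖) := by gcongr
      _ = (n.choose i : ℝ) * ((‖z.1‖ ^ k * ‖iteratedFDeriv ℝ i f z.1‖) *
          ‖iteratedFDeriv ℝ (n - i) g z.2‖ + ‖iteratedFDeriv ℝ i f z.1‖ *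
          (‖z.2‖ ^ k * ‖iteratedFDeriv ℝ (n - i) g z.2‖)) := by ring
      _ ≤ _ := by gcongr

@[simp] theorem tens_apply (f : 𝓢(D, ℂ)) (g : 𝓢(D', ℂ)) (z : D × D') :
    tens f g z = f z.1 * g z.2 := rfl

end Schwartz

/-! ### Fourier transformation along a factor -/

section PartialFourier

open scoped FourierTransform RealInnerProductSpace

variable {A W W' : Type} [NormedAddCommGroup A] [NormedSpace ℝ A]
  [NormedAddCommGroup W] [NormedSpace ℝ W] [NormedAddCommGroup W'] [NormedSpace ℝ W']
  [FiniteDimensional ℝ W] [MeasurableSpace W] [BorelSpace W]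
  (μ : Measure W) [μ.IsAddHaarMeasure]

/-- Restriction of a Schwartz function on a product to the slice `{a} × W`. -/
def slice {F : Type} [NormedAddCommGroup F] [NormedSpace ℝ F] (a : A) (f : 𝓢(A × W, F)) :
    𝓢(W, F) :=
  compCLM ℝ (g := fun y : W => (a, y))
    (by
      have h : (fun y : W => (a, y)) = fun y => ContinuousLinearMap.inr ℝ A W y + (a, 0) := by
        ext y <;> simp
      rw [h]
      fun_prop)
    ⟨1, 1, fun y => by simp [Prod.norm_def]; linarith [le_max_right ‖a‖ ‖y‖]⟩ f

@[simp] theorem slice_apply {F : Type} [NormedAddCommGroup F] [NormedSpace ℝ F] (a : A)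
    (f : 𝓢(A × W, F)) (y : W) : slice a f y = f (a, y) := rfl

theorem fderiv_slice {F : Type} [NormedAddCommGroup F] [NormedSpace ℝ F] (a : A)
    (f : 𝓢(A × W, F)) (y : W) :
    fderiv ℝ (slice a f) y = (fderiv ℝ f (a, y)).comp (ContinuousLinearMap.inr ℝ A W) :=
  ((f.hasFDerivAt (a, y)).comp y (hasFDerivAt_prodMk_right a y)).fderiv

/-- The integral over a slice of the norm is bounded by Schwartz seminorms, uniformly. -/
theorem exists_integral_slice_bound (F : Type) [NormedAddCommGroup F] [NormedSpace ℝ F] (k : ℕ) :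
    ∃ (s : Finset (ℕ × ℕ)) (C : ℝ), 0 ≤ C ∧ ∀ (f : 𝓢(A × W, F)) (a : A),
      ‖a‖ ^ k * ∫ y, ‖f (a, y)‖ ∂μ ≤ C * (s.sup (schwartzSeminormFamily ℝ (A × W) F)) f := by
  set N := μ.integrablePower
  set I := ∫ x : W, (1 + ‖x‖) ^ (-(N : ℝ)) ∂μ
  have hI : 0 ≤ I := integral_nonneg fun x => by positivity
  refine ⟨{(k, 0), (k + N, 0)}, 2 ^ N * I * 2, by positivity, fun f a => ?_⟩
  have h := integral_pow_mul_le_of_le_of_pow_mul_le (μ := μ) (k := 0)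
    (f := fun y : W => ‖a‖ ^ k • f (a, y)) (C₁ := SchwartzMap.seminorm ℝ k 0 f)
    (C₂ := SchwartzMap.seminorm ℝ (k + N) 0 f) (fun y => ?_) (fun y => ?_)
  · simp only [pow_zero, one_mul, norm_smul, norm_pow, norm_norm] at h
    rw [integral_const_mul] at h
    refine h.trans ?_
    have h1 : SchwartzMap.seminorm ℝ k 0 f ≤
        (({(k, 0), (k + N, 0)} : Finset (ℕ × ℕ)).sup (schwartzSeminormFamily ℝ (A × W) F)) f :=
      (Finset.le_sup (f := schwartzSeminormFamily ℝ (A × W) F)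
        (s := {(k, 0), (k + N, 0)}) (b := (k, 0)) (by simp) :) f
    have h2 : SchwartzMap.seminorm ℝ (k + N) 0 f ≤
        (({(k, 0), (k + N, 0)} : Finset (ℕ × ℕ)).sup (schwartzSeminormFamily ℝ (A × W) F)) f :=
      (Finset.le_sup (f := schwartzSeminormFamily ℝ (A × W) F)
        (s := {(k, 0), (k + N, 0)}) (b := (k + N, 0)) (by simp) :) f
    calc _ ≤ 2 ^ N * I * (_ + _) := mul_le_mul_of_nonneg_left (add_le_add h1 h2) (by positivity)
      _ = _ := by ring
  · rw [norm_smul, norm_pow, norm_norm]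
    refine le_trans ?_ (norm_pow_mul_le_seminorm ℝ f k (a, y))
    gcongr
    exact norm_fst_le (a, y)
  · rw [norm_smul, norm_pow, norm_norm]
    refine le_trans ?_ (norm_pow_mul_le_seminorm ℝ f (k + N) (a, y))
    rw [← mul_assoc, zero_add, pow_add, mul_comm (‖y‖ ^ _)]
    gcongr
    · exact norm_fst_le (a, y)
    · exact norm_snd_le (a, y)

theorem exists_integrable_bound_slice {F : Type} [NormedAddCommGroup F] [NormedSpace ℝ F]
    (f : 𝓢(A × W, F)) : ∃ b : W → ℝ, Integrable b μ ∧ ∀ a y, ‖f (a, y)‖ ≤ b y := by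
  refine ⟨_, (Measure.integrable_pow_neg_integrablePower μ).const_mul
    (2 ^ μ.integrablePower * (SchwartzMap.seminorm ℝ 0 0 f
      + SchwartzMap.seminorm ℝ (0 + μ.integrablePower) 0 f)), fun a y => ?_⟩
  have h := pow_mul_le_of_le_of_pow_mul_le (k := 0) (l := μ.integrablePower) (norm_nonneg y)
    (norm_nonneg (f (a, y))) (norm_le_seminorm ℝ f (a, y))
    (C₂ := SchwartzMap.seminorm ℝ (0 + μ.integrablePower) 0 f) ?_
  · simpa using h
  · refine le_trans ?_ (norm_pow_mul_le_seminorm ℝ f _ (a, y))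
    gcongr
    exact norm_snd_le (a, y)

variable (L : W →L[ℝ] W' →L[ℝ] ℝ)

/-- Fourier integral in the second variable, for the phase given by the bilinear map `L`. -/
def fibreFourierFun (F : Type) [NormedAddCommGroup F] [NormedSpace ℂ F] (f : 𝓢(A × W, F))
    (x : A × W') : F := VectorFourier.fourierIntegral 𝐞 μ L.toLinearMap₁₂ (fun y => f (x.1, y)) x.2

/-- The operator which computes the total derivative under the Fourier integral. -/
def fibreFourierDeriv (F : Type) [NormedAddCommGroup F] [NormedSpace ℂ F] :
    𝓢(A × W, F) →L[ℝ] 𝓢(A × W, A × W' →L[ℝ] F) :=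
  (postcompCLM ((ContinuousLinearMap.compL ℝ (A × W') (A × W) F).flip
    ((ContinuousLinearMap.inl ℝ A W).comp (ContinuousLinearMap.fst ℝ A W')))).comp
      (fderivCLM ℝ (A × W) F)
  + (postcompCLM (-(2 * Real.pi * Complex.I) • ContinuousLinearMap.id ℝ (A × W' →L[ℝ] F))).comp
    (smulRightCLM ℝ F (((ContinuousLinearMap.compL ℝ (A × W') W' ℝ).flip
      (ContinuousLinearMap.snd ℝ A W')).comp (L.comp (ContinuousLinearMap.snd ℝ A W))))

theorem fibreFourierDeriv_apply (F : Type) [NormedAddCommGroup F] [NormedSpace ℂ F]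
    (f : 𝓢(A × W, F)) (z : A × W) : fibreFourierDeriv (A := A) L F f z =
      (fderiv ℝ f z).comp ((ContinuousLinearMap.inl ℝ A W).comp (ContinuousLinearMap.fst ℝ A W'))
      + -(2 * Real.pi * Complex.I) •
        ((L z.2).comp (ContinuousLinearMap.snd ℝ A W')).smulRight (f z) := by
  rfl

theorem integrable_fibreFourier {F : Type} [NormedAddCommGroup F] [NormedSpace ℂ F]
    (f : 𝓢(A × W, F)) (x : A × W') :
    Integrable (fun y => 𝐞 (-L y x.2) • f (x.1, y)) μ := by
  have h : Continuous fun y => 𝐞 (-L y x.2) := by fun_prop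
  refine ((slice x.1 f).integrable (μ := μ)).norm.mono' ?_ (.of_forall fun y => ?_)
  · exact (h.smul (slice x.1 f).continuous).aestronglyMeasurable
  · simp [Circle.norm_smul]

theorem hasFDerivAt_fibreFourier_integrand {F : Type} [NormedAddCommGroup F] [NormedSpace ℂ F]
    (f : 𝓢(A × W, F)) (y : W) (x : A × W') :
    HasFDerivAt (fun x : A × W' => 𝐞 (-L y x.2) • f (x.1, y))
      (𝐞 (-L y x.2) • fibreFourierDeriv L F f (x.1, y)) x := by
  have h1 : HasFDerivAt (fun x : A × W' => (𝐞 (-L y x.2) : ℂ)) _ x :=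
    (Real.hasFDerivAt_fourierChar_neg_bilinear_right L y x.2).comp x hasFDerivAt_snd
  have h2 : HasFDerivAt (fun x : A × W' => f (x.1, y)) _ x :=
    (f.hasFDerivAt (x.1, y)).comp x
      ((hasFDerivAt_prodMk_left (𝕜 := ℝ) x.1 y).comp x hasFDerivAt_fst)
  refine (h1.smul h2).congr_fderiv ?_
  rw [fibreFourierDeriv_apply]
  refine ContinuousLinearMap.ext fun v => ?_
  change (𝐞 (-L y x.2) : ℂ) • fderiv ℝ f (x.1, y) (v.1, 0)
    + ((-2 * Real.pi * Complex.I * 𝐞 (-L y x.2)) • ((L y v.2 : ℝ) : ℂ)) • f (x.1, y)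
    = (𝐞 (-L y x.2) : ℂ) • (fderiv ℝ f (x.1, y) (v.1, 0)
      + -(2 * Real.pi * Complex.I) • (L y v.2 • f (x.1, y)))
  rw [smul_add, ← Complex.coe_smul (L y v.2), smul_smul, smul_smul, smul_eq_mul]
  congr 2
  ring

/-- Differentiation under the integral; the derivative is again a Fourier integral, of a Schwartz
function with values in linear maps. -/
theorem hasFDerivAt_fibreFourierFun (F : Type) [NormedAddCommGroup F] [NormedSpace ℂ F]
    [CompleteSpace F] (f : 𝓢(A × W, F)) (x : A × W') :
    HasFDerivAt (fibreFourierFun μ L F f)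
      (fibreFourierFun μ L (A × W' →L[ℝ] F) (fibreFourierDeriv L F f) x) x := by
  obtain ⟨b, hb, hbd⟩ := exists_integrable_bound_slice μ (fibreFourierDeriv (A := A) L F f)
  have h1 : ∀ᵐ y ∂μ, ∀ x ∈ (Set.univ : Set (A × W')),
      ‖𝐞 (-L y x.2) • fibreFourierDeriv L F f (x.1, y)‖ ≤ b y :=
    .of_forall fun y x _ => (Circle.norm_smul _ _).trans_le (hbd _ _)
  have h2 : ∀ᵐ y ∂μ, ∀ x ∈ (Set.univ : Set (A × W')),
      HasFDerivAt (fun x : A × W' => 𝐞 (-L y x.2) • f (x.1, y))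
      (𝐞 (-L y x.2) • fibreFourierDeriv L F f (x.1, y)) x :=
    .of_forall fun y x _ => hasFDerivAt_fibreFourier_integrand L f y x
  have h3 := integrable_fibreFourier μ L f x
  have h4 := (integrable_fibreFourier μ L (fibreFourierDeriv L F f) x).aestronglyMeasurable
  have h5 : ∀ᶠ x in nhds x, AEStronglyMeasurable (fun y => 𝐞 (-L y x.2) • f (x.1, y)) μ :=
    .of_forall fun x => (integrable_fibreFourier μ L f x).aestronglyMeasurable
  have key := hasFDerivAt_integral_of_dominated_of_fderiv_le (𝕜 := ℝ) Filter.univ_mem h5 h3 h4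
    h1 hb h2
  exact key

/-- Integration by parts: differentiation along the fibre becomes multiplication by the frequency.
-/
theorem fibreFourierFun_deriv_fibre {F : Type} [NormedAddCommGroup F] [NormedSpace ℂ F]
    (f : 𝓢(A × W, F)) (x : A × W') :
    2 * Real.pi * ‖L.flip x.2‖ * ‖fibreFourierFun μ L F f x‖ =
      ‖fibreFourierFun μ L (W →L[ℝ] F)
        (postcompCLM ((ContinuousLinearMap.compL ℝ W (A × W) F).flip
          (ContinuousLinearMap.inr ℝ A W)) (fderivCLM ℝ (A × W) F f)) x‖ := by
  have h := VectorFourier.fourierIntegral_fderiv (μ := μ) (E := F) L (f := slice x.1 f)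
    ((slice x.1 f).integrable) (slice x.1 f).differentiable
    (by simpa using! (fderivCLM ℝ W F (slice x.1 f)).integrable (μ := μ))
  have h2 := congrArg norm (congrFun h x.2)
  rw [VectorFourier.norm_fourierSMulRight] at h2
  simp only [neg_apply, norm_neg] at h2
  rw [fibreFourierFun, fibreFourierFun]
  refine h2.symm.trans ?_
  congr 2
  ext1 y
  rw [fderiv_slice]
  rfl

variable (A) in
/-- Decay in the frequency: the Fourier integral of the derivative along the fibre supplies one
factor of the frequency at a time. -/
theorem exists_pow_snd_mul_fibreFourierFun_le {K : ℝ} (hL : ∀ w', ‖w'‖ ≤ K * ‖L.flip w'‖) (k : ℕ) :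
    ∀ (F : Type) [NormedAddCommGroup F] [NormedSpace ℂ F],
      ∃ (s : Finset (ℕ × ℕ)) (C : ℝ), 0 ≤ C ∧ ∀ (f : 𝓢(A × W, F)) (x : A × W'),
        ‖x.2‖ ^ k * ‖fibreFourierFun μ L F f x‖
          ≤ C * (s.sup (schwartzSeminormFamily ℝ (A × W) F)) f := by
  induction k with
  | zero =>
    intro F _ _
    obtain ⟨s, C, hC, h⟩ := exists_integral_slice_bound (A := A) μ F 0
    refine ⟨s, C, hC, fun f x => le_trans ?_ (h f x.1)⟩
    rw [pow_zero, pow_zero, one_mul, one_mul]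
    exact VectorFourier.norm_fourierIntegral_le_integral_norm _ _ _ _ _
  | succ k ih =>
    intro F _ _
    obtain ⟨s, C, hC, h⟩ := ih (W →L[ℝ] F)
    obtain ⟨t, C', hC', h'⟩ := exists_seminorm_bound_comp
      ((postcompCLM ((ContinuousLinearMap.compL ℝ W (A × W) F).flip
          (ContinuousLinearMap.inr ℝ A W))).comp (fderivCLM ℝ (A × W) F)) s
    refine ⟨t, |K| * (C * C'), by positivity, fun f x => ?_⟩
    have e := fibreFourierFun_deriv_fibre μ L f x
    have hpi : 1 ≤ 2 * Real.pi := by linarith [Real.pi_gt_three]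
    have e2 : ‖x.2‖ * ‖fibreFourierFun μ L F f x‖ ≤ |K| * ‖fibreFourierFun μ L (W →L[ℝ] F)
        (postcompCLM ((ContinuousLinearMap.compL ℝ W (A × W) F).flip
          (ContinuousLinearMap.inr ℝ A W)) (fderivCLM ℝ (A × W) F f)) x‖ := by
      rw [← e]
      calc ‖x.2‖ * ‖fibreFourierFun μ L F f x‖
          ≤ (|K| * ‖L.flip x.2‖) * ‖fibreFourierFun μ L F f x‖ := by
            gcongr
            exact (hL _).trans (mul_le_mul_of_nonneg_right (le_abs_self K) (norm_nonneg _))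
        _ = |K| * (1 * ‖L.flip x.2‖ * ‖fibreFourierFun μ L F f x‖) := by ring
        _ ≤ _ := by gcongr
    set g := postcompCLM ((ContinuousLinearMap.compL ℝ W (A × W) F).flip
          (ContinuousLinearMap.inr ℝ A W)) (fderivCLM ℝ (A × W) F f)
    have e3 : (s.sup (schwartzSeminormFamily ℝ (A × W) (W →L[ℝ] F))) g
        ≤ C' * (t.sup (schwartzSeminormFamily ℝ (A × W) F)) f := h' f
    calc ‖x.2‖ ^ (k + 1) * ‖fibreFourierFun μ L F f x‖
        = ‖x.2‖ ^ k * (‖x.2‖ * ‖fibreFourierFun μ L F f x‖) := by ring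
      _ ≤ ‖x.2‖ ^ k * (|K| * ‖fibreFourierFun μ L (W →L[ℝ] F) g x‖) :=
          mul_le_mul_of_nonneg_left e2 (by positivity)
      _ = |K| * (‖x.2‖ ^ k * ‖fibreFourierFun μ L (W →L[ℝ] F) g x‖) := by ring
      _ ≤ |K| * (C * (C' * (t.sup (schwartzSeminormFamily ℝ (A × W) F)) f)) :=
          mul_le_mul_of_nonneg_left ((h g x).trans (mul_le_mul_of_nonneg_left e3 hC))
            (abs_nonneg K)
      _ = _ := by ring

/-- Fourier transformation along the factor `W`, as an operator on Schwartz spaces. -/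
def fibreFourier {K : ℝ} (hL : ∀ w', ‖w'‖ ≤ K * ‖L.flip w'‖) :
    𝓢(A × W, ℂ) →L[ℂ] 𝓢(A × W', ℂ) :=
  clmOfHasFDerivAt (fun F _ _ _ => fibreFourierFun μ L F)
    (fun F _ _ _ => fibreFourierDeriv L F)
    (fun F _ _ _ f x => hasFDerivAt_fibreFourierFun μ L F f x)
    (fun F _ _ _ k => by
      obtain ⟨s, C, hC, h⟩ := exists_pow_snd_mul_fibreFourierFun_le A μ L hL k F
      obtain ⟨s', C', hC', h'⟩ := exists_integral_slice_bound (A := A) μ F k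
      refine ⟨s ∪ s', C + C', by positivity, fun f x => ?_⟩
      have hx : ‖x‖ ^ k ≤ ‖x.2‖ ^ k + ‖x.1‖ ^ k := by
        rw [Prod.norm_def]
        rcases max_cases ‖x.1‖ ‖x.2‖ with h | h <;> rw [h.1] <;> simp [pow_nonneg]
      have m1 : (s.sup (schwartzSeminormFamily ℝ (A × W) F)) f
          ≤ ((s ∪ s').sup (schwartzSeminormFamily ℝ (A × W) F)) f :=
        (Finset.sup_mono (f := schwartzSeminormFamily ℝ (A × W) F) Finset.subset_union_left :) f
      have m2 : (s'.sup (schwartzSeminormFamily ℝ (A × W) F)) f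
          ≤ ((s ∪ s').sup (schwartzSeminormFamily ℝ (A × W) F)) f :=
        (Finset.sup_mono (f := schwartzSeminormFamily ℝ (A × W) F) Finset.subset_union_right :) f
      calc ‖x‖ ^ k * ‖fibreFourierFun μ L F f x‖
          ≤ (‖x.2‖ ^ k + ‖x.1‖ ^ k) * ‖fibreFourierFun μ L F f x‖ := by gcongr
        _ = ‖x.2‖ ^ k * ‖fibreFourierFun μ L F f x‖
            + ‖x.1‖ ^ k * ‖fibreFourierFun μ L F f x‖ := by ring
        _ ≤ C * (s.sup (schwartzSeminormFamily ℝ (A × W) F)) f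
            + ‖x.1‖ ^ k * ∫ y, ‖f (x.1, y)‖ ∂μ :=
            add_le_add (h f x) (mul_le_mul_of_nonneg_left
              (VectorFourier.norm_fourierIntegral_le_integral_norm _ _ _ _ _) (by positivity))
        _ ≤ C * ((s ∪ s').sup (schwartzSeminormFamily ℝ (A × W) F)) f
            + C' * ((s ∪ s').sup (schwartzSeminormFamily ℝ (A × W) F)) f :=
            add_le_add (mul_le_mul_of_nonneg_left m1 hC)
              ((h' f x.1).trans (mul_le_mul_of_nonneg_left m2 hC'))
        _ = _ := by ring)
    (fun f g x => by
      have h := integral_add (integrable_fibreFourier μ L f x) (integrable_fibreFourier μ L g x)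
      simp only [← smul_add] at h
      exact h)
    (fun c f x => by
      have h := integral_smul (μ := μ) c (fun y => 𝐞 (-L y x.2) • f (x.1, y))
      refine Eq.trans ?_ h
      refine integral_congr_ae (.of_forall fun y => ?_)
      exact smul_comm (𝐞 (-L y x.2)) c (f (x.1, y)))

theorem fibreFourier_apply {K : ℝ} (hL : ∀ w', ‖w'‖ ≤ K * ‖L.flip w'‖) (f : 𝓢(A × W, ℂ))
    (x : A × W') : fibreFourier μ L hL f x = ∫ y, 𝐞 (-L y x.2) • f (x.1, y) ∂μ := rfl

end PartialFourier

/-! ### Linear changes of variables -/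

section Haar

variable {E F : Type} [NormedAddCommGroup E] [NormedSpace ℝ E] [FiniteDimensional ℝ E]
  [MeasurableSpace E] [BorelSpace E] [NormedAddCommGroup F] [NormedSpace ℝ F]
  [FiniteDimensional ℝ F] [MeasurableSpace F] [BorelSpace F]
  (μ : Measure E) [μ.IsAddHaarMeasure] (ν : Measure F) [ν.IsAddHaarMeasure]

/-- The factor by which a linear isomorphism changes Haar measures. -/
theorem exists_map_linearEquiv_eq_smul (e : E ≃L[ℝ] F) :
    ∃ c : ℝ≥0∞, c ≠ 0 ∧ c ≠ ⊤ ∧ μ.map e = c • ν := by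
  have := FiniteDimensional.proper_real F
  have := e.isAddHaarMeasure_map μ
  refine ⟨(Measure.addHaarScalarFactor (μ.map e) ν : ℝ≥0∞), ?_, by simp, ?_⟩
  · exact_mod_cast (Measure.addHaarScalarFactor_pos_of_isAddHaarMeasure (μ.map e) ν).ne'
  · exact Measure.isAddLeftInvariant_eq_smul _ _

/-- The factor by which a linear isomorphism changes integrals. -/
theorem exists_integral_comp_linearEquiv (e : E ≃L[ℝ] F) :
    ∃ c : ℝ, 0 < c ∧ ∀ f : F → ℂ, ∫ x, f (e x) ∂μ = c * ∫ y, f y ∂ν := by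
  obtain ⟨c, h0, h1, h⟩ := exists_map_linearEquiv_eq_smul μ ν e
  refine ⟨c.toReal, ENNReal.toReal_pos h0 h1, fun f => ?_⟩
  have h2 := e.toHomeomorph.measurableEmbedding.integral_map (μ := μ) f
  have h3 : μ.map e.toHomeomorph = c • ν := h
  rw [h3, integral_smul_measure] at h2
  rw [← Complex.real_smul]
  exact h2.symm

theorem integrable_comp_linearEquiv_iff (e : E ≃L[ℝ] F) {f : F → ℂ} :
    Integrable (fun x => f (e x)) μ ↔ Integrable f ν := by
  obtain ⟨c, h0, h1, h⟩ := exists_map_linearEquiv_eq_smul μ ν e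
  have h2 := e.toHomeomorph.measurableEmbedding.integrable_map_iff (μ := μ) (g := f)
  have h3 : μ.map e.toHomeomorph = c • ν := h
  rw [h3, integrable_smul_measure h0 h1] at h2
  exact h2.symm

end Haar

/-! ### The partial Fourier transformation without factors `2π` in the exponent -/

section FT

open scoped FourierTransform RealInnerProductSpace

variable {E A W : Type} [NormedAddCommGroup E] [NormedSpace ℝ E]
  [NormedAddCommGroup A] [NormedSpace ℝ A]
  [NormedAddCommGroup W] [InnerProductSpace ℝ W] [FiniteDimensional ℝ W] [MeasurableSpace W]
  [BorelSpace W]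

/-- The bilinear map `⟪x, y⟫ / 2π`. -/
def innerDivTwoPi (W : Type) [NormedAddCommGroup W] [InnerProductSpace ℝ W] :
    W →L[ℝ] W →L[ℝ] ℝ := (2 * Real.pi)⁻¹ • innerSL ℝ

theorem innerDivTwoPi_apply (x y : W) : innerDivTwoPi W x y = (2 * Real.pi)⁻¹ * ⟪x, y⟫ := rfl

theorem norm_le_innerDivTwoPi (w : W) : ‖w‖ ≤ 2 * Real.pi * ‖(innerDivTwoPi W).flip w‖ := by
  have h : (innerDivTwoPi W).flip w = (2 * Real.pi)⁻¹ • innerSL ℝ w := by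
    ext y
    simp [innerDivTwoPi_apply, real_inner_comm]
  rw [h, norm_smul, innerSL_apply_norm, Real.norm_of_nonneg (by positivity), ← mul_assoc,
    mul_inv_cancel₀ (by positivity), one_mul]

/-- `(a, w) ↦ ∫ exp(-i⟪w, y⟫) f(a, y) dy` on `𝓢(A × W)`. -/
def prodFT : 𝓢(A × W, ℂ) →L[ℂ] 𝓢(A × W, ℂ) :=
  fibreFourier volume (innerDivTwoPi W) norm_le_innerDivTwoPi

theorem prodFT_apply (f : 𝓢(A × W, ℂ)) (x : A × W) :
    prodFT f x = ∫ y : W, Complex.exp (-(Complex.I * ⟪y, x.2⟫)) * f (x.1, y) := by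
  rw [prodFT, fibreFourier_apply]
  congr 1
  ext y
  rw [Circle.smul_def, Real.fourierChar_apply, innerDivTwoPi_apply, smul_eq_mul]
  congr 2
  have : (Real.pi : ℂ) ≠ 0 := by simp [Real.pi_ne_zero]
  push_cast
  field_simp

theorem prodFT_eq_fourier (f : 𝓢(A × W, ℂ)) (a : A) (w : W) :
    prodFT f (a, w) = 𝓕 (slice a f) ((2 * Real.pi)⁻¹ • w) := by
  rw [fourier_coe, Real.fourier_eq, prodFT, fibreFourier_apply]
  simp only [innerDivTwoPi_apply, real_inner_smul_right, slice_apply]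

/-- The normalization of the inverse transformation. -/
def ftConst (W : Type) [NormedAddCommGroup W] [InnerProductSpace ℝ W] : ℝ :=
  |((2 * Real.pi) ^ Module.finrank ℝ W)⁻¹|

theorem ftConst_pos : 0 < ftConst W := by unfold ftConst; positivity

/-- Fourier inversion along the factor `W`. -/
theorem ftConst_mul_integral_prodFT (f : 𝓢(A × W, ℂ)) (a : A) (y : W) :
    ftConst W * ∫ w : W, Complex.exp (Complex.I * ⟪w, y⟫) * prodFT f (a, w) = f (a, y) := by
  have h1 := congrArg (fun g : 𝓢(W, ℂ) => g y) (FourierTransform.fourierInv_fourier_eq (F := 𝓢(W, ℂ)) (slice a f))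
  simp only [slice_apply] at h1
  rw [← h1, fourierInv_coe, Real.fourierInv_eq']
  have h2 := Measure.integral_comp_smul (volume : Measure W)
    (fun w => Complex.exp (Complex.I * ⟪w, y⟫) * prodFT f (a, w)) (2 * Real.pi)
  rw [← ftConst, Complex.real_smul] at h2
  rw [← h2]
  congr 1
  ext w
  rw [prodFT_eq_fourier, smul_smul, inv_mul_cancel₀ (by positivity), one_smul, smul_eq_mul]
  congr 2
  rw [real_inner_smul_left]
  push_cast
  ring

/-- Reflection in the second variable. -/
def reflSnd (A W : Type) [NormedAddCommGroup A] [NormedSpace ℝ A] [NormedAddCommGroup W]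
    [NormedSpace ℝ W] : (A × W) ≃L[ℝ] (A × W) :=
  (ContinuousLinearEquiv.refl ℝ A).prodCongr (ContinuousLinearEquiv.neg ℝ)

@[simp] theorem reflSnd_apply (x : A × W) : reflSnd A W x = (x.1, -x.2) := rfl

/-- The inverse of `prodFT`. -/
def prodFTInv : 𝓢(A × W, ℂ) →L[ℂ] 𝓢(A × W, ℂ) :=
  (ftConst W : ℂ) • (compCLMOfContinuousLinearEquiv ℂ (reflSnd A W)).comp prodFT

theorem prodFTInv_eq (f : 𝓢(A × W, ℂ)) (x : A × W) :
    prodFTInv f x = ftConst W * prodFT f (x.1, -x.2) := rfl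

theorem prodFTInv_apply (f : 𝓢(A × W, ℂ)) (x : A × W) :
    prodFTInv f x = ftConst W * ∫ w : W, Complex.exp (Complex.I * ⟪w, x.2⟫) * f (x.1, w) := by
  rw [prodFTInv_eq, prodFT_apply]
  simp

theorem prodFTInv_prodFT (f : 𝓢(A × W, ℂ)) : prodFTInv (prodFT f) = f := by
  ext x
  rw [prodFTInv_apply, ftConst_mul_integral_prodFT]

theorem prodFT_prodFTInv (f : 𝓢(A × W, ℂ)) : prodFT (prodFTInv f) = f := by
  ext x
  have h := ftConst_mul_integral_prodFT f x.1 x.2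
  rw [← integral_const_mul, ← integral_neg_eq_self] at h
  rw [prodFT_apply]
  refine Eq.trans ?_ h
  congr 1
  ext y
  rw [prodFTInv_eq]
  simp only [inner_neg_left, Complex.ofReal_neg]
  ring_nf

section Measure

variable [FiniteDimensional ℝ A] [MeasurableSpace A] [BorelSpace A] [SecondCountableTopology A]
  (ν : Measure A) [ν.IsAddHaarMeasure]

theorem integral_prodFT_mul (f g : 𝓢(A × W, ℂ)) :
    ∫ x, prodFT f x * g x ∂(ν.prod volume) = ∫ x, f x * prodFT g x ∂(ν.prod volume) := by
  have : (ν.prod (volume : Measure W)).IsAddHaarMeasure := Measure.prod.instIsAddHaarMeasure _ _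
  have i1 : Integrable (fun x => prodFT f x * g x) (ν.prod volume) :=
    (SchwartzMap.pairing (ContinuousLinearMap.mul ℂ ℂ) (prodFT f) g).integrable
  have i2 : Integrable (fun x => f x * prodFT g x) (ν.prod volume) :=
    (SchwartzMap.pairing (ContinuousLinearMap.mul ℂ ℂ) f (prodFT g)).integrable
  rw [integral_prod _ i1, integral_prod _ i2]
  congr 1
  ext a
  have h := VectorFourier.integral_fourierIntegral_smul_eq_flip (μ := volume) (ν := volume)
    (L := (innerDivTwoPi W).toLinearMap₁₂) (f := slice a f) (g := slice a g)
    Real.continuous_fourierChar (by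
      change Continuous fun p : W × W => innerDivTwoPi W p.1 p.2
      fun_prop) (slice a f).integrable (slice a g).integrable
  have hflip : (innerDivTwoPi W).toLinearMap₁₂.flip = (innerDivTwoPi W).toLinearMap₁₂ := by
    ext x y
    change innerDivTwoPi W y x = innerDivTwoPi W x y
    simp [innerDivTwoPi_apply, real_inner_comm]
  rw [hflip] at h
  exact h

end Measure

variable (e : E ≃L[ℝ] A × W)

/-- Fourier transformation along the second factor of a decomposition `e : E ≃ A × W`. -/
def FT : 𝓢(E, ℂ) →L[ℂ] 𝓢(E, ℂ) :=
  (compCLMOfContinuousLinearEquiv ℂ e).comp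
    (prodFT.comp (compCLMOfContinuousLinearEquiv ℂ e.symm))

/-- The inverse of `FT`. -/
def FTInv : 𝓢(E, ℂ) →L[ℂ] 𝓢(E, ℂ) :=
  (compCLMOfContinuousLinearEquiv ℂ e).comp
    (prodFTInv.comp (compCLMOfContinuousLinearEquiv ℂ e.symm))

theorem FT_apply (f : 𝓢(E, ℂ)) (x : E) :
    FT e f x = ∫ y : W, Complex.exp (-(Complex.I * ⟪y, (e x).2⟫)) * f (e.symm ((e x).1, y)) :=
  prodFT_apply _ _

theorem FTInv_apply (f : 𝓢(E, ℂ)) (x : E) :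
    FTInv e f x = ftConst W *
      ∫ y : W, Complex.exp (Complex.I * ⟪y, (e x).2⟫) * f (e.symm ((e x).1, y)) :=
  prodFTInv_apply _ _

theorem FTInv_FT (f : 𝓢(E, ℂ)) : FTInv e (FT e f) = f := by
  ext x
  have h : compCLMOfContinuousLinearEquiv ℂ e.symm (FT e f)
      = prodFT (compCLMOfContinuousLinearEquiv ℂ e.symm f) := by ext; simp [FT]
  change prodFTInv (compCLMOfContinuousLinearEquiv ℂ e.symm (FT e f)) (e x) = f x
  rw [h, prodFTInv_prodFT]
  simp

theorem FT_FTInv (f : 𝓢(E, ℂ)) : FT e (FTInv e f) = f := by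
  ext x
  have h : compCLMOfContinuousLinearEquiv ℂ e.symm (FTInv e f)
      = prodFTInv (compCLMOfContinuousLinearEquiv ℂ e.symm f) := by ext; simp [FTInv]
  change prodFT (compCLMOfContinuousLinearEquiv ℂ e.symm (FTInv e f)) (e x) = f x
  rw [h, prodFT_prodFTInv]
  simp

/-- Complex conjugation of Schwartz functions. -/
def conjSchwartz (f : 𝓢(E, ℂ)) : 𝓢(E, ℂ) :=
  SchwartzMap.postcompCLM (𝕜 := ℝ) (Complex.conjCLE : ℂ →L[ℝ] ℂ) f

@[simp] theorem conjSchwartz_apply (f : 𝓢(E, ℂ)) (x : E) :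
    conjSchwartz f x = (starRingEnd ℂ) (f x) := rfl

theorem conj_FT (f : 𝓢(E, ℂ)) (x : E) :
    ftConst W * (starRingEnd ℂ) (FT e f x) = FTInv e (conjSchwartz f) x := by
  rw [FT_apply, FTInv_apply, ← integral_conj]
  congr 2
  ext y
  rw [map_mul, ← Complex.exp_conj]
  simp

section Measure

variable [FiniteDimensional ℝ A] [MeasurableSpace A] [BorelSpace A] [SecondCountableTopology A]
  [FiniteDimensional ℝ E] [MeasurableSpace E] [BorelSpace E]
  (μ : Measure E) [μ.IsAddHaarMeasure]

theorem integral_FT_mul (f g : 𝓢(E, ℂ)) : ∫ x, FT e f x * g x ∂μ = ∫ x, f x * FT e g x ∂μ := by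
  let ν : Measure A := Measure.addHaar
  have : (ν.prod (volume : Measure W)).IsAddHaarMeasure := Measure.prod.instIsAddHaarMeasure _ _
  obtain ⟨c, hc, h⟩ := exists_integral_comp_linearEquiv μ (ν.prod (volume : Measure W)) e
  have h1 := h fun z => prodFT (compCLMOfContinuousLinearEquiv ℂ e.symm f) z
    * (compCLMOfContinuousLinearEquiv ℂ e.symm g) z
  have h2 := h fun z => (compCLMOfContinuousLinearEquiv ℂ e.symm f) z
    * prodFT (compCLMOfContinuousLinearEquiv ℂ e.symm g) z
  rw [integral_prodFT_mul] at h1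
  simpa [FT] using h1.trans h2.symm

theorem integral_FTInv_mul (f g : 𝓢(E, ℂ)) :
    ∫ x, FTInv e f x * g x ∂μ = ∫ x, f x * FTInv e g x ∂μ := by
  conv_lhs => rw [← FT_FTInv e g]
  conv_rhs => rw [← FT_FTInv e f]
  exact (integral_FT_mul e μ _ _).symm

theorem integral_FT_mul_conj_FT (f g : 𝓢(E, ℂ)) :
    ftConst W * ∫ x, FT e f x * (starRingEnd ℂ) (FT e g x) ∂μ
      = ∫ x, f x * (starRingEnd ℂ) (g x) ∂μ := by
  have h := integral_FTInv_mul e μ (FT e f) (conjSchwartz g)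
  rw [FTInv_FT] at h
  simp only [conjSchwartz_apply] at h
  rw [h, ← integral_const_mul]
  congr 1
  ext x
  rw [← conj_FT]
  ring

end Measure

end FT

/-! ### Integration along a factor, composition of Schwartz kernels -/

section FibreIntegral

variable {A W : Type} [NormedAddCommGroup A] [NormedSpace ℝ A]
  [NormedAddCommGroup W] [NormedSpace ℝ W] [FiniteDimensional ℝ W] [MeasurableSpace W]
  [BorelSpace W] (μ : Measure W) [μ.IsAddHaarMeasure]

theorem norm_le_norm_flip_apply (φ : W →L[ℝ] ℝ) :
    ‖φ‖ ≤ 1 * ‖(ContinuousLinearMap.apply ℝ ℝ).flip φ‖ := by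
  rw [one_mul]
  exact le_of_eq rfl

/-- Integration over the second variable: the Fourier transform along the fibre at frequency `0`. -/
def fibreIntegral : 𝓢(A × W, ℂ) →L[ℂ] 𝓢(A, ℂ) :=
  (compCLM ℂ (g := fun a : A => (a, (0 : W →L[ℝ] ℝ)))
    (ContinuousLinearMap.inl ℝ A (W →L[ℝ] ℝ)).hasTemperateGrowth
    ⟨1, 1, fun a => by simp [Prod.norm_def]⟩).comp
  (fibreFourier μ (ContinuousLinearMap.apply ℝ ℝ) norm_le_norm_flip_apply)

theorem fibreIntegral_apply (f : 𝓢(A × W, ℂ)) (a : A) :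
    fibreIntegral μ f a = ∫ y, f (a, y) ∂μ := by
  change fibreFourier μ (ContinuousLinearMap.apply ℝ ℝ) norm_le_norm_flip_apply f (a, 0) = _
  rw [fibreFourier_apply]
  simp

end FibreIntegral

section Kernels

variable {X : Type} [NormedAddCommGroup X] [NormedSpace ℝ X] [FiniteDimensional ℝ X]
  [MeasureSpace X] [BorelSpace X] [SecondCountableTopology X]
  [(volume : Measure X).IsAddHaarMeasure]

instance : (volume : Measure (X × X)).IsAddHaarMeasure :=
  Measure.prod.instIsAddHaarMeasure (volume : Measure X) volume

variable (X) in
/-- The map `((s, t), r) ↦ ((s, r), (r, t))`. -/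
def compPath : (X × X) × X →L[ℝ] (X × X) × (X × X) :=
  ((((ContinuousLinearMap.fst ℝ X X).comp (ContinuousLinearMap.fst ℝ (X × X) X)).prod
    (ContinuousLinearMap.snd ℝ (X × X) X))).prod
  ((ContinuousLinearMap.snd ℝ (X × X) X).prod
    ((ContinuousLinearMap.snd ℝ X X).comp (ContinuousLinearMap.fst ℝ (X × X) X)))

@[simp] theorem compPath_apply (z : (X × X) × X) :
    compPath X z = ((z.1.1, z.2), (z.2, z.1.2)) := rfl

/-- Pullback along `compPath`. -/
def compPathCLM : 𝓢((X × X) × (X × X), ℂ) →L[ℂ] 𝓢((X × X) × X, ℂ) :=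
  compCLM ℂ (compPath X).hasTemperateGrowth ⟨1, 1, fun z => by
    simp only [compPath_apply, Prod.norm_def, pow_one, one_mul]
    have h1 := le_max_left (max ‖z.1.1‖ ‖z.2‖) (max ‖z.2‖ ‖z.1.2‖)
    have h2 := le_max_right (max ‖z.1.1‖ ‖z.2‖) (max ‖z.2‖ ‖z.1.2‖)
    have h3 := le_max_left ‖z.1.1‖ ‖z.2‖
    have h4 := le_max_right ‖z.1.1‖ ‖z.2‖
    have h5 := le_max_right ‖z.2‖ ‖z.1.2‖
    refine max_le (max_le ?_ ?_) ?_ <;> linarith⟩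

/-- Composition of Schwartz kernels, `(K ∘ L)(s, t) = ∫ K(s, r) L(r, t) dr`. -/
def compK : 𝓢(X × X, ℂ) →ₗ[ℂ] 𝓢(X × X, ℂ) →ₗ[ℂ] 𝓢(X × X, ℂ) :=
  LinearMap.mk₂ ℂ (fun K L => fibreIntegral volume (compPathCLM (tens K L)))
    (fun K K' L => by
      rw [← map_add, ← map_add]; congr 2; ext z; simp [add_mul])
    (fun c K L => by
      rw [← map_smul, ← map_smul]; congr 2; ext z; simp [mul_assoc])
    (fun K L L' => by
      rw [← map_add, ← map_add]; congr 2; ext z; simp [mul_add])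
    (fun c K L => by
      rw [← map_smul, ← map_smul]; congr 2; ext z; simp [mul_left_comm])

theorem compK_apply (K L : 𝓢(X × X, ℂ)) (z : X × X) :
    compK K L z = ∫ r, K (z.1, r) * L (r, z.2) :=
  fibreIntegral_apply volume (compPathCLM (tens K L)) z

/-- The slice `s ↦ K(s, t)`. -/
def sliceFst (t : X) (K : 𝓢(X × X, ℂ)) : 𝓢(X, ℂ) :=
  slice t (compCLMOfContinuousLinearEquiv ℂ (ContinuousLinearEquiv.prodComm ℝ X X) K)

@[simp] theorem sliceFst_apply (t : X) (K : 𝓢(X × X, ℂ)) (s : X) : sliceFst t K s = K (s, t) := rfl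

/-- The adjoint kernel `K*(s, t) = conj K(t, s)`. -/
def adjK (K : 𝓢(X × X, ℂ)) : 𝓢(X × X, ℂ) :=
  conjSchwartz (compCLMOfContinuousLinearEquiv ℂ (ContinuousLinearEquiv.prodComm ℝ X X) K)

@[simp] theorem adjK_apply (K : 𝓢(X × X, ℂ)) (z : X × X) :
    adjK K z = (starRingEnd ℂ) (K (z.2, z.1)) := rfl

theorem adjK_compK (K L : 𝓢(X × X, ℂ)) : adjK (compK K L) = compK (adjK L) (adjK K) := by
  ext z
  rw [adjK_apply, compK_apply, compK_apply, ← integral_conj]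
  congr 1
  ext r
  simp [mul_comm]

theorem compK_assoc (K L N : 𝓢(X × X, ℂ)) : compK (compK K L) N = compK K (compK L N) := by
  ext z
  simp only [compK_apply, ← integral_mul_const, ← integral_const_mul]
  rw [integral_integral_swap]
  · congr 1; ext r; congr 1; ext r'; ring
  · -- the integrand in `(r', r)` is `L` times bounded Schwartz slices
    have h : Integrable (fun p : X × X => L (p.2, p.1) * (K (z.1, p.2) * N (p.1, z.2)))
        (volume.prod volume) := by
      have h0 := (compCLMOfContinuousLinearEquiv ℂ (ContinuousLinearEquiv.prodComm ℝ X X) L).integrable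
        (μ := volume.prod volume)
      refine h0.mul_bdd (c := SchwartzMap.seminorm ℝ 0 0 K * SchwartzMap.seminorm ℝ 0 0 N) ?_
        (.of_forall fun p => ?_)
      · exact Continuous.aestronglyMeasurable (by fun_prop)
      · rw [norm_mul]
        gcongr
        · exact norm_le_seminorm ℝ K _
        · exact norm_le_seminorm ℝ N _
    refine h.congr (.of_forall fun p => ?_)
    simp only [Function.uncurry]
    ring

/-! ### Hilbert–Schmidt kernels -/

theorem norm_toLp_sq {E : Type} [NormedAddCommGroup E] [NormedSpace ℝ E] [FiniteDimensional ℝ E]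
    [MeasurableSpace E] [BorelSpace E] (μ : Measure E) [μ.HasTemperateGrowth] (f : 𝓢(E, ℂ)) :
    ‖f.toLp 2 μ‖ ^ 2 = ∫ x, ‖f x‖ ^ 2 ∂μ := by
  have h := inner_toL2_toL2_eq f f μ
  rw [inner_self_eq_norm_sq_to_K] at h
  have h2 : ∀ x, inner ℂ (f x) (f x) = ((‖f x‖ ^ 2 : ℝ) : ℂ) := fun x => by
    rw [inner_self_eq_norm_sq_to_K]; simp
  simp only [h2] at h
  rw [integral_complex_ofReal] at h
  refine Complex.ofReal_injective (Eq.trans ?_ h)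
  push_cast
  rfl

theorem integrable_norm_sq {E : Type} [NormedAddCommGroup E] [NormedSpace ℝ E]
    [FiniteDimensional ℝ E] [MeasurableSpace E] [BorelSpace E] (μ : Measure E)
    [μ.HasTemperateGrowth] (f : 𝓢(E, ℂ)) : Integrable (fun x => ‖f x‖ ^ 2) μ :=
  (memLp_two_iff_integrable_sq_norm f.continuous.aestronglyMeasurable).1 (f.memLp 2 μ)

theorem norm_compK_apply_sq_le (K L : 𝓢(X × X, ℂ)) (z : X × X) :
    ‖compK K L z‖ ^ 2 ≤ (∫ r, ‖K (z.1, r)‖ ^ 2) * ∫ r, ‖L (r, z.2)‖ ^ 2 := by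
  have h := norm_inner_le_norm (𝕜 := ℂ) ((conjSchwartz (slice z.1 K)).toLp 2 volume)
    ((sliceFst z.2 L).toLp 2 volume)
  have hi := inner_toL2_toL2_eq (conjSchwartz (slice z.1 K)) (sliceFst z.2 L) volume
  rw [hi] at h
  have h2 : ∫ x, inner ℂ (conjSchwartz (slice z.1 K) x) (sliceFst z.2 L x) = compK K L z := by
    rw [compK_apply]
    congr 1
    ext r
    simp [mul_comm]
  rw [h2] at h
  have h3 := pow_le_pow_left₀ (norm_nonneg _) h 2
  rw [mul_pow, norm_toLp_sq, norm_toLp_sq] at h3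
  simpa using h3

/-- The Hilbert–Schmidt norm is submultiplicative, by the Cauchy–Schwarz inequality. -/
theorem norm_toLp_compK_le (K L : 𝓢(X × X, ℂ)) :
    ‖(compK K L).toLp 2 volume‖ ≤ ‖K.toLp 2 volume‖ * ‖L.toLp 2 volume‖ := by
  refine le_of_sq_le_sq ?_ (by positivity)
  rw [mul_pow, norm_toLp_sq, norm_toLp_sq, norm_toLp_sq]
  have hK : Integrable (fun z : X × X => ‖K z‖ ^ 2) (volume.prod volume) :=
    integrable_norm_sq (volume : Measure (X × X)) K
  have hL : Integrable (fun z : X × X => ‖L z‖ ^ 2) (volume.prod volume) :=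
    integrable_norm_sq (volume : Measure (X × X)) L
  calc ∫ z, ‖compK K L z‖ ^ 2
      ≤ ∫ z : X × X, (∫ r, ‖K (z.1, r)‖ ^ 2) * ∫ r, ‖L (r, z.2)‖ ^ 2 := by
        refine integral_mono (integrable_norm_sq _ _) ?_ (norm_compK_apply_sq_le K L)
        exact Integrable.mul_prod hK.integral_prod_left hL.integral_prod_right
    _ = (∫ s, ∫ r, ‖K (s, r)‖ ^ 2) * ∫ t, ∫ r, ‖L (r, t)‖ ^ 2 :=
        integral_prod_mul (μ := volume) (ν := volume) (fun s => ∫ r, ‖K (s, r)‖ ^ 2)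
          (fun t => ∫ r, ‖L (r, t)‖ ^ 2)
    _ = _ := by
        rw [integral_integral_swap (f := fun t r => ‖L (r, t)‖ ^ 2) hL.swap]
        rw [← integral_prod _ hK, ← integral_prod _ hL]
        rfl

theorem norm_toLp_adjK (K : 𝓢(X × X, ℂ)) : ‖(adjK K).toLp 2 volume‖ = ‖K.toLp 2 volume‖ := by
  rw [← sq_eq_sq₀ (norm_nonneg _) (norm_nonneg _), norm_toLp_sq, norm_toLp_sq]
  simp only [adjK_apply, RCLike.norm_conj]
  exact integral_prod_swap (μ := volume) (ν := volume) (fun z : X × X => ‖K z‖ ^ 2)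

variable (X) in
/-- The space of Hilbert–Schmidt kernels on `X`. -/
abbrev HS : Type := Lp ℂ 2 (volume : Measure (X × X))

variable (X) in
/-- The inclusion of Schwartz kernels into Hilbert–Schmidt kernels. -/
def incl : 𝓢(X × X, ℂ) →ₗ[ℂ] HS X := (toLpCLM ℂ ℂ 2 volume).toLinearMap

@[simp] theorem incl_apply (K : 𝓢(X × X, ℂ)) : incl X K = K.toLp 2 volume := rfl

theorem denseRange_incl : DenseRange (incl X) :=
  denseRange_toLpCLM (E := X × X) (F := ℂ) (p := 2) (μ := volume) (by simp)

/-- Left composition by a Schwartz kernel, on Hilbert–Schmidt kernels. -/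
def mulLeftHS (K : 𝓢(X × X, ℂ)) : HS X →L[ℂ] HS X :=
  ((incl X).comp (compK K)).extendOfNorm (incl X)

theorem mulLeftHS_bound (K : 𝓢(X × X, ℂ)) (L : 𝓢(X × X, ℂ)) :
    ‖(incl X).comp (compK K) L‖ ≤ ‖incl X K‖ * ‖incl X L‖ := norm_toLp_compK_le K L

theorem mulLeftHS_incl (K L : 𝓢(X × X, ℂ)) : mulLeftHS K (incl X L) = incl X (compK K L) :=
  LinearMap.extendOfNorm_eq denseRange_incl ⟨_, mulLeftHS_bound K⟩ L

/-- `mulLeftHS` as a linear map. -/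
def mulLeftHSₗ : 𝓢(X × X, ℂ) →ₗ[ℂ] HS X →L[ℂ] HS X where
  toFun := mulLeftHS
  map_add' K K' := by
    refine DFunLike.coe_injective (denseRange_incl.equalizer (by fun_prop) (by fun_prop) ?_)
    ext1 L
    simp only [Function.comp_apply, add_apply, mulLeftHS_incl, map_add, LinearMap.add_apply]
  map_smul' c K := by
    refine DFunLike.coe_injective (denseRange_incl.equalizer (by fun_prop) (by fun_prop) ?_)
    ext1 L
    simp only [Function.comp_apply, smul_apply, mulLeftHS_incl, map_smul,
      LinearMap.smul_apply, RingHom.id_apply]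

variable (X) in
/-- Composition of Hilbert–Schmidt kernels. -/
def mulHS : HS X →L[ℂ] HS X →L[ℂ] HS X := (mulLeftHSₗ (X := X)).extendOfNorm (incl X)

theorem mulHS_incl (K L : 𝓢(X × X, ℂ)) : mulHS X (incl X K) (incl X L) = incl X (compK K L) := by
  have h : mulHS X (incl X K) = mulLeftHS K :=
    LinearMap.extendOfNorm_eq denseRange_incl ⟨1, fun K => by
      rw [one_mul]
      exact LinearMap.opNorm_extendOfNorm_le denseRange_incl (norm_nonneg _)
        (mulLeftHS_bound K)⟩ K
  rw [h, mulLeftHS_incl]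

/-- `adjK` followed by the inclusion, as a conjugate linear map. -/
def inclAdjK : 𝓢(X × X, ℂ) →ₗ⋆[ℂ] HS X where
  toFun K := incl X (adjK K)
  map_add' K L := by
    rw [← map_add]; congr 1; ext z; simp
  map_smul' c K := by
    rw [← map_smul]; congr 1; ext z; simp

variable (X) in
/-- The adjoint of Hilbert–Schmidt kernels. -/
def adjHS : HS X →L⋆[ℂ] HS X := (inclAdjK (X := X)).extendOfNorm (incl X)

theorem adjHS_incl (K : 𝓢(X × X, ℂ)) : adjHS X (incl X K) = incl X (adjK K) :=
  LinearMap.extendOfNorm_eq (f := inclAdjK) denseRange_incl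
    ⟨1, fun K => by rw [one_mul]; exact (norm_toLp_adjK K).le⟩ K

end Kernels

/-! ### Hilbert–Schmidt kernels form a Hilbert algebra -/

section HilbertSchmidt

variable {X : Type} [NormedAddCommGroup X] [NormedSpace ℝ X] [FiniteDimensional ℝ X]
  [MeasureSpace X] [BorelSpace X] [SecondCountableTopology X]
  [(volume : Measure X).IsAddHaarMeasure]

/-- The Hilbert–Schmidt inner product as the trace of `A* B`. -/
theorem inner_incl_eq_trace (A B : 𝓢(X × X, ℂ)) :
    ⟪incl X A, incl X B⟫_ℂ = ∫ t, compK (adjK A) B (t, t) := by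
  have h := inner_toL2_toL2_eq A B (volume : Measure (X × X))
  refine h.trans ?_
  have hi : Integrable (fun z : X × X => (starRingEnd ℂ) (A z) * B z) (volume.prod volume) := by
    have := (conjSchwartz A).memLp 2 (volume : Measure (X × X))
    exact this.integrable_mul (B.memLp 2 (volume : Measure (X × X)))
  have h2 : ∫ z, ⟪A z, B z⟫_ℂ = ∫ z, (starRingEnd ℂ) (A z) * B z ∂(volume.prod volume) := by
    refine integral_congr_ae (.of_forall fun z => ?_)
    simp [mul_comm]
  rw [h2, integral_prod_symm _ hi]
  simp only [compK_apply, adjK_apply]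

theorem inner_incl_compK (K L N : 𝓢(X × X, ℂ)) :
    ⟪incl X (compK K L), incl X N⟫_ℂ = ⟪incl X L, incl X (compK (adjK K) N)⟫_ℂ := by
  rw [inner_incl_eq_trace, inner_incl_eq_trace, adjK_compK, compK_assoc]

theorem inner_incl_adjK (K L : 𝓢(X × X, ℂ)) :
    ⟪incl X (adjK K), incl X (adjK L)⟫_ℂ = ⟪incl X L, incl X K⟫_ℂ := by
  have h := inner_toL2_toL2_eq (adjK K) (adjK L) (volume : Measure (X × X))
  have h' := inner_toL2_toL2_eq L K (volume : Measure (X × X))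
  refine h.trans (Eq.trans ?_ h'.symm)
  simp only [adjK_apply]
  refine Eq.trans ?_ (integral_prod_swap (μ := volume) (ν := volume) (fun z : X × X => ⟪L z, K z⟫_ℂ))
  refine integral_congr_ae (.of_forall fun z => ?_)
  simp [mul_comm, Prod.swap]

theorem mulHS_assoc (a b c : HS X) :
    mulHS X (mulHS X a b) c = mulHS X a (mulHS X b c) := by
  refine DenseRange.induction_on₃ denseRange_incl ?_ ?_ a b c
  · exact isClosed_eq (by fun_prop) (by fun_prop)
  · intro K L N
    simp only [mulHS_incl, compK_assoc]

theorem adjHS_adjHS (a : HS X) : adjHS X (adjHS X a) = a := by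
  refine denseRange_incl.induction_on a ?_ ?_
  · exact isClosed_eq (by fun_prop) (by fun_prop)
  · intro K
    rw [adjHS_incl, adjHS_incl]
    congr 1
    ext z
    simp

theorem adjHS_mulHS (a b : HS X) : adjHS X (mulHS X a b) = mulHS X (adjHS X b) (adjHS X a) := by
  refine DenseRange.induction_on₂ denseRange_incl ?_ ?_ a b
  · exact isClosed_eq (by fun_prop) (by fun_prop)
  · intro K L
    simp only [mulHS_incl, adjHS_incl, adjK_compK]

theorem inner_adjHS (a b : HS X) : ⟪adjHS X a, adjHS X b⟫_ℂ = ⟪b, a⟫_ℂ := by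
  refine DenseRange.induction_on₂ denseRange_incl ?_ ?_ a b
  · exact isClosed_eq (by fun_prop) (by fun_prop)
  · intro K L
    rw [adjHS_incl, adjHS_incl, inner_incl_adjK]

theorem inner_mulHS_left (a b c : HS X) :
    ⟪mulHS X a b, c⟫_ℂ = ⟪b, mulHS X (adjHS X a) c⟫_ℂ := by
  refine DenseRange.induction_on₃ denseRange_incl ?_ ?_ a b c
  · exact isClosed_eq (by fun_prop) (by fun_prop)
  · intro K L N
    simp only [mulHS_incl, adjHS_incl, inner_incl_compK]

theorem inner_mulHS_right (a b c : HS X) :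
    ⟪mulHS X a b, c⟫_ℂ = ⟪a, mulHS X c (adjHS X b)⟫_ℂ := by
  have h1 := inner_adjHS c (mulHS X a b)
  have h2 := inner_adjHS a (mulHS X c (adjHS X b))
  rw [adjHS_mulHS] at h1 h2
  rw [adjHS_adjHS] at h2
  rw [← h1, ← inner_conj_symm, inner_mulHS_left, adjHS_adjHS, h2, inner_conj_symm]

/-- An `L²` function on a product which is orthogonal to all products of Schwartz functions has
vanishing integral over every rectangle of finite measure. -/
theorem setIntegral_prod_eq_zero_of_tens (c : X × X → ℂ) (hc : MemLp c 2 (volume.prod volume))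
    (h : ∀ f g : 𝓢(X, ℂ), ∫ z, f z.1 * g z.2 * c z ∂(volume.prod volume) = 0)
    {A B : Set X} (hA' : volume A ≠ ⊤) (hB' : volume B ≠ ⊤) :
    ∫ z in A ×ˢ B, c z ∂(volume.prod volume) = 0 := by
  have key : ∀ {S : Set X} (g : 𝓢(X, ℂ)), volume S ≠ ⊤ →
      Integrable (fun z : X × X => g z.2 * c z) ((volume.restrict S).prod volume) := by
    intro S g hS
    have : IsFiniteMeasure (volume.restrict S) := isFiniteMeasure_restrict.2 hS
    have h1 : MemLp (fun z : X × X => g z.2) 2 ((volume.restrict S).prod volume) :=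
      (g.memLp 2 volume).comp_snd _
    exact h1.integrable_mul (hc.mono_measure (Measure.prod_mono Measure.restrict_le_self le_rfl))
  have key2 : ∀ {S S' : Set X}, volume S ≠ ⊤ → volume S' ≠ ⊤ →
      Integrable c ((volume.restrict S).prod (volume.restrict S')) := by
    intro S S' hS hS'
    have : IsFiniteMeasure (volume.restrict S) := isFiniteMeasure_restrict.2 hS
    have : IsFiniteMeasure (volume.restrict S') := isFiniteMeasure_restrict.2 hS'
    exact (hc.mono_measure (Measure.prod_mono Measure.restrict_le_self
      Measure.restrict_le_self)).integrable (by norm_num)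
  have toS : ∀ f : X → ℝ, ContDiff ℝ ∞ f → HasCompactSupport f →
      ∃ F : 𝓢(X, ℂ), ∀ x, F x = (f x : ℂ) := by
    intro f hf hf'
    have h1 : HasCompactSupport (fun x => (f x : ℂ)) := hf'.comp_left (g := Complex.ofReal) rfl
    exact ⟨h1.toSchwartzMap (Complex.ofRealCLM.contDiff.comp hf), fun x => rfl⟩
  -- fix one factor, remove the other by testing, then exchange the roles of the variables
  have s1 : ∀ g : 𝓢(X, ℂ), ∀ᵐ x, ∫ y, g y * c (x, y) = 0 := by
    intro g
    refine ae_eq_zero_of_integral_contDiff_smul_eq_zero ?_ ?_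
    · rw [locallyIntegrable_iff]
      intro k hk
      exact (key g hk.measure_lt_top.ne).integral_prod_left
    · intro f hf hf'
      obtain ⟨F, hF⟩ := toS f hf hf'
      have hi : Integrable (fun z : X × X => F z.1 * g z.2 * c z) (volume.prod volume) :=
        ((tens F g).memLp 2 (volume : Measure (X × X))).integrable_mul hc
      rw [← h F g, integral_prod _ hi]
      congr 1
      ext x
      simp only [mul_assoc, integral_const_mul, hF, Complex.real_smul]
  have s2 : ∀ᵐ y, ∫ x in A, c (x, y) = 0 := by
    refine ae_eq_zero_of_integral_contDiff_smul_eq_zero ?_ ?_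
    · rw [locallyIntegrable_iff]
      intro k hk
      exact (key2 hA' hk.measure_lt_top.ne).integral_prod_right
    · intro g hg hg'
      obtain ⟨G, hG⟩ := toS g hg hg'
      have h3 : ∫ x in A, ∫ y, G y * c (x, y) = 0 := by
        rw [integral_congr_ae (ae_restrict_of_ae (s1 G))]
        simp
      rw [integral_integral_swap (key G hA')] at h3
      rw [← h3]
      congr 1
      ext y
      simp only [integral_const_mul, hG, Complex.real_smul]
  rw [← Measure.prod_restrict, integral_prod_symm _ (key2 hA' hB'),
    integral_congr_ae (ae_restrict_of_ae s2)]
  simp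

theorem ae_eq_zero_of_tens (c : X × X → ℂ) (hc : MemLp c 2 (volume.prod volume))
    (h : ∀ f g : 𝓢(X, ℂ), ∫ z, f z.1 * g z.2 * c z ∂(volume.prod volume) = 0) :
    c =ᵐ[volume.prod volume] 0 := by
  have hS : ∀ k : ℕ, volume (Metric.ball (0 : X) k) ≠ ⊤ := fun k => measure_ball_lt_top.ne
  let R : ℕ → Set (X × X) := fun k => Metric.ball (0 : X) k ×ˢ Metric.ball (0 : X) k
  have hR : ∀ k, MeasurableSet (R k) := fun k => measurableSet_ball.prod measurableSet_ball
  have hcR : ∀ k, IntegrableOn c (R k) (volume.prod volume) := by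
    intro k
    have : IsFiniteMeasure ((volume.prod volume).restrict (R k)) := by
      refine isFiniteMeasure_restrict.2 ?_
      rw [Measure.prod_prod]
      exact ENNReal.mul_ne_top (hS k) (hS k)
    exact (hc.mono_measure Measure.restrict_le_self).integrable (by norm_num)
  have hzero : ∀ k, c =ᵐ[(volume.prod volume).restrict (R k)] 0 := by
    intro k
    have hall : ∀ s, MeasurableSet s →
        ∫ z in s, c z ∂((volume.prod volume).restrict (R k)) = 0 := by
      have hrect : ∀ A B : Set X, MeasurableSet A → MeasurableSet B →
          ∫ z in A ×ˢ B, c z ∂((volume.prod volume).restrict (R k)) = 0 := by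
        intro A B hA hB
        rw [Measure.restrict_restrict (hA.prod hB), Set.prod_inter_prod]
        exact setIntegral_prod_eq_zero_of_tens c hc h
          (measure_ne_top_of_subset Set.inter_subset_right (hS k))
          (measure_ne_top_of_subset Set.inter_subset_right (hS k))
      -- rectangles generate the σ-algebra of the product
      refine MeasurableSpace.induction_on_inter generateFrom_prod.symm isPiSystem_prod ?_ ?_ ?_ ?_
      · simp
      · rintro t ⟨A, hA, B, hB, rfl⟩
        exact hrect A B hA hB
      · intro t ht h0
        have h1 := hrect Set.univ Set.univ .univ .univ
        rw [Set.univ_prod_univ, setIntegral_univ] at h1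
        rw [setIntegral_compl ht (hcR k), h0, h1, sub_zero]
      · intro f hd hf h0
        rw [integral_iUnion hf hd (hcR k).integrableOn]
        simp [h0]
    exact (hcR k).ae_eq_zero_of_forall_setIntegral_eq_zero fun s hs _ => hall s hs
  have hU : ⋃ k, R k = Set.univ := by
    refine Set.eq_univ_of_forall fun z => ?_
    obtain ⟨k, hk⟩ := exists_nat_gt (max ‖z.1‖ ‖z.2‖)
    exact Set.mem_iUnion.2 ⟨k, by
      simpa [R] using ⟨(le_max_left _ _).trans_lt hk, (le_max_right _ _).trans_lt hk⟩⟩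
  have := (ae_restrict_iUnion_iff R (fun z => c z = 0)).2 hzero
  rwa [hU, Measure.restrict_univ] at this

/-- The products of Hilbert–Schmidt kernels span a dense subspace: they include all tensor products
of Schwartz functions. -/
theorem dense_span_mulHS :
    Dense (Submodule.span ℂ (Set.range fun p : HS X × HS X => mulHS X p.1 p.2) : Set (HS X)) := by
  rw [Submodule.dense_iff_topologicalClosure_eq_top, Submodule.topologicalClosure_eq_top_iff,
    eq_bot_iff]
  intro c hc
  rw [Submodule.mem_orthogonal] at hc
  have h0 : ∀ f g : 𝓢(X, ℂ), ⟪incl X (tens f g), c⟫_ℂ = 0 := by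
    intro f g
    by_cases hf : f = 0
    · have : tens f g = 0 := by ext z; simp [hf]
      rw [this, map_zero, inner_zero_left]
    -- `f ⊗ g` is, up to a factor, the product of the kernels `f ⊗ conj f` and `f ⊗ g`
    have h1 : compK (tens f (conjSchwartz f)) (tens f g) =
        ((‖f.toLp 2 volume‖ ^ 2 : ℝ) : ℂ) • tens f g := by
      ext z
      rw [compK_apply, norm_toLp_sq, ← integral_complex_ofReal, smul_apply, smul_eq_mul,
        ← integral_mul_const]
      congr 1
      ext r
      simp only [tens_apply, conjSchwartz_apply]
      push_cast
      rw [← Complex.conj_mul']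
      ring
    have h2 : ((‖f.toLp 2 volume‖ ^ 2 : ℝ) : ℂ) ≠ 0 := by
      rw [Complex.ofReal_ne_zero]
      refine pow_ne_zero 2 (norm_ne_zero_iff.2 fun h => hf ?_)
      have := SchwartzMap.injective_toLp 2 (volume : Measure X) (a₁ := f) (a₂ := 0)
      exact this (h.trans (map_zero (toLpCLM ℂ ℂ 2 (volume : Measure X))).symm)
    have h3 := hc _ (Submodule.subset_span ⟨(incl X (tens f (conjSchwartz f)), incl X (tens f g)), rfl⟩)
    simp only [mulHS_incl, h1, map_smul, inner_smul_left] at h3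
    exact (mul_eq_zero.1 h3).resolve_left ((map_ne_zero _).2 h2)
  rw [Submodule.mem_bot, Lp.eq_zero_iff_ae_eq_zero]
  refine ae_eq_zero_of_tens c (Lp.memLp c) fun f g => ?_
  rw [← h0 (conjSchwartz f) (conjSchwartz g), L2.inner_def]
  refine integral_congr_ae ?_
  filter_upwards [(tens (conjSchwartz f) (conjSchwartz g)).coeFn_toLp 2 (volume : Measure (X × X))]
    with z hz
  rw [incl_apply, hz]
  simp [mul_comm]

/-- The Hilbert–Schmidt kernels form a Hilbert algebra, for any nonzero real rescaling of the
composition. -/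
theorem isHilbertAlgebra_smul_mulHS (m : ℝ) (hm : m ≠ 0) :
    IsHilbertAlgebra ((m : ℂ) • mulHS X) (adjHS X).toLinearMap where
  assoc a b c := by
    simp only [smul_apply, map_smul, mulHS_assoc]
  inv_inv := adjHS_adjHS
  inv_mul a b := by
    change adjHS X ((m : ℂ) • mulHS X a b) = (m : ℂ) • mulHS X (adjHS X b) (adjHS X a)
    rw [map_smulₛₗ, adjHS_mulHS, Complex.conj_ofReal]
  inner_inv := inner_adjHS
  inner_left a b c := by
    change ⟪(m : ℂ) • mulHS X a b, c⟫_ℂ = ⟪b, (m : ℂ) • mulHS X (adjHS X a) c⟫_ℂ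
    rw [inner_smul_left, inner_smul_right, inner_mulHS_left, Complex.conj_ofReal]
  inner_right a b c := by
    change ⟪(m : ℂ) • mulHS X a b, c⟫_ℂ = ⟪a, (m : ℂ) • mulHS X c (adjHS X b)⟫_ℂ
    rw [inner_smul_left, inner_smul_right, inner_mulHS_right, Complex.conj_ofReal]
  dense := by
    refine dense_span_mulHS.mono (Submodule.span_le.2 ?_)
    rintro _ ⟨p, rfl⟩
    refine Submodule.subset_span ⟨((m : ℂ)⁻¹ • p.1, p.2), ?_⟩
    have hm' : (m : ℂ) ≠ 0 := Complex.ofReal_ne_zero.2 hm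
    change (m : ℂ) • mulHS X ((m : ℂ)⁻¹ • p.1) p.2 = mulHS X p.1 p.2
    rw [map_smul, smul_apply, smul_smul, mul_inv_cancel₀ hm', one_smul]

end HilbertSchmidt

/-! ### The twisting map has tempered inverse and Jacobian -/

/-- A polynomially bounded solution of a linear differential equation `F' = k F` with tempered
coefficient is tempered. -/
theorem hasTemperateGrowth_of_hasDerivAt_mul {F k : ℝ → ℝ} (hk : k.HasTemperateGrowth)
    (hF : ∀ x, HasDerivAt F (k x * F x) x) {N : ℕ} {C : ℝ}
    (hb : ∀ x, ‖F x‖ ≤ C * (1 + ‖x‖) ^ N) : F.HasTemperateGrowth := by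
  have hd : deriv F = fun x => k x * F x := funext fun x => (hF x).deriv
  have hsm : ∀ m : ℕ, ContDiff ℝ m F := by
    intro m
    induction m with
    | zero =>
      exact contDiff_zero.2 (continuous_iff_continuousAt.2 fun x => (hF x).continuousAt)
    | succ m ih =>
      push_cast
      refine contDiff_succ_iff_deriv.2 ⟨fun x => (hF x).differentiableAt, by simp, ?_⟩
      rw [hd]
      exact (hk.1.of_le (mod_cast le_top)).mul ih
  refine ⟨contDiff_infty.2 hsm, fun m => ?_⟩
  induction m using Nat.strong_induction_on with
  | _ m ih =>
    rcases m with _ | m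
    · exact ⟨N, C, fun x => by simpa using hb x⟩
    choose! p A hA using ih
    choose q B hB using hk.2
    have h1 : ∀ x : ℝ, 1 ≤ 1 + ‖x‖ := fun x => by simp
    refine ⟨∑ i ∈ Finset.range (m + 1), (q i + p (m - i)),
      ∑ i ∈ Finset.range (m + 1), m.choose i * |B i| * |A (m - i)|, fun x => ?_⟩
    rw [norm_iteratedFDeriv_eq_norm_iteratedDeriv, iteratedDeriv_succ', hd,
      ← norm_iteratedFDeriv_eq_norm_iteratedDeriv]
    refine (norm_iteratedFDeriv_mul_le (N := m) (hk.1.of_le (mod_cast le_top)) (hsm m) x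
      le_rfl).trans ?_
    rw [Finset.sum_mul]
    refine Finset.sum_le_sum fun i hi => ?_
    have hpow : (1 + ‖x‖) ^ q i * (1 + ‖x‖) ^ p (m - i) ≤
        (1 + ‖x‖) ^ ∑ i ∈ Finset.range (m + 1), (q i + p (m - i)) := by
      rw [← pow_add]
      exact pow_le_pow_right₀ (h1 x) (Finset.single_le_sum (f := fun i => q i + p (m - i))
        (fun _ _ => Nat.zero_le _) hi)
    have hBi : ‖iteratedFDeriv ℝ i k x‖ ≤ |B i| * (1 + ‖x‖) ^ q i :=
      (hB i x).trans (mul_le_mul_of_nonneg_right (le_abs_self _) (by positivity))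
    have hAi : ‖iteratedFDeriv ℝ (m - i) F x‖ ≤ |A (m - i)| * (1 + ‖x‖) ^ p (m - i) :=
      (hA (m - i) (by omega) x).trans (mul_le_mul_of_nonneg_right (le_abs_self _) (by positivity))
    calc (m.choose i : ℝ) * ‖iteratedFDeriv ℝ i k x‖ * ‖iteratedFDeriv ℝ (m - i) F x‖
        ≤ m.choose i * (|B i| * (1 + ‖x‖) ^ q i) * (|A (m - i)| * (1 + ‖x‖) ^ p (m - i)) :=
          mul_le_mul (mul_le_mul_of_nonneg_left hBi (by positivity)) hAi (norm_nonneg _)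
            (by positivity)
      _ = m.choose i * |B i| * |A (m - i)| * ((1 + ‖x‖) ^ q i * (1 + ‖x‖) ^ p (m - i)) := by ring
      _ ≤ _ := mul_le_mul_of_nonneg_left hpow (by positivity)

/-- `ρ_θ(ξ) = √(1 + (2θξ)²) = cosh(2θη)` for `ξ = φ_θ(η)`. -/
def rho (θ ξ : ℝ) : ℝ := √(1 + (2 * θ * ξ) ^ 2)

/-- `cosh(θη)` for `ξ = φ_θ(η)`. -/
def chi (θ ξ : ℝ) : ℝ := Real.cosh (θ * phiInv θ ξ)

/-- `sinh(θη)` for `ξ = φ_θ(η)`. -/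
def shi (θ ξ : ℝ) : ℝ := Real.sinh (θ * phiInv θ ξ)

theorem rho_pos (θ ξ : ℝ) : 0 < rho θ ξ := Real.sqrt_pos.2 (by positivity)

theorem chi_pos (θ ξ : ℝ) : 0 < chi θ ξ := Real.cosh_pos _

theorem mul_phiInv (θ ξ : ℝ) : θ * phiInv θ ξ = Real.arsinh (2 * θ * ξ) / 2 := by
  unfold phiInv
  split_ifs with h
  · simp [h]
  · field_simp

theorem mul_phi (θ η : ℝ) : 2 * θ * phi θ η = Real.sinh (2 * θ * η) := by
  unfold phi
  split_ifs with h
  · simp [h]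
  · field_simp

theorem rho_phi (θ η : ℝ) : rho θ (phi θ η) = Real.cosh (2 * θ * η) := by
  rw [rho, mul_phi, ← Real.cosh_sq', Real.sqrt_sq (Real.cosh_pos _).le]

theorem chi_phi (θ η : ℝ) : chi θ (phi θ η) = Real.cosh (θ * η) := by rw [chi, phiInv_phi]

theorem shi_phi (θ η : ℝ) : shi θ (phi θ η) = Real.sinh (θ * η) := by rw [shi, phiInv_phi]

theorem hasDerivAt_phi (θ η : ℝ) : HasDerivAt (phi θ) (Real.cosh (2 * θ * η)) η := by
  unfold phi
  split_ifs with h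
  · simpa [h] using hasDerivAt_id' η
  · have h1 := ((hasDerivAt_id η).const_mul (2 * θ)).sinh.div_const (2 * θ)
    refine h1.congr_deriv ?_
    simp only [id, mul_one]
    field_simp

theorem hasDerivAt_phiInv (θ ξ : ℝ) : HasDerivAt (phiInv θ) (rho θ ξ)⁻¹ ξ := by
  unfold phiInv
  split_ifs with h
  · simpa [h, rho] using hasDerivAt_id' ξ
  · have h1 := ((hasDerivAt_id ξ).const_mul (2 * θ)).arsinh.div_const (2 * θ)
    refine h1.congr_deriv ?_
    simp only [id, mul_one, smul_eq_mul, rho]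
    field_simp

theorem rpow_rho_eq (θ ξ r : ℝ) : (1 + ‖2 * θ * ξ‖ ^ 2) ^ (r / 2) = rho θ ξ ^ r := by
  rw [rho, Real.sqrt_eq_rpow, ← Real.rpow_mul (by positivity), Real.norm_eq_abs, sq_abs]
  ring_nf

theorem hasTemperateGrowth_rho_rpow (θ r : ℝ) :
    (fun ξ => rho θ ξ ^ r).HasTemperateGrowth := by
  have h1 := (Function.hasTemperateGrowth_one_add_norm_sq_rpow ℝ (r / 2)).comp
    (f := fun ξ : ℝ => 2 * θ * ξ) (by fun_prop)
  exact (funext fun ξ => (rpow_rho_eq θ ξ r).symm) ▸ h1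

theorem hasTemperateGrowth_rho (θ : ℝ) : (rho θ).HasTemperateGrowth := by
  simpa using hasTemperateGrowth_rho_rpow θ 1

theorem hasTemperateGrowth_rho_inv (θ : ℝ) : (fun ξ => (rho θ ξ)⁻¹).HasTemperateGrowth := by
  simpa [Real.rpow_neg_one] using hasTemperateGrowth_rho_rpow θ (-1)

/-- The functions `cosh(θη)` and `sinh(θη)` of `ξ = φ_θ(η)` are combinations of `exp(±arsinh(2θξ)
/ 2)`, which grow like a square root and solve a linear differential equation with temperate
coefficient. -/
theorem hasTemperateGrowth_exp_half_arsinh (c : ℝ) :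
    (fun ξ => Real.exp (Real.arsinh (c * ξ) / 2)).HasTemperateGrowth := by
  refine hasTemperateGrowth_of_hasDerivAt_mul (k := fun ξ => c / 2 * (rho (c / 2) ξ)⁻¹) (N := 1)
    (C := 2 + 2 * |c|) ((Function.HasTemperateGrowth.const _).mul (hasTemperateGrowth_rho_inv _))
    (fun ξ => ?_) (fun ξ => ?_)
  · have h1 := (((hasDerivAt_id ξ).const_mul c).arsinh.div_const 2).exp
    refine h1.congr_deriv ?_
    simp only [id, mul_one, smul_eq_mul, rho]
    ring_nf
  · have h1 : Real.exp (Real.arsinh (c * ξ) / 2) ^ 2 = c * ξ + √(1 + (c * ξ) ^ 2) := by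
      rw [← Real.exp_nat_mul, ← Real.exp_arsinh]; congr 1; push_cast; ring
    have h2 : √(1 + (c * ξ) ^ 2) ≤ 1 + |c * ξ| := by
      refine Real.sqrt_le_iff.2 ⟨by positivity, ?_⟩
      nlinarith [abs_nonneg (c * ξ), sq_abs (c * ξ)]
    have h3 := Real.exp_pos (Real.arsinh (c * ξ) / 2)
    rw [Real.norm_eq_abs, abs_of_pos h3, pow_one, Real.norm_eq_abs]
    have h4 := le_abs_self (c * ξ)
    rw [abs_mul] at h2 h4
    nlinarith [abs_nonneg c, abs_nonneg ξ, mul_nonneg (abs_nonneg c) (abs_nonneg ξ)]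

theorem hasTemperateGrowth_chi (θ : ℝ) : (chi θ).HasTemperateGrowth := by
  have h := ((hasTemperateGrowth_exp_half_arsinh (2 * θ)).add
    (hasTemperateGrowth_exp_half_arsinh (-(2 * θ)))).mul (Function.HasTemperateGrowth.const (2⁻¹ : ℝ))
  refine Eq.mp (congrArg _ (funext fun ξ => ?_)) h
  simp only [chi, mul_phiInv, Real.cosh_eq, Pi.mul_apply, Pi.add_apply, neg_mul, Real.arsinh_neg,
    neg_div]
  ring

theorem hasTemperateGrowth_shi (θ : ℝ) : (shi θ).HasTemperateGrowth := by
  have h := ((hasTemperateGrowth_exp_half_arsinh (2 * θ)).sub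
    (hasTemperateGrowth_exp_half_arsinh (-(2 * θ)))).mul (Function.HasTemperateGrowth.const (2⁻¹ : ℝ))
  refine Eq.mp (congrArg _ (funext fun ξ => ?_)) h
  simp only [shi, mul_phiInv, Real.sinh_eq, Pi.mul_apply, Pi.sub_apply, neg_mul, Real.arsinh_neg,
    neg_div]
  ring

theorem hasTemperateGrowth_chi_inv (θ : ℝ) : (fun ξ => (chi θ ξ)⁻¹).HasTemperateGrowth := by
  have h1 := (Function.hasTemperateGrowth_one_add_norm_sq_rpow ℝ (-1 / 2)).comp (hasTemperateGrowth_shi θ)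
  refine Eq.mp (congrArg _ (funext fun ξ => ?_)) h1
  have h2 : 1 + ‖shi θ ξ‖ ^ 2 = chi θ ξ ^ 2 := by
    rw [Real.norm_eq_abs, sq_abs, chi, shi, Real.cosh_sq']
  simp only [Function.comp_apply, h2]
  rw [← Real.rpow_natCast, ← Real.rpow_mul (chi_pos θ ξ).le]
  norm_num [Real.rpow_neg_one]

theorem hasTemperateGrowth_phiInv (θ : ℝ) : (phiInv θ).HasTemperateGrowth := by
  refine Function.HasTemperateGrowth.of_fderiv (k := 1) (C := 1) ?_
    (fun ξ => (hasDerivAt_phiInv θ ξ).differentiableAt) (fun ξ => ?_)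
  · have h : fderiv ℝ (phiInv θ) = fun ξ => (rho θ ξ)⁻¹ • ContinuousLinearMap.id ℝ ℝ := by
      ext1 ξ
      rw [(hasDerivAt_phiInv θ ξ).hasFDerivAt.fderiv]
      ext; simp
    rw [h]
    exact (hasTemperateGrowth_rho_inv θ).smul (.const _)
  · -- `|η| ≤ |φ_θ(η)|`, by the mean value theorem for the `1`-Lipschitz function `phiInv`
    have h1 : LipschitzWith 1 (phiInv θ) := by
      refine lipschitzWith_of_nnnorm_deriv_le (fun ξ => (hasDerivAt_phiInv θ ξ).differentiableAt)
        fun ξ => ?_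
      rw [(hasDerivAt_phiInv θ ξ).deriv, ← NNReal.coe_le_coe, coe_nnnorm, norm_inv,
        Real.norm_of_nonneg (rho_pos θ ξ).le]
      exact inv_le_one_of_one_le₀ (Real.one_le_sqrt.2 (by simp [sq_nonneg]))
    have h2 := h1.dist_le_mul ξ 0
    have h3 : phiInv θ 0 = 0 := by simp [phiInv]
    rw [h3, dist_zero_right, dist_zero_right, NNReal.coe_one, one_mul] at h2
    simpa using h2.trans (by simp)

section Twist

variable {n : ℕ}

theorem hasTemperateGrowth_prodMk {A B C : Type} [NormedAddCommGroup A] [NormedSpace ℝ A]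
    [NormedAddCommGroup B] [NormedSpace ℝ B] [NormedAddCommGroup C] [NormedSpace ℝ C]
    {f : A → B} {g : A → C} (hf : f.HasTemperateGrowth) (hg : g.HasTemperateGrowth) :
    (fun x => (f x, g x)).HasTemperateGrowth := by
  have h := ((ContinuousLinearMap.inl ℝ B C).hasTemperateGrowth.comp hf).add
    ((ContinuousLinearMap.inr ℝ B C).hasTemperateGrowth.comp hg)
  refine Eq.mp (congrArg _ (funext fun x => ?_)) h
  simp

/-- The coordinate `ξ` (or `ℓ`) of `M`. -/
def coordL (n : ℕ) : M n →L[ℝ] ℝ :=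
  (ContinuousLinearMap.snd ℝ (V n) ℝ).comp (ContinuousLinearMap.snd ℝ ℝ (V n × ℝ))

/-- The coordinate `v` of `M`. -/
def coordV (n : ℕ) : M n →L[ℝ] V n :=
  (ContinuousLinearMap.fst ℝ (V n) ℝ).comp (ContinuousLinearMap.snd ℝ ℝ (V n × ℝ))

@[simp] theorem coordL_apply (x : M n) : coordL n x = x.2.2 := rfl

@[simp] theorem coordV_apply (x : M n) : coordV n x = x.2.1 := rfl

theorem hasTemperateGrowth_comp_coordL {F : Type} [NormedAddCommGroup F] [NormedSpace ℝ F]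
    {g : ℝ → F} (hg : g.HasTemperateGrowth) : (fun x : M n => g x.2.2).HasTemperateGrowth :=
  hg.comp (coordL n).hasTemperateGrowth

theorem hasTemperateGrowth_twist_symm (θ : ℝ) :
    (fun x : M n => (twist n θ).symm x).HasTemperateGrowth := by
  refine hasTemperateGrowth_prodMk (ContinuousLinearMap.fst ℝ ℝ (V n × ℝ)).hasTemperateGrowth
    (hasTemperateGrowth_prodMk ?_ ?_)
  · exact (hasTemperateGrowth_comp_coordL (hasTemperateGrowth_chi θ)).smul
      (coordV n).hasTemperateGrowth
  · exact hasTemperateGrowth_comp_coordL (hasTemperateGrowth_phiInv θ)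

/-- The derivative of the twisting map, as a function of the image point: a diagonal part plus a
shear in the direction of `v`. -/
def twistJ (n : ℕ) (θ : ℝ) (y : M n) : M n →L[ℝ] M n :=
  (ContinuousLinearMap.id ℝ ℝ).prodMap
    (((chi θ y.2.2)⁻¹ • ContinuousLinearMap.id ℝ (V n)).prodMap
      (rho θ y.2.2 • ContinuousLinearMap.id ℝ ℝ))
  - (coordL n).smulRight ((0 : ℝ), (θ * shi θ y.2.2 * (chi θ y.2.2)⁻¹) • y.2.1, (0 : ℝ))

theorem hasFDerivAt_twist (θ : ℝ) (x : M n) :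
    HasFDerivAt (twist n θ) (twistJ n θ (twist n θ x)) x := by
  have hl : HasFDerivAt (fun x : M n => x.2.2) (coordL n) x := (coordL n).hasFDerivAt
  have hv : HasFDerivAt (fun x : M n => x.2.1) (coordV n) x := (coordV n).hasFDerivAt
  have ha : HasFDerivAt (fun x : M n => x.1) (ContinuousLinearMap.fst ℝ ℝ (V n × ℝ)) x :=
    (ContinuousLinearMap.fst ℝ ℝ (V n × ℝ)).hasFDerivAt
  have h1 : HasDerivAt (fun η => (Real.cosh (θ * η))⁻¹)
      (-(θ * Real.sinh (θ * x.2.2)) / Real.cosh (θ * x.2.2) ^ 2) x.2.2 := by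
    have := (((hasDerivAt_id x.2.2).const_mul θ).cosh).fun_inv (Real.cosh_pos _).ne'
    refine this.congr_deriv ?_
    simp [mul_comm]
  have h2 := (h1.comp_hasFDerivAt x hl).smul hv
  have h3 := (hasDerivAt_phi θ x.2.2).comp_hasFDerivAt x hl
  refine (ha.prodMk (h2.prodMk h3)).congr_fderiv ?_
  refine ContinuousLinearMap.ext fun d => ?_
  have hc := (Real.cosh_pos (θ * x.2.2)).ne'
  refine Prod.ext ?_ (Prod.ext ?_ ?_)
  · simp [twistJ, twist]
  · simp only [twistJ, twist, Equiv.coe_fn_mk, chi_phi, shi_phi, rho_phi]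
    simp [smul_smul]
    rw [sub_eq_add_neg, ← neg_smul]
    congr 2
    field_simp
  · simp [twistJ, twist, rho_phi, mul_comm]

theorem hasTemperateGrowth_twistJ (θ : ℝ) : (twistJ n θ).HasTemperateGrowth := by
  have hc := hasTemperateGrowth_comp_coordL (n := n) (hasTemperateGrowth_chi_inv θ)
  have hr := hasTemperateGrowth_comp_coordL (n := n) (hasTemperateGrowth_rho θ)
  have hs := hasTemperateGrowth_comp_coordL (n := n)
    (((Function.HasTemperateGrowth.const θ).mul (hasTemperateGrowth_shi θ)).mul
      (hasTemperateGrowth_chi_inv θ))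
  have hw : (fun y : M n => ((0 : ℝ), (θ * shi θ y.2.2 * (chi θ y.2.2)⁻¹) • y.2.1,
      (0 : ℝ))).HasTemperateGrowth :=
    hasTemperateGrowth_prodMk (.const _)
      (hasTemperateGrowth_prodMk (hs.smul (coordV n).hasTemperateGrowth) (.const _))
  have h1 := (ContinuousLinearMap.smulRightL ℝ (M n) (M n) (coordL n)).hasTemperateGrowth.comp hw
  let D1 : M n →L[ℝ] M n := (ContinuousLinearMap.id ℝ ℝ).prodMap 0
  let D2 : M n →L[ℝ] M n := (0 : ℝ →L[ℝ] ℝ).prodMap ((ContinuousLinearMap.id ℝ (V n)).prodMap 0)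
  let D3 : M n →L[ℝ] M n := (0 : ℝ →L[ℝ] ℝ).prodMap
    ((0 : V n →L[ℝ] V n).prodMap (ContinuousLinearMap.id ℝ ℝ))
  have h2 := (((Function.HasTemperateGrowth.const D1).fun_add
    (hc.fun_smul (.const D2))).fun_add (hr.fun_smul (.const D3))).fun_sub h1
  refine Eq.mp (congrArg _ (funext fun y => ?_)) h2
  refine ContinuousLinearMap.ext fun d => ?_
  simp [D1, D2, D3, twistJ]
  refine Prod.ext ?_ (Prod.ext ?_ ?_) <;> simp

/-- The inverse of the twisting map is polynomially bounded. -/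
theorem norm_le_of_twist (θ : ℝ) : ∃ (k : ℕ) (C : ℝ), ∀ x : M n, ‖x‖ ≤ C * (1 + ‖twist n θ x‖) ^ k := by
  obtain ⟨k, C, h⟩ := (hasTemperateGrowth_twist_symm (n := n) θ).2 0
  refine ⟨k, C, fun x => ?_⟩
  simpa using h (twist n θ x)

/-- The Jacobian determinant of the twisting map, as a function of the image point. -/
def twistDet (n : ℕ) (θ ξ : ℝ) : ℝ := rho θ ξ * (chi θ ξ)⁻¹ ^ (2 * n)

theorem twistDet_pos (n : ℕ) (θ ξ : ℝ) : 0 < twistDet n θ ξ :=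
  mul_pos (rho_pos _ _) (pow_pos (inv_pos.2 (chi_pos _ _)) _)

theorem det_twistJ (θ : ℝ) (y : M n) : (twistJ n θ y).det = twistDet n θ y.2.2 := by
  let s := (chi θ y.2.2)⁻¹
  let r := rho θ y.2.2
  have hr : r ≠ 0 := (rho_pos _ _).ne'
  let D : M n →ₗ[ℝ] M n := (LinearMap.id : ℝ →ₗ[ℝ] ℝ).prodMap
    ((s • (LinearMap.id : V n →ₗ[ℝ] V n)).prodMap (r • (LinearMap.id : ℝ →ₗ[ℝ] ℝ)))
  let w : M n := (0, (-(r⁻¹ * (θ * shi θ y.2.2 * s))) • y.2.1, 0)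
  have h : ((twistJ n θ y : M n →L[ℝ] M n) : M n →ₗ[ℝ] M n) =
      (LinearMap.transvection (coordL n).toLinearMap w).comp D := by
    refine LinearMap.ext fun d => ?_
    refine Prod.ext ?_ (Prod.ext ?_ ?_)
    · simp [twistJ, D, w, LinearMap.transvection]
    · simp [twistJ, D, w, LinearMap.transvection, smul_smul, s, r]
      rw [sub_eq_add_neg, ← neg_smul]
      congr 2
      have hr' : rho θ y.2.2 ≠ 0 := hr
      field_simp
      rw [neg_smul]
    · simp [twistJ, D, w, LinearMap.transvection, s, r]
  rw [ContinuousLinearMap.det, h, LinearMap.det_comp, LinearMap.transvection.det]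
  have hD : LinearMap.det D = s ^ (2 * n) * r := by
    simp only [D, LinearMap.det_prodMap, LinearMap.det_id, LinearMap.det_smul, one_mul]
    congr 1
    · simp [two_mul]
    · simp
  rw [hD]
  simp [w, twistDet, s, r, mul_comm]

theorem jacInv_eq (θ : ℝ) (x : M n) : jacInv n θ x = (twistDet n θ x.2.2)⁻¹ := by
  have hs : DifferentiableAt ℝ (twist n θ).symm x :=
    ((hasTemperateGrowth_twist_symm (n := n) θ).1.differentiable (by simp)) x
  have h1 := (hasFDerivAt_twist θ ((twist n θ).symm x)).comp x hs.hasFDerivAt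
  rw [Equiv.apply_symm_apply] at h1
  have h2 : (twist n θ) ∘ (twist n θ).symm = id := by ext1 y; simp
  rw [h2] at h1
  have h3 := h1.unique (hasFDerivAt_id x)
  have h4 := congrArg (fun L : M n →L[ℝ] M n => LinearMap.det (L : M n →ₗ[ℝ] M n)) h3
  simp only [ContinuousLinearMap.coe_id, LinearMap.det_id] at h4
  change LinearMap.det ((twistJ n θ x).toLinearMap ∘ₗ
    (fderiv ℝ (twist n θ).symm x).toLinearMap) = 1 at h4
  rw [LinearMap.det_comp] at h4
  have h5 := det_twistJ θ x
  rw [ContinuousLinearMap.det] at h5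
  rw [h5] at h4
  rw [jacInv, ContinuousLinearMap.det, eq_inv_of_mul_eq_one_right h4,
    abs_of_pos (inv_pos.2 (twistDet_pos n θ _))]

theorem hasTemperateGrowth_twistDet (n : ℕ) (θ : ℝ) : (twistDet n θ).HasTemperateGrowth :=
  (hasTemperateGrowth_rho θ).mul ((hasTemperateGrowth_chi_inv θ).pow _)

theorem integral_twist (θ : ℝ) (F : M n → ℂ) :
    ∫ x, F x = ∫ y, (twistDet n θ (phi θ y.2.2) : ℂ) * F (twist n θ y) := by
  have h := integral_image_eq_integral_abs_det_fderiv_smul (volume : Measure (M n)) MeasurableSet.univ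
    (fun x _ => (hasFDerivAt_twist θ x).hasFDerivWithinAt) (twist n θ).injective.injOn F
  rw [Set.image_univ, (twist n θ).surjective.range_eq] at h
  simp only [setIntegral_univ, det_twistJ, abs_of_pos (twistDet_pos _ _ _), Complex.real_smul] at h
  exact h

theorem integrable_twist_iff (θ : ℝ) (F : M n → ℂ) :
    Integrable F ↔ Integrable (fun y => (twistDet n θ (phi θ y.2.2) : ℂ) * F (twist n θ y)) := by
  have h := integrableOn_image_iff_integrableOn_abs_det_fderiv_smul (volume : Measure (M n))
    MeasurableSet.univ (fun x _ => (hasFDerivAt_twist θ x).hasFDerivWithinAt)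
    (twist n θ).injective.injOn F
  rw [Set.image_univ, (twist n θ).surjective.range_eq] at h
  simp only [integrableOn_univ, det_twistJ, abs_of_pos (twistDet_pos _ _ _), Complex.real_smul] at h
  exact h

end Twist

/-! ### The partial Fourier transformation on `𝓢` and the map `T` -/

section OperatorT

variable {n : ℕ}

/-- The decomposition `M = (ℝ × V) × ℝ`. -/
def splitL (n : ℕ) : M n ≃L[ℝ] (ℝ × V n) × ℝ := (ContinuousLinearEquiv.prodAssoc ℝ ℝ (V n) ℝ).symm

@[simp] theorem splitL_apply (x : M n) : splitL n x = ((x.1, x.2.1), x.2.2) := rfl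

@[simp] theorem splitL_symm_apply (y : (ℝ × V n) × ℝ) :
    (splitL n).symm y = (y.1.1, y.1.2, y.2) := rfl

/-- The partial Fourier transformation in `ℓ`, on `𝓢`. -/
def pF : 𝓢(M n, ℂ) →L[ℂ] 𝓢(M n, ℂ) := FT (splitL n)

/-- The inverse partial Fourier transformation in `ℓ`, on `𝓢`. -/
def pFi : 𝓢(M n, ℂ) →L[ℂ] 𝓢(M n, ℂ) := FTInv (splitL n)

theorem pF_apply (u : 𝓢(M n, ℂ)) (x : M n) : pF u x = pFourier u x := by
  rw [pF, FT_apply, pFourier]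
  simp [mul_assoc]

theorem pFi_apply (u : 𝓢(M n, ℂ)) (x : M n) : pFi u x = pFourierInv u x := by
  rw [pFi, FTInv_apply, pFourierInv]
  have h : (ftConst ℝ : ℂ) = (2 * Real.pi : ℂ)⁻¹ := by
    rw [ftConst, Module.finrank_self, pow_one, abs_of_pos (by positivity)]
    push_cast
    rfl
  rw [h]
  simp [mul_assoc]

@[simp] theorem pFi_pF (u : 𝓢(M n, ℂ)) : pFi (pF u) = u := FTInv_FT _ u

@[simp] theorem pF_pFi (u : 𝓢(M n, ℂ)) : pF (pFi u) = u := FT_FTInv _ u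

theorem toDist_apply (u g : 𝓢(M n, ℂ)) : toDist u g = ∫ x, u x * g x :=
  (toTemperedDistributionCLM_apply_apply volume u g).trans (by simp only [smul_eq_mul, mul_comm])

theorem pF_injective : Function.Injective (pF (n := n)) :=
  Function.LeftInverse.injective pFi_pF

/-- Multiplication by a function of the last coordinate. -/
def mulL (g : ℝ → ℂ) : 𝓢(M n, ℂ) →L[ℂ] 𝓢(M n, ℂ) := smulLeftCLM ℂ (fun x => g x.2.2)

theorem mulL_apply {g : ℝ → ℂ} (hg : g.HasTemperateGrowth) (u : 𝓢(M n, ℂ)) (x : M n) :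
    mulL g u x = g x.2.2 * u x := by
  rw [mulL, smulLeftCLM_apply_apply (hasTemperateGrowth_comp_coordL hg), smul_eq_mul]

/-- Pullback by the twisting map. -/
def twistPull (θ : ℝ) : 𝓢(M n, ℂ) →L[ℂ] 𝓢(M n, ℂ) :=
  pullbackCLM (twist n θ) (twistJ n θ) (hasTemperateGrowth_twistJ θ) (hasFDerivAt_twist θ)
    (norm_le_of_twist θ)

@[simp] theorem twistPull_apply (θ : ℝ) (u : 𝓢(M n, ℂ)) (x : M n) :
    twistPull θ u x = u (twist n θ x) := rfl

/-- The function `exp ∘ f` is an invertible Schwartz multiplier. -/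
structure IsInvMult (f : ℝ → ℂ) : Prop where
  mult : (fun ξ => Complex.exp (f ξ)).HasTemperateGrowth
  mult_inv : (fun ξ => Complex.exp (-f ξ)).HasTemperateGrowth

/-- The restriction of `T⁻¹` to `𝓢`, as a continuous operator of `𝓢`. -/
def Ti (n : ℕ) (θ : ℝ) (f : ℝ → ℂ) : 𝓢(M n, ℂ) →L[ℂ] 𝓢(M n, ℂ) :=
  pFi.comp ((twistPull θ).comp ((mulL fun ξ => Complex.exp (-f ξ)).comp pF))

/-- The transpose of `T`, as a continuous operator of `𝓢`. -/
def Tt (n : ℕ) (θ : ℝ) (f : ℝ → ℂ) : 𝓢(M n, ℂ) →L[ℂ] 𝓢(M n, ℂ) :=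
  pF.comp ((twistPull θ).comp
    ((mulL fun ξ => Complex.exp (f ξ) * (twistDet n θ ξ : ℂ)).comp pFi))

variable {θ : ℝ} {f : ℝ → ℂ}

theorem pF_Ti (hf : IsInvMult f) (w : 𝓢(M n, ℂ)) (x : M n) :
    pF (Ti n θ f w) x = Complex.exp (-f (phi θ x.2.2)) * pF w (twist n θ x) := by
  simp only [Ti, ContinuousLinearMap.comp_apply, pF_pFi, twistPull_apply]
  rw [mulL_apply hf.mult_inv]
  rfl

theorem symbolT_eq (u : 𝓢(M n, ℂ)) (x : M n) :
    symbolT θ f u x = Complex.exp (f x.2.2) * pF u ((twist n θ).symm x) := by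
  rw [symbolT, pF_apply]

theorem symbolT_Ti (hf : IsInvMult f) (w : 𝓢(M n, ℂ)) (x : M n) :
    symbolT θ f (Ti n θ f w) x = pF w x := by
  rw [symbolT_eq, pF_Ti hf, Equiv.apply_symm_apply, ← mul_assoc, ← Complex.exp_add]
  have h : phi θ ((twist n θ).symm x).2.2 = x.2.2 := phi_phiInv θ _
  rw [h, add_neg_cancel, Complex.exp_zero, one_mul]

/-- The change of variables by the twisting map moves all factors to the test function. -/
theorem twistDet_mul_symbolT (hf : IsInvMult f) (u g : 𝓢(M n, ℂ)) (y : M n) :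
    (twistDet n θ (phi θ y.2.2) : ℂ) * (symbolT θ f u (twist n θ y) * pFi g (twist n θ y)) =
      pF u y * twistPull θ (mulL (fun ξ => Complex.exp (f ξ) * (twistDet n θ ξ : ℂ)) (pFi g)) y := by
  have hm : (fun ξ => Complex.exp (f ξ) * (twistDet n θ ξ : ℂ)).HasTemperateGrowth :=
    hf.mult.fun_mul
      (Function.Complex.hasTemperateGrowth_ofReal.comp (hasTemperateGrowth_twistDet n θ))
  rw [twistPull_apply, mulL_apply hm, symbolT_eq, Equiv.symm_apply_apply]
  have h : (twist n θ y).2.2 = phi θ y.2.2 := rfl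
  rw [h]
  ring

theorem integrable_symbolT_mul (hf : IsInvMult f) (u g : 𝓢(M n, ℂ)) :
    Integrable fun x => symbolT θ f u x * pFi g x := by
  rw [integrable_twist_iff θ]
  simp only [twistDet_mul_symbolT hf]
  exact (SchwartzMap.pairing (ContinuousLinearMap.mul ℂ ℂ) (pF u)
    (twistPull θ (mulL (fun ξ => Complex.exp (f ξ) * (twistDet n θ ξ : ℂ)) (pFi g)))).integrable

theorem integral_symbolT_mul (hf : IsInvMult f) (u g : 𝓢(M n, ℂ)) :
    ∫ x, symbolT θ f u x * pFi g x = ∫ x, u x * Tt n θ f g x := by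
  rw [integral_twist θ]
  simp only [twistDet_mul_symbolT hf]
  exact integral_FT_mul (splitL n) volume u _

theorem exists_isT (hf : IsInvMult f) : ∃ L, IsT (n := n) θ f L := by
  refine ⟨(PointwiseConvergenceCLM.precomp ℂ (Tt n θ f)).toLinearMap ∘ₗ
    (toTemperedDistributionCLM (M n) ℂ volume).toLinearMap, fun u g => ⟨?_, ?_⟩⟩
  · simpa only [pFi_apply] using integrable_symbolT_mul (θ := θ) hf u g
  · simp only [← pFi_apply]
    rw [integral_symbolT_mul hf]
    exact toDist_apply u (Tt n θ f g)

theorem isT_T (hf : IsInvMult f) : IsT θ f (T n θ f) := by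
  have h := exists_isT (n := n) (θ := θ) hf
  rw [T, dif_pos h]
  exact h.choose_spec

theorem T_apply (hf : IsInvMult f) (u g : 𝓢(M n, ℂ)) :
    T n θ f u g = ∫ x, symbolT θ f u x * pFi g x := by
  simp only [pFi_apply]
  exact (isT_T hf u g).2

theorem T_apply_eq_integral_Tt (hf : IsInvMult f) (u g : 𝓢(M n, ℂ)) :
    T n θ f u g = ∫ x, u x * Tt n θ f g x := by
  rw [T_apply hf, integral_symbolT_mul hf]

/-- A continuous function whose integral against all Schwartz functions vanishes is zero. -/
theorem eq_zero_of_integral_mul_eq_zero {F : M n → ℂ} (hF : Continuous F)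
    (h : ∀ g : 𝓢(M n, ℂ), ∫ x, F x * g x = 0) : F = 0 := by
  have h0 : F =ᵐ[volume] 0 := by
    refine ae_eq_zero_of_integral_contDiff_smul_eq_zero hF.locallyIntegrable fun g hg hg' => ?_
    have h1 : HasCompactSupport (fun x => (g x : ℂ)) := hg'.comp_left (g := Complex.ofReal) rfl
    rw [← h (h1.toSchwartzMap (Complex.ofRealCLM.contDiff.comp hg))]
    congr 1
    ext x
    exact mul_comm (g x : ℂ) (F x)
  exact hF.ae_eq_iff_eq volume continuous_zero |>.1 h0

theorem continuous_symbolT (hf : IsInvMult f) (u : 𝓢(M n, ℂ)) : Continuous (symbolT θ f u) := by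
  have h : symbolT θ f u = fun x => Complex.exp (f x.2.2) * pF u ((twist n θ).symm x) :=
    funext fun x => symbolT_eq u x
  rw [h]
  have h1 : Continuous fun x : M n => (twist n θ).symm x :=
    (hasTemperateGrowth_twist_symm θ).1.continuous
  exact (hf.mult.1.continuous.comp (by fun_prop)).mul ((pF u).continuous.comp h1)

/-- `T u` determines the continuous function `symbolT u`, and hence `u`. -/
theorem T_injective (hf : IsInvMult f) : Function.Injective (T n θ f) := by
  rw [injective_iff_map_eq_zero]
  intro u hu
  have h0 : symbolT θ f u = 0 := by
    refine eq_zero_of_integral_mul_eq_zero (continuous_symbolT hf u) fun g => ?_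
    have h := T_apply (θ := θ) hf u (pF g)
    rw [hu, pFi_pF] at h
    exact h.symm
  refine pF_injective ?_
  rw [map_zero]
  ext y
  have h1 := congrFun h0 (twist n θ y)
  rw [symbolT_eq, Equiv.symm_apply_apply] at h1
  exact (mul_eq_zero.1 h1).resolve_left (Complex.exp_ne_zero _)

theorem T_Ti (hf : IsInvMult f) (w : 𝓢(M n, ℂ)) : T n θ f (Ti n θ f w) = toDist w := by
  refine DFunLike.ext _ _ fun g => ?_
  rw [T_apply hf, toDist_apply]
  simp only [symbolT_Ti hf]
  have h := integral_FT_mul (splitL n) volume w (pFi g)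
  refine h.trans ?_
  change ∫ x, w x * pF (pFi g) x = _
  simp only [pF_pFi]

theorem toDist_mem_E (hf : IsInvMult f) (w : 𝓢(M n, ℂ)) : toDist w ∈ E n θ f :=
  ⟨_, T_Ti hf w⟩

theorem Tinv_eq (hf : IsInvMult f) {a : E n θ f} {u : 𝓢(M n, ℂ)} (h : T n θ f u = a) :
    Tinv a = u := T_injective hf ((T_Tinv a).trans h.symm)

theorem Tinv_toDist (hf : IsInvMult f) (w : 𝓢(M n, ℂ)) (hw : toDist w ∈ E n θ f) :
    Tinv ⟨toDist w, hw⟩ = Ti n θ f w := Tinv_eq hf (T_Ti hf w)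

theorem Tinv_star (hf : IsInvMult f) (a b : E n θ f) :
    Tinv (star a b) = weyl n θ (Tinv a) (Tinv b) := Tinv_eq hf rfl

theorem Tinv_injective (a b : E n θ f) (h : Tinv a = Tinv b) : a = b := by
  refine Subtype.ext ?_
  rw [← T_Tinv a, ← T_Tinv b, h]

/-- `T⁻¹` as a linear equivalence. -/
def TinvEquiv (hf : IsInvMult f) : E n θ f ≃ₗ[ℂ] 𝓢(M n, ℂ) :=
  (LinearEquiv.ofInjective (T n θ f) (T_injective hf)).symm

theorem TinvEquiv_apply (hf : IsInvMult f) (a : E n θ f) : TinvEquiv hf a = Tinv a := by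
  refine (Tinv_eq hf ?_).symm
  exact congrArg Subtype.val ((TinvEquiv hf).symm_apply_apply a)

end OperatorT

/-! ### Weyl symbols and integral kernels -/

section Affine

variable {D D' : Type} [NormedAddCommGroup D] [NormedSpace ℝ D] [FiniteDimensional ℝ D]
  [NormedAddCommGroup D'] [NormedSpace ℝ D']

/-- Pullback of Schwartz functions by the affine map `x ↦ x₀ + L x`, with `L` injective. -/
def affinePull (L : D →L[ℝ] D') (hL : Function.Injective L) (x₀ : D') : 𝓢(D', ℂ) →L[ℂ] 𝓢(D, ℂ) :=
  compCLM ℂ (g := fun x => x₀ + L x) ((Function.HasTemperateGrowth.const x₀).fun_add L.hasTemperateGrowth)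
    (by
      obtain ⟨K, -, hK⟩ := L.toLinearMap.exists_antilipschitzWith (LinearMap.ker_eq_bot.2 hL)
      refine ⟨1, K * (1 + ‖x₀‖), fun x => ?_⟩
      have h1 := hK.le_mul_dist x 0
      simp only [ContinuousLinearMap.coe_coe, map_zero, dist_zero_right] at h1
      have h2 : ‖L x‖ ≤ ‖x₀ + L x‖ + ‖x₀‖ := by
        have := norm_sub_le (x₀ + L x) x₀
        rwa [add_sub_cancel_left] at this
      have hK0 : (0 : ℝ) ≤ K := K.2
      calc ‖x‖ ≤ K * ‖L x‖ := h1
        _ ≤ K * (‖x₀ + L x‖ + ‖x₀‖) := mul_le_mul_of_nonneg_left h2 hK0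
        _ ≤ K * ((1 + ‖x₀‖) * (1 + ‖x₀ + L x‖)) := by
          refine mul_le_mul_of_nonneg_left ?_ hK0
          nlinarith [norm_nonneg x₀, norm_nonneg (x₀ + L x)]
        _ = _ := by ring)

@[simp] theorem affinePull_apply (L : D →L[ℝ] D') (hL : Function.Injective L) (x₀ : D')
    (F : 𝓢(D', ℂ)) (x : D) : affinePull L hL x₀ F x = F (x₀ + L x) := rfl

/-- A unimodular continuous factor does not affect the integrability of Schwartz functions. -/
theorem integrable_phase_mul [MeasurableSpace D] [BorelSpace D] (μ : Measure D)
    [μ.HasTemperateGrowth] {φ : D → ℝ} (hφ : Continuous φ) (F : 𝓢(D, ℂ)) :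
    Integrable (fun x => Complex.exp (Complex.I * φ x) * F x) μ := by
  refine F.integrable.bdd_mul (c := 1) (Continuous.aestronglyMeasurable (by fun_prop))
    (.of_forall fun x => ?_)
  rw [mul_comm, Complex.norm_exp_ofReal_mul_I]

end Affine

section Kappa

variable {n : ℕ}

/-- The configuration space of the kernels. -/
abbrev Cf (n : ℕ) : Type := ℝ × EuclideanSpace ℝ (Fin n)

instance : (volume : Measure (Cf n)).IsAddHaarMeasure :=
  Measure.prod.instIsAddHaarMeasure (volume : Measure ℝ) (volume : Measure (EuclideanSpace ℝ (Fin n)))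

instance : (volume : Measure (EuclideanSpace ℝ (Fin n) × Cf n)).IsAddHaarMeasure :=
  Measure.prod.instIsAddHaarMeasure (volume : Measure (EuclideanSpace ℝ (Fin n)))
    (volume : Measure (Cf n))

instance : (volume : Measure (ℝ × V n)).IsAddHaarMeasure :=
  Measure.prod.instIsAddHaarMeasure (volume : Measure ℝ) (volume : Measure (V n))

/-- The decomposition of `M` which isolates the coordinate `q`. -/
def splitQ (n : ℕ) : M n ≃L[ℝ] (ℝ × EuclideanSpace ℝ (Fin n) × ℝ) × EuclideanSpace ℝ (Fin n) :=
  LinearEquiv.toContinuousLinearEquiv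
    { toFun := fun x => ((x.1, x.2.1.1, x.2.2), x.2.1.2)
      invFun := fun y => (y.1.1, (y.1.2.1, y.2), y.1.2.2)
      map_add' := fun _ _ => rfl
      map_smul' := fun _ _ => rfl
      left_inv := fun _ => rfl
      right_inv := fun _ => rfl }

@[simp] theorem splitQ_apply (x : M n) : splitQ n x = ((x.1, x.2.1.1, x.2.2), x.2.1.2) := rfl

@[simp] theorem splitQ_symm_apply
    (y : (ℝ × EuclideanSpace ℝ (Fin n) × ℝ) × EuclideanSpace ℝ (Fin n)) :
    (splitQ n).symm y = (y.1.1, (y.1.2.1, y.2), y.1.2.2) := rfl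

variable {θ : ℝ}

/-- Kernel coordinates: the pair `(s, p), (t, p')` corresponds to the midpoint and the (scaled)
difference. -/
def kerCoord (n : ℕ) (hθ : θ ≠ 0) : (Cf n × Cf n) ≃L[ℝ] M n :=
  LinearEquiv.toContinuousLinearEquiv
    { toFun := fun z => ((2 : ℝ)⁻¹ * (z.1.1 + z.2.1), ((2 : ℝ)⁻¹ • (z.1.2 + z.2.2),
        (4 * θ)⁻¹ • (z.2.2 - z.1.2)), (2 * θ)⁻¹ * (z.2.1 - z.1.1))
      invFun := fun x => ((x.1 - θ * x.2.2, x.2.1.1 - (2 * θ) • x.2.1.2),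
        (x.1 + θ * x.2.2, x.2.1.1 + (2 * θ) • x.2.1.2))
      map_add' := fun z z' => by
        refine Prod.ext ?_ (Prod.ext (Prod.ext ?_ ?_) ?_)
        · simp; ring
        · simp only [Prod.fst_add, Prod.snd_add]; module
        · simp only [Prod.fst_add, Prod.snd_add]; module
        · simp; ring
      map_smul' := fun c z => by
        refine Prod.ext ?_ (Prod.ext (Prod.ext ?_ ?_) ?_)
        · simp; ring
        · simp only [Prod.smul_fst, Prod.smul_snd, RingHom.id_apply]; module
        · simp only [Prod.smul_fst, Prod.smul_snd, RingHom.id_apply]; module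
        · simp; ring
      left_inv := fun z => by
        refine Prod.ext (Prod.ext ?_ ?_) (Prod.ext ?_ ?_)
        · simp; field_simp; ring
        · simp only [smul_smul]
          have : 2 * θ * (4 * θ)⁻¹ = 2⁻¹ := by field_simp; norm_num
          rw [this]; module
        · simp; field_simp; ring
        · simp only [smul_smul]
          have : 2 * θ * (4 * θ)⁻¹ = 2⁻¹ := by field_simp; norm_num
          rw [this]; module
      right_inv := fun x => by
        refine Prod.ext ?_ (Prod.ext (Prod.ext ?_ ?_) ?_)
        · simp; ring
        · simp only; module
        · have : (4 * θ)⁻¹ * (2 * (2 * θ)) = 1 := by field_simp; norm_num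
          simp only [add_sub_sub_cancel, ← two_smul ℝ ((2 * θ) • x.2.1.2), smul_smul, this,
            one_smul]
        · simp; field_simp; ring }

/-- The Weyl symbol to kernel map: Fourier transformation in `ℓ` and `q`, and linear change of
coordinates. -/
def kappa (n : ℕ) (hθ : θ ≠ 0) : 𝓢(M n, ℂ) →L[ℂ] 𝓢(Cf n × Cf n, ℂ) :=
  (compCLMOfContinuousLinearEquiv ℂ (kerCoord n hθ)).comp ((FT (splitQ n)).comp pF)

/-- The inverse of `kappa`. -/
def kappaInv (n : ℕ) (hθ : θ ≠ 0) : 𝓢(Cf n × Cf n, ℂ) →L[ℂ] 𝓢(M n, ℂ) :=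
  (pFi.comp (FTInv (splitQ n))).comp (compCLMOfContinuousLinearEquiv ℂ (kerCoord n hθ).symm)

theorem kappaInv_kappa (hθ : θ ≠ 0) (u : 𝓢(M n, ℂ)) : kappaInv n hθ (kappa n hθ u) = u := by
  have h : compCLMOfContinuousLinearEquiv ℂ (kerCoord n hθ).symm (kappa n hθ u) =
      FT (splitQ n) (pF u) := by
    ext x; simp [kappa]
  change pFi (FTInv (splitQ n) (compCLMOfContinuousLinearEquiv ℂ (kerCoord n hθ).symm
    (kappa n hθ u))) = u
  rw [h, FTInv_FT, pFi_pF]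

theorem kappa_kappaInv (hθ : θ ≠ 0) (K : 𝓢(Cf n × Cf n, ℂ)) : kappa n hθ (kappaInv n hθ K) = K := by
  change compCLMOfContinuousLinearEquiv ℂ (kerCoord n hθ) (FT (splitQ n) (pF (pFi
    (FTInv (splitQ n) (compCLMOfContinuousLinearEquiv ℂ (kerCoord n hθ).symm K))))) = K
  rw [pF_pFi, FT_FTInv]
  ext x; simp

/-- The product of symbols corresponding to the composition of kernels. -/
def symbProd (n : ℕ) (hθ : θ ≠ 0) : 𝓢(M n, ℂ) →ₗ[ℂ] 𝓢(M n, ℂ) →ₗ[ℂ] 𝓢(M n, ℂ) :=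
  ((compK (X := Cf n)).compl₁₂ (kappa n hθ).toLinearMap (kappa n hθ).toLinearMap).compr₂
    (kappaInv n hθ).toLinearMap

theorem kappa_symbProd (hθ : θ ≠ 0) (u v : 𝓢(M n, ℂ)) :
    kappa n hθ (symbProd n hθ u v) = compK (kappa n hθ u) (kappa n hθ v) :=
  kappa_kappaInv hθ _

theorem kappa_apply (hθ : θ ≠ 0) (u : 𝓢(M n, ℂ)) (z : Cf n × Cf n) :
    kappa n hθ u z = ∫ q, Complex.exp (-(Complex.I * ⟪q, (4 * θ)⁻¹ • (z.2.2 - z.1.2)⟫_ℝ)) *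
      pF u ((2 : ℝ)⁻¹ * (z.1.1 + z.2.1), ((2 : ℝ)⁻¹ • (z.1.2 + z.2.2), q),
        (2 * θ)⁻¹ * (z.2.1 - z.1.1)) :=
  FT_apply (splitQ n) (pF u) (kerCoord n hθ z)

theorem pF_symbProd (hθ : θ ≠ 0) (u v : 𝓢(M n, ℂ)) (a : ℝ) (p q : EuclideanSpace ℝ (Fin n))
    (ξ : ℝ) :
    pF (symbProd n hθ u v) (a, (p, q), ξ) = ftConst (EuclideanSpace ℝ (Fin n)) *
      ∫ y, Complex.exp (Complex.I * ⟪y, q⟫_ℝ) * ∫ z : Cf n,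
        kappa n hθ u ((a - θ * ξ, p - (2 * θ) • y), z) *
        kappa n hθ v (z, (a + θ * ξ, p + (2 * θ) • y)) := by
  have h : pF (symbProd n hθ u v) = FTInv (splitQ n)
      (compCLMOfContinuousLinearEquiv ℂ (kerCoord n hθ).symm
        (compK (kappa n hθ u) (kappa n hθ v))) := pF_pFi _
  rw [h, FTInv_apply]
  congr 2
  ext y
  congr 1
  exact compK_apply _ _ _

end Kappa

/-! ### Integral formulas for the product of symbols -/

section Formula

variable {n : ℕ} {θ : ℝ}

/-- The inclusion of the integration variables of `pF_symbProd` into the kernel coordinates. -/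
def kerIncl (n : ℕ) (θ : ℝ) :
    EuclideanSpace ℝ (Fin n) × Cf n →L[ℝ] (Cf n × Cf n) × (Cf n × Cf n) :=
  LinearMap.toContinuousLinearMap
    { toFun := fun w => (((0, -((2 * θ) • w.1)), w.2), (w.2, (0, (2 * θ) • w.1)))
      map_add' := fun w w' => by
        simp only [Prod.fst_add, Prod.snd_add, smul_add, neg_add, Prod.mk_add_mk, add_zero]
      map_smul' := fun c w => by
        simp only [Prod.smul_fst, Prod.smul_snd, smul_comm (2 * θ) c, RingHom.id_apply,
          Prod.smul_mk, smul_neg, smul_zero] }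

theorem kerIncl_apply (w : EuclideanSpace ℝ (Fin n) × Cf n) :
    kerIncl n θ w = (((0, -((2 * θ) • w.1)), w.2), (w.2, (0, (2 * θ) • w.1))) := rfl

theorem kerIncl_injective (hθ : θ ≠ 0) : Function.Injective (kerIncl n θ) := by
  intro w w' h
  simp only [kerIncl_apply, Prod.mk.injEq] at h
  exact Prod.ext (smul_right_injective _ (mul_ne_zero two_ne_zero hθ) h.2.2.2) h.1.2

/-- The change of the integration variables `(r, p₁, p₂) ↦ (y, r, ρ)` with `2θy = p₂ - p₁` and
`ρ = p₁ + p₂` (up to a translation). -/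
def kerChange (n : ℕ) (hθ : θ ≠ 0) :
    (ℝ × (EuclideanSpace ℝ (Fin n) × EuclideanSpace ℝ (Fin n))) ≃L[ℝ]
      EuclideanSpace ℝ (Fin n) × Cf n :=
  LinearEquiv.toContinuousLinearEquiv
    { toFun := fun w => ((2 * θ)⁻¹ • (w.2.2 - w.2.1), (w.1, w.2.1 + w.2.2))
      invFun := fun w => (w.2.1, ((2 : ℝ)⁻¹ • w.2.2 - θ • w.1, (2 : ℝ)⁻¹ • w.2.2 + θ • w.1))
      map_add' := fun w w' => by
        refine Prod.ext ?_ (Prod.ext rfl ?_)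
        · simp only [Prod.fst_add, Prod.snd_add]; module
        · simp only [Prod.fst_add, Prod.snd_add]; module
      map_smul' := fun c w => by
        refine Prod.ext ?_ (Prod.ext rfl ?_)
        · simp only [Prod.smul_fst, Prod.smul_snd, RingHom.id_apply]; module
        · simp only [Prod.smul_fst, Prod.smul_snd, RingHom.id_apply]; module
      left_inv := fun w => by
        have h : θ * (2 * θ)⁻¹ = 2⁻¹ := by field_simp
        refine Prod.ext rfl (Prod.ext ?_ ?_) <;> simp only [smul_smul, h] <;> module
      right_inv := fun w => by
        have h : (2 * θ)⁻¹ * (2 * θ) = 1 := inv_mul_cancel₀ (mul_ne_zero two_ne_zero hθ)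
        refine Prod.ext ?_ (Prod.ext rfl ?_)
        · have h2 : (2 : ℝ)⁻¹ • w.2.2 + θ • w.1 - ((2 : ℝ)⁻¹ • w.2.2 - θ • w.1) =
            (2 * θ) • w.1 := by module
          simp only [h2, smul_smul, h, one_smul]
        · simp only; module }

theorem kerChange_apply (hθ : θ ≠ 0)
    (w : ℝ × (EuclideanSpace ℝ (Fin n) × EuclideanSpace ℝ (Fin n))) :
    kerChange n hθ w = ((2 * θ)⁻¹ • (w.2.2 - w.2.1), (w.1, w.2.1 + w.2.2)) := rfl

/-- The rearrangement `((p₁, p₂), (q₁, q₂)) ↦ ((p₁, q₁), (p₂, q₂))`. -/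
def shuffleV (n : ℕ) : ((EuclideanSpace ℝ (Fin n) × EuclideanSpace ℝ (Fin n)) ×
    (EuclideanSpace ℝ (Fin n) × EuclideanSpace ℝ (Fin n))) ≃L[ℝ] V n × V n :=
  ContinuousLinearEquiv.prodProdProdComm ℝ _ _ _ _

theorem shuffleV_apply (w : (EuclideanSpace ℝ (Fin n) × EuclideanSpace ℝ (Fin n)) ×
    (EuclideanSpace ℝ (Fin n) × EuclideanSpace ℝ (Fin n))) :
    shuffleV n w = ((w.1.1, w.2.1), (w.1.2, w.2.2)) := rfl

/-- The inclusion of `V × V` into `M × M`. -/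
def inclVV (n : ℕ) : V n × V n →L[ℝ] M n × M n :=
  ((ContinuousLinearMap.inr ℝ ℝ (V n × ℝ)).comp (ContinuousLinearMap.inl ℝ (V n) ℝ)).prodMap
    ((ContinuousLinearMap.inr ℝ ℝ (V n × ℝ)).comp (ContinuousLinearMap.inl ℝ (V n) ℝ))

theorem inclVV_apply (w : V n × V n) : inclVV n w = ((0, w.1, 0), (0, w.2, 0)) := rfl

theorem inclVV_injective : Function.Injective (inclVV n) := by
  intro w w' h
  simp only [inclVV_apply, Prod.mk.injEq] at h
  exact Prod.ext h.1.2.1 h.2.2.1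

/-- The two Fourier integrals in `q₁, q₂` and the phase in `p₁, p₂` combine to the symplectic
phase on `V × V`. -/
theorem exists_integral_kappa_mul_kappa (hθ : θ ≠ 0) : ∃ k : ℝ, 0 < k ∧
    ∀ (u v : 𝓢(M n, ℂ)) (p q : EuclideanSpace ℝ (Fin n)) (s t r : ℝ),
    ∫ w : EuclideanSpace ℝ (Fin n) × EuclideanSpace ℝ (Fin n),
      Complex.exp (Complex.I * ⟪(2 * θ)⁻¹ • (w.2 - w.1), q⟫_ℝ) *
        (kappa n hθ u ((s, p - (w.2 - w.1)), (r, w.1 + w.2 - p)) *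
          kappa n hθ v ((r, w.1 + w.2 - p), (t, p + (w.2 - w.1)))) =
    k * ∫ w : V n × V n,
      Complex.exp (Complex.I * ((2 * θ)⁻¹ * Om (w.1 - (p, q)) (w.2 - (p, q)) : ℝ)) *
        (pF u (2⁻¹ * (s + r), w.1, (2 * θ)⁻¹ * (r - s)) *
          pF v (2⁻¹ * (r + t), w.2, (2 * θ)⁻¹ * (t - r))) := by
  obtain ⟨k, hk, h⟩ := exists_integral_comp_linearEquiv
    (volume : Measure ((EuclideanSpace ℝ (Fin n) × EuclideanSpace ℝ (Fin n)) ×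
    (EuclideanSpace ℝ (Fin n) × EuclideanSpace ℝ (Fin n)))) (volume : Measure (V n × V n)) (shuffleV n)
  refine ⟨k, hk, fun u v p q s t r => ?_⟩
  rw [← h]
  let F : V n × V n → ℂ := fun w =>
    Complex.exp (Complex.I * ((2 * θ)⁻¹ * Om (w.1 - (p, q)) (w.2 - (p, q)) : ℝ)) *
        (pF u (2⁻¹ * (s + r), w.1, (2 * θ)⁻¹ * (r - s)) *
          pF v (2⁻¹ * (r + t), w.2, (2 * θ)⁻¹ * (t - r)))
  have hF : Integrable F := by
    have h1 := integrable_phase_mul (volume : Measure (V n × V n))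
      (φ := fun w => (2 * θ)⁻¹ * Om (w.1 - (p, q)) (w.2 - (p, q))) (by unfold Om; fun_prop)
      (affinePull (inclVV n) inclVV_injective
        ((2⁻¹ * (s + r), 0, (2 * θ)⁻¹ * (r - s)), (2⁻¹ * (r + t), 0, (2 * θ)⁻¹ * (t - r)))
        (tens (pF u) (pF v)))
    refine h1.congr (.of_forall fun w => ?_)
    simp [F, inclVV_apply]
  have hF' : Integrable (fun w => F (shuffleV n w)) (volume.prod volume) :=
    (integrable_comp_linearEquiv_iff volume volume (shuffleV n)).2 hF
  change _ = ∫ w, F (shuffleV n w) ∂(volume.prod volume)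
  rw [integral_prod _ hF']
  congr 1
  ext w
  rw [kappa_apply, kappa_apply, ← integral_prod_mul, ← integral_const_mul]
  congr 1
  ext x
  have h4 : (4 * θ)⁻¹ = (2 * θ)⁻¹ * 2⁻¹ := by field_simp; norm_num
  have e1 : (2 : ℝ)⁻¹ • ((p - (w.2 - w.1)) + (w.1 + w.2 - p)) = w.1 := by module
  have e2 : (2 : ℝ)⁻¹ • ((w.1 + w.2 - p) + (p + (w.2 - w.1))) = w.2 := by module
  have e3 : (4 * θ)⁻¹ • ((w.1 + w.2 - p) - (p - (w.2 - w.1))) = (2 * θ)⁻¹ • (w.2 - p) := by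
    rw [h4]; module
  have e4 : (4 * θ)⁻¹ • ((p + (w.2 - w.1)) - (w.1 + w.2 - p)) = (2 * θ)⁻¹ • (p - w.1) := by
    rw [h4]; module
  simp only [e1, e2, e3, e4, F, shuffleV_apply]
  have hph : Complex.exp (Complex.I * ((2 * θ)⁻¹ *
        Om ((w.1, x.1) - (p, q)) ((w.2, x.2) - (p, q)) : ℝ)) =
      Complex.exp (Complex.I * ⟪(2 * θ)⁻¹ • (w.2 - w.1), q⟫_ℝ) *
      (Complex.exp (-(Complex.I * ⟪x.1, (2 * θ)⁻¹ • (w.2 - p)⟫_ℝ)) *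
        Complex.exp (-(Complex.I * ⟪x.2, (2 * θ)⁻¹ • (p - w.1)⟫_ℝ))) := by
    rw [← Complex.exp_add, ← Complex.exp_add]
    congr 1
    have : (2 * θ)⁻¹ * Om ((w.1, x.1) - (p, q)) ((w.2, x.2) - (p, q)) =
        ⟪(2 * θ)⁻¹ • (w.2 - w.1), q⟫_ℝ - ⟪x.1, (2 * θ)⁻¹ • (w.2 - p)⟫_ℝ
          - ⟪x.2, (2 * θ)⁻¹ • (p - w.1)⟫_ℝ := by
      simp only [Om, Prod.mk_sub_mk, inner_sub_left, inner_sub_right, real_inner_smul_left,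
        real_inner_smul_right, real_inner_comm w.1 x.2, real_inner_comm p x.2,
        real_inner_comm p q, real_inner_comm w.2 q]
      ring
    rw [this]
    push_cast
    ring
  rw [hph]
  ring

/-- The partial Fourier transform of a product of symbols. -/
theorem exists_pF_symbProd (hθ : θ ≠ 0) : ∃ c : ℝ, 0 < c ∧
    ∀ (u v : 𝓢(M n, ℂ)) (a : ℝ) (x : V n) (ξ : ℝ),
    pF (symbProd n hθ u v) (a, x, ξ) = c * ∫ r : ℝ, ∫ w : V n × V n,
      Complex.exp (Complex.I * ((2 * θ)⁻¹ * Om (w.1 - x) (w.2 - x) : ℝ)) *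
        (pF u (2⁻¹ * (a - θ * ξ + r), w.1, (2 * θ)⁻¹ * (r - (a - θ * ξ))) *
          pF v (2⁻¹ * (r + (a + θ * ξ)), w.2, (2 * θ)⁻¹ * (a + θ * ξ - r))) := by
  obtain ⟨k, hk, h⟩ := exists_integral_kappa_mul_kappa (n := n) hθ
  obtain ⟨k', hk', h'⟩ := exists_integral_comp_linearEquiv
    (volume : Measure (ℝ × (EuclideanSpace ℝ (Fin n) × EuclideanSpace ℝ (Fin n))))
    (volume : Measure (EuclideanSpace ℝ (Fin n) × Cf n)) (kerChange n hθ)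
  refine ⟨ftConst (EuclideanSpace ℝ (Fin n)) * (k'⁻¹ * k),
    mul_pos ftConst_pos (mul_pos (inv_pos.2 hk') hk), ?_⟩
  rintro u v a ⟨p, q⟩ ξ
  let G : EuclideanSpace ℝ (Fin n) × Cf n → ℂ := fun w =>
    Complex.exp (Complex.I * ⟪w.1, q⟫_ℝ) *
      (kappa n hθ u ((a - θ * ξ, p - (2 * θ) • w.1), w.2) *
        kappa n hθ v (w.2, (a + θ * ξ, p + (2 * θ) • w.1)))
  have hG : Integrable G := by
    have h1 := integrable_phase_mul (volume : Measure (EuclideanSpace ℝ (Fin n) × Cf n))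
      (φ := fun w => ⟪w.1, q⟫_ℝ) (by fun_prop)
      (affinePull (kerIncl n θ) (kerIncl_injective hθ)
        (((a - θ * ξ, p), 0), (0, (a + θ * ξ, p))) (tens (kappa n hθ u) (kappa n hθ v)))
    refine h1.congr (.of_forall fun w => ?_)
    simp [G, kerIncl_apply, sub_eq_add_neg]
  let c : EuclideanSpace ℝ (Fin n) × Cf n := (0, (0, -p))
  have hG2 : Integrable (fun w => G (c + kerChange n hθ w)) (volume.prod volume) :=
    (integrable_comp_linearEquiv_iff volume volume (kerChange n hθ)
      (f := fun w => G (c + w))).2 (hG.comp_add_left c)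
  have h1 : ∫ y, Complex.exp (Complex.I * ⟪y, q⟫_ℝ) * ∫ z : Cf n,
        kappa n hθ u ((a - θ * ξ, p - (2 * θ) • y), z) *
        kappa n hθ v (z, (a + θ * ξ, p + (2 * θ) • y)) = ∫ w, G w := by
    refine Eq.trans ?_ (integral_prod (μ := volume) (ν := volume) G hG).symm
    simp only [G, integral_const_mul]
  have h2 : ∫ w, G (c + kerChange n hθ w) = k' * ∫ w, G w := by
    rw [h' (fun w => G (c + w)), integral_add_left_eq_self]
  have h3 : ∫ w, G (c + kerChange n hθ w) = ∫ r, ∫ w, G (c + kerChange n hθ (r, w)) :=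
    integral_prod (μ := volume) (ν := volume) _ hG2
  have h4 : ∀ w : ℝ × (EuclideanSpace ℝ (Fin n) × EuclideanSpace ℝ (Fin n)),
      G (c + kerChange n hθ w) =
      Complex.exp (Complex.I * ⟪(2 * θ)⁻¹ • (w.2.2 - w.2.1), q⟫_ℝ) *
        (kappa n hθ u ((a - θ * ξ, p - (w.2.2 - w.2.1)), (w.1, w.2.1 + w.2.2 - p)) *
          kappa n hθ v ((w.1, w.2.1 + w.2.2 - p), (a + θ * ξ, p + (w.2.2 - w.2.1)))) := by
    intro w
    have h5 : (2 * θ) * (2 * θ)⁻¹ = 1 := mul_inv_cancel₀ (mul_ne_zero two_ne_zero hθ)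
    simp only [G, c, kerChange_apply, Prod.mk_add_mk, zero_add, smul_smul, h5, one_smul,
      neg_add_eq_sub]
  rw [pF_symbProd, h1, (eq_inv_mul_iff_mul_eq₀ (Complex.ofReal_ne_zero.2 hk'.ne')).2 h2.symm, h3]
  simp only [h4, h, integral_const_mul]
  push_cast
  ring

end Formula

/-! ### The general kernel formula -/

section KernelFormula

variable {n : ℕ} {θ : ℝ}

/-- Integrals over `V × V` under scaling of the two factors. -/
theorem integral_scaleVV {c₁ c₂ : ℝ} (h₁ : 0 < c₁) (h₂ : 0 < c₂) (H : V n × V n → ℂ) :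
    ∫ w, H w = ∫ w : V n × V n, (c₁ ^ (2 * n) * c₂ ^ (2 * n) : ℝ) * H (c₁ • w.1, c₂ • w.2) := by
  let L : V n × V n →L[ℝ] V n × V n :=
    (c₁ • ContinuousLinearMap.id ℝ (V n)).prodMap (c₂ • ContinuousLinearMap.id ℝ (V n))
  have hL : ∀ w, L w = (c₁ • w.1, c₂ • w.2) := fun w => rfl
  have hinj : Function.Injective L := by
    intro w w' h
    simp only [hL, Prod.mk.injEq] at h
    exact Prod.ext (smul_right_injective _ h₁.ne' h.1) (smul_right_injective _ h₂.ne' h.2)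
  have hsurj : Function.Surjective L := fun w => ⟨(c₁⁻¹ • w.1, c₂⁻¹ • w.2), by
    simp [hL, smul_smul, h₁.ne', h₂.ne']⟩
  have hdet : L.det = c₁ ^ (2 * n) * c₂ ^ (2 * n) := by
    have : (L : V n × V n →ₗ[ℝ] V n × V n) =
        (c₁ • (LinearMap.id : V n →ₗ[ℝ] V n)).prodMap (c₂ • (LinearMap.id : V n →ₗ[ℝ] V n)) := rfl
    rw [ContinuousLinearMap.det, this, LinearMap.det_prodMap, LinearMap.det_smul,
      LinearMap.det_smul]
    simp [two_mul]
  have h := integral_image_eq_integral_abs_det_fderiv_smul (volume : Measure (V n × V n))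
    MeasurableSet.univ (fun x _ => L.hasFDerivAt.hasFDerivWithinAt) hinj.injOn H
  rw [Set.image_univ, hsurj.range_eq] at h
  simp only [setIntegral_univ, hdet, Complex.real_smul] at h
  rw [abs_of_pos (by positivity)] at h
  exact h

/-- The change of variables `((ξ, r), ((v₁, v₂), (ℓ₁, ℓ₂))) ↦ ((a₁, v₁, ℓ₁), (a₂, v₂, ℓ₂))` with
`a₂ - a₁ = θξ` and `a₁ + a₂ = r`. -/
def pairCoord (n : ℕ) (hθ : θ ≠ 0) :
    ((ℝ × ℝ) × ((V n × V n) × (ℝ × ℝ))) ≃L[ℝ] M n × M n :=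
  LinearEquiv.toContinuousLinearEquiv
    { toFun := fun w => ((2⁻¹ * (w.1.2 - θ * w.1.1), w.2.1.1, w.2.2.1),
        (2⁻¹ * (w.1.2 + θ * w.1.1), w.2.1.2, w.2.2.2))
      invFun := fun P => ((θ⁻¹ * (P.2.1 - P.1.1), P.1.1 + P.2.1), ((P.1.2.1, P.2.2.1),
        (P.1.2.2, P.2.2.2)))
      map_add' := fun w w' => by
        refine Prod.ext (Prod.ext ?_ rfl) (Prod.ext ?_ rfl)
        · simp; ring
        · simp; ring
      map_smul' := fun c w => by
        refine Prod.ext (Prod.ext ?_ rfl) (Prod.ext ?_ rfl)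
        · simp; ring
        · simp; ring
      left_inv := fun w => by
        refine Prod.ext (Prod.ext ?_ ?_) rfl
        · simp; field_simp; ring
        · simp; ring
      right_inv := fun P => by
        refine Prod.ext (Prod.ext ?_ rfl) (Prod.ext ?_ rfl)
        · simp; field_simp; ring
        · simp; field_simp; ring }

theorem pairCoord_apply (hθ : θ ≠ 0) (w : (ℝ × ℝ) × ((V n × V n) × (ℝ × ℝ))) :
    pairCoord n hθ w = ((2⁻¹ * (w.1.2 - θ * w.1.1), w.2.1.1, w.2.2.1),
        (2⁻¹ * (w.1.2 + θ * w.1.1), w.2.1.2, w.2.2.2)) := rfl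

instance : (volume : Measure ((V n × V n) × (ℝ × ℝ))).IsAddHaarMeasure :=
  Measure.prod.instIsAddHaarMeasure (volume : Measure (V n × V n)) (volume : Measure (ℝ × ℝ))

instance : SFinite (volume : Measure ((V n × V n) × (ℝ × ℝ))) :=
  Measure.prod.instSFinite (μ := (volume : Measure (V n × V n)))
    (ν := (volume : Measure (ℝ × ℝ)))

instance : (volume : Measure ((ℝ × ℝ) × ((V n × V n) × (ℝ × ℝ)))).IsAddHaarMeasure :=
  Measure.prod.instIsAddHaarMeasure (volume : Measure (ℝ × ℝ))
    (volume : Measure ((V n × V n) × (ℝ × ℝ)))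

/-- The kernel of a product of symbols, for symbols obtained from `u`, `v` by a substitution
`(a, x, η) ↦ (a, x / c(η), ϕ(η))` and multiplication by `ε(η)` of partial Fourier transforms. -/
def genKernel (n : ℕ) (θ : ℝ) (ε : ℝ → ℂ) (c ϕ : ℝ → ℝ) (g : ℝ → ℂ) (a : ℝ) (x : V n)
    (P : M n × M n) : ℂ :=
  g (θ⁻¹ * (P.2.1 - P.1.1)) *
    (ε (θ⁻¹ * (P.2.1 - a)) * ε (θ⁻¹ * (a - P.1.1))) *
    (c (θ⁻¹ * (P.2.1 - a)) ^ (2 * n) * c (θ⁻¹ * (a - P.1.1)) ^ (2 * n) : ℝ) *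
    Complex.exp (Complex.I * ((2 * θ)⁻¹ *
      Om (c (θ⁻¹ * (P.2.1 - a)) • P.1.2.1 - c (θ⁻¹ * (P.2.1 - P.1.1)) • x)
        (c (θ⁻¹ * (a - P.1.1)) • P.2.2.1 - c (θ⁻¹ * (P.2.1 - P.1.1)) • x) : ℝ)) *
    (Complex.exp (-(Complex.I * ϕ (θ⁻¹ * (P.2.1 - a)) * P.1.2.2)) *
      Complex.exp (-(Complex.I * ϕ (θ⁻¹ * (a - P.1.1)) * P.2.2.2)))

/-- The general kernel formula. The constant `J` depends only on `n` and `θ`, so that its value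
can be read off from any special case. -/
theorem exists_integral_pF_symbProd (n : ℕ) (hθ : θ ≠ 0) : ∃ J : ℝ, 0 < J ∧
    ∀ (U V' u v : 𝓢(M n, ℂ)) (ε : ℝ → ℂ) (c ϕ : ℝ → ℝ), (∀ η, 0 < c η) →
    (∀ a x η, pF U (a, x, η) = ε η * pF u (a, (c η)⁻¹ • x, ϕ η)) →
    (∀ a x η, pF V' (a, x, η) = ε η * pF v (a, (c η)⁻¹ • x, ϕ η)) →
    ∀ (g : ℝ → ℂ) (a : ℝ) (x : V n),
    Integrable (fun P : M n × M n => genKernel n θ ε c ϕ g a x P * (u P.1 * v P.2)) →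
    ∫ ξ, g ξ * pF (symbProd n hθ U V') (a, c ξ • x, ξ) =
      J * ∫ P : M n × M n, genKernel n θ ε c ϕ g a x P * (u P.1 * v P.2) := by
  obtain ⟨k, hk, hR⟩ := exists_pF_symbProd (n := n) hθ
  obtain ⟨k', hk', hk2⟩ := exists_integral_comp_linearEquiv
    (volume : Measure ((ℝ × ℝ) × ((V n × V n) × (ℝ × ℝ))))
    (volume : Measure (M n × M n)) (pairCoord n hθ)
  refine ⟨k * k', mul_pos hk hk', fun U V' u v ε c ϕ hc hU hV g a x hint => ?_⟩
  let F : M n × M n → ℂ := fun P => genKernel n θ ε c ϕ g a x P * (u P.1 * v P.2)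
  have hF : Integrable (fun w => F (pairCoord n hθ w)) (volume.prod volume) :=
    (integrable_comp_linearEquiv_iff volume volume (pairCoord n hθ)).2 hint
  have h1 : (k' : ℂ) * ∫ P, F P =
      ∫ ξ : ℝ, ∫ r : ℝ, ∫ z : (V n × V n) × (ℝ × ℝ), F (pairCoord n hθ ((ξ, r), z)) := by
    rw [← hk2]
    refine (integral_prod _ hF).trans ?_
    exact integral_prod (μ := (volume : Measure ℝ)) (ν := (volume : Measure ℝ)) _
      hF.integral_prod_left
  let W : ℝ → ℝ → V n × V n → ℂ := fun ξ r w =>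
      Complex.exp (Complex.I * ((2 * θ)⁻¹ * Om (w.1 - c ξ • x) (w.2 - c ξ • x) : ℝ)) *
        (pF U (2⁻¹ * (r - θ * ξ), w.1, θ⁻¹ * (2⁻¹ * (r + θ * ξ) - a)) *
          pF V' (2⁻¹ * (r + θ * ξ), w.2, θ⁻¹ * (a - 2⁻¹ * (r - θ * ξ))))
  have h2 : ∀ᵐ y : ℝ × ℝ, ∫ z : (V n × V n) × (ℝ × ℝ), F (pairCoord n hθ (y, z)) =
      g y.1 * ∫ w : V n × V n, W y.1 y.2 w := by
    filter_upwards [hF.prod_right_ae] with y hy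
    have hy' : Integrable (fun z => F (pairCoord n hθ (y, z))) (volume.prod volume) := hy
    refine (integral_prod _ hy').trans ?_
    have hc1 := hc (θ⁻¹ * (2⁻¹ * (y.2 + θ * y.1) - a))
    have hc2 := hc (θ⁻¹ * (a - 2⁻¹ * (y.2 - θ * y.1)))
    rw [integral_scaleVV hc1 hc2 (W y.1 y.2), ← integral_const_mul]
    congr 1
    ext w
    have hξ : θ⁻¹ * (2⁻¹ * (y.2 + θ * y.1) - 2⁻¹ * (y.2 - θ * y.1)) = y.1 := by
      field_simp; ring
    simp only [W, hU, hV, smul_smul, inv_mul_cancel₀ hc1.ne', inv_mul_cancel₀ hc2.ne', one_smul,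
      pF_apply, pFourier]
    have hmul := integral_prod_mul (μ := (volume : Measure ℝ)) (ν := (volume : Measure ℝ))
      (fun l => Complex.exp (-(Complex.I * ϕ (θ⁻¹ * (2⁻¹ * (y.2 + θ * y.1) - a)) * l)) *
        u (2⁻¹ * (y.2 - θ * y.1), w.1, l))
      (fun l => Complex.exp (-(Complex.I * ϕ (θ⁻¹ * (a - 2⁻¹ * (y.2 - θ * y.1))) * l)) *
        v (2⁻¹ * (y.2 + θ * y.1), w.2, l))
    rw [mul_mul_mul_comm (ε _), ← hmul]
    simp only [← integral_const_mul]
    congr 1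
    ext l
    simp only [F, genKernel, pairCoord_apply, hξ]
    ring
  have h3 : ∀ᵐ ξ : ℝ, ∫ r : ℝ, ∫ z : (V n × V n) × (ℝ × ℝ), F (pairCoord n hθ ((ξ, r), z)) =
      g ξ * ∫ r : ℝ, ∫ w, W ξ r w := by
    filter_upwards [Measure.ae_ae_of_ae_prod h2] with ξ hξ
    rw [integral_congr_ae hξ, integral_const_mul]
  have h4 : ∀ ξ, pF (symbProd n hθ U V') (a, c ξ • x, ξ) = k * ∫ r : ℝ, ∫ w, W ξ r w := by
    intro ξ
    rw [hR, ← integral_add_left_eq_self (fun r => ∫ w, W ξ r w) a]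
    congr 2
    ext r
    congr 1
    ext w
    have e1 : 2⁻¹ * (a + r - θ * ξ) = 2⁻¹ * (a - θ * ξ + r) := by ring
    have e2 : 2⁻¹ * (a + r + θ * ξ) = 2⁻¹ * (r + (a + θ * ξ)) := by ring
    have e3 : θ⁻¹ * (2⁻¹ * (r + (a + θ * ξ)) - a) = (2 * θ)⁻¹ * (r - (a - θ * ξ)) := by
      field_simp; ring
    have e4 : θ⁻¹ * (a - 2⁻¹ * (a - θ * ξ + r)) = (2 * θ)⁻¹ * (a + θ * ξ - r) := by
      field_simp; ring
    simp only [W, e1, e2, e3, e4]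
  rw [Complex.ofReal_mul, mul_assoc]
  change _ = (k : ℂ) * ((k' : ℂ) * ∫ P, F P)
  rw [h1, integral_congr_ae h3, ← integral_const_mul]
  congr 1
  ext ξ
  rw [h4]
  ring

end KernelFormula

/-! ### The Weyl product and the kernel of the transported product -/

section Weyl

variable {n : ℕ} {θ : ℝ}

instance : (volume : Measure (M n × M n)).HasTemperateGrowth :=
  Measure.IsAddHaarMeasure.instHasTemperateGrowth

/-- The real number `4 / (4πθ)^{2n+2}`. -/
def weylReal (n : ℕ) (θ : ℝ) : ℝ := 4 / (4 * Real.pi * θ) ^ (2 * n + 2)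

theorem weylReal_pos (n : ℕ) (hθ : θ ≠ 0) : 0 < weylReal n θ := by
  unfold weylReal
  have h : (4 * Real.pi * θ) ^ (2 * n + 2) = ((4 * Real.pi * θ) ^ 2) ^ (n + 1) := by
    rw [← pow_mul]; ring_nf
  rw [h]
  have : 4 * Real.pi * θ ≠ 0 := mul_ne_zero (mul_ne_zero four_ne_zero Real.pi_ne_zero) hθ
  positivity

theorem weylConst_eq (n : ℕ) (θ : ℝ) : weylConst n θ = (weylReal n θ : ℂ) := by
  unfold weylConst weylReal
  push_cast
  rfl

/-- The factor between the Weyl product and the composition of kernels. -/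
def weylScale (n : ℕ) (hθ : θ ≠ 0) : ℝ :=
  weylReal n θ * (2 * Real.pi) / (exists_integral_pF_symbProd n hθ).choose

theorem weylScale_pos (n : ℕ) (hθ : θ ≠ 0) : 0 < weylScale n hθ :=
  div_pos (mul_pos (weylReal_pos n hθ) (by positivity))
    (exists_integral_pF_symbProd n hθ).choose_spec.1

/-- The kernel formula with its normalization. -/
theorem integral_pF_symbProd (hθ : θ ≠ 0) (U V' u v : 𝓢(M n, ℂ)) (ε : ℝ → ℂ) (c ϕ : ℝ → ℝ)
    (hc : ∀ η, 0 < c η) (hU : ∀ a x η, pF U (a, x, η) = ε η * pF u (a, (c η)⁻¹ • x, ϕ η))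
    (hV : ∀ a x η, pF V' (a, x, η) = ε η * pF v (a, (c η)⁻¹ • x, ϕ η)) (g : ℝ → ℂ) (a : ℝ)
    (x : V n)
    (hint : Integrable (fun P : M n × M n => genKernel n θ ε c ϕ g a x P * (u P.1 * v P.2))) :
    weylScale n hθ * ((2 * Real.pi : ℂ)⁻¹ * ∫ ξ, g ξ * pF (symbProd n hθ U V') (a, c ξ • x, ξ)) =
      weylConst n θ * ∫ P : M n × M n, genKernel n θ ε c ϕ g a x P * (u P.1 * v P.2) := by
  rw [(exists_integral_pF_symbProd n hθ).choose_spec.2 U V' u v ε c ϕ hc hU hV g a x hint,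
    weylConst_eq, weylScale]
  have hJ := (exists_integral_pF_symbProd n hθ).choose_spec.1
  generalize (exists_integral_pF_symbProd n hθ).choose = J at hJ ⊢
  have hJ' : (J : ℂ) ≠ 0 := Complex.ofReal_ne_zero.2 hJ.ne'
  have hpi : (Real.pi : ℂ) ≠ 0 := Complex.ofReal_ne_zero.2 Real.pi_ne_zero
  push_cast
  field_simp

theorem genKernel_one (x : M n) (P : M n × M n) (hθ : θ ≠ 0) :
    genKernel n θ (fun _ => 1) (fun _ => 1) id (fun ξ => Complex.exp (Complex.I * x.2.2 * ξ))
      x.1 x.2.1 P =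
    Complex.exp (Complex.I * ((2 * θ)⁻¹ * (omega x P.1 + omega P.1 P.2 + omega P.2 x) : ℝ)) := by
  simp only [genKernel, mul_one, one_pow, one_smul, Complex.ofReal_one, id]
  rw [← Complex.exp_add, ← Complex.exp_add, ← Complex.exp_add]
  congr 1
  have hO : Om (P.1.2.1 - x.2.1) (P.2.2.1 - x.2.1) =
      Om x.2.1 P.1.2.1 + Om P.1.2.1 P.2.2.1 + Om P.2.2.1 x.2.1 := by
    simp only [Om, Prod.fst_sub, Prod.snd_sub, inner_sub_left, inner_sub_right,
      real_inner_comm x.2.1.1 x.2.1.2, real_inner_comm P.1.2.1.1 x.2.1.2,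
      real_inner_comm x.2.1.1 P.1.2.1.2, real_inner_comm x.2.1.1 P.2.2.1.2,
      real_inner_comm P.2.2.1.1 x.2.1.2]
    ring
  rw [hO]
  simp only [omega]
  push_cast
  have : (θ : ℂ) ≠ 0 := Complex.ofReal_ne_zero.2 hθ
  field_simp
  ring

/-- The case `ε = 1`, `c = 1`, `ϕ = id` of the kernel formula is the Weyl product. -/
theorem isWeyl_smul_symbProd (hθ : θ ≠ 0) :
    IsWeyl θ ((weylScale n hθ : ℂ) • symbProd n hθ) := by
  intro u v x
  have hint : Integrable (fun P : M n × M n => genKernel n θ (fun _ => 1) (fun _ => 1) id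
      (fun ξ => Complex.exp (Complex.I * x.2.2 * ξ)) x.1 x.2.1 P * (u P.1 * v P.2)) := by
    simp only [genKernel_one x _ hθ]
    exact integrable_phase_mul (volume : Measure (M n × M n))
      (φ := fun P => (2 * θ)⁻¹ * (omega x P.1 + omega P.1 P.2 + omega P.2 x))
      (by unfold omega Om; fun_prop) (tens u v)
  have h := integral_pF_symbProd hθ u v u v (fun _ => 1) (fun _ => 1) id (fun _ => one_pos)
    (fun a x η => by simp) (fun a x η => by simp) _ _ _ hint
  simp only [genKernel_one x _ hθ, one_smul] at h
  have h1 : symbProd n hθ u v x = (2 * Real.pi : ℂ)⁻¹ * ∫ ξ : ℝ, Complex.exp (Complex.I * x.2.2 * ξ) *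
      pF (symbProd n hθ u v) (x.1, x.2.1, ξ) := by
    conv_lhs => rw [← pFi_pF (symbProd n hθ u v), pFi_apply]
    rfl
  change (weylScale n hθ : ℂ) * symbProd n hθ u v x = _
  rw [h1, h]
  congr 2
  ext P
  rw [← mul_assoc]
  congr 3
  push_cast
  have : (θ : ℂ) ≠ 0 := Complex.ofReal_ne_zero.2 hθ
  field_simp

theorem isWeyl_weyl (hθ : θ ≠ 0) : IsWeyl (n := n) θ (weyl n θ) := by
  have h : ∃ B, IsWeyl (n := n) θ B := ⟨_, isWeyl_smul_symbProd hθ⟩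
  rw [weyl, dif_pos h]
  exact h.choose_spec

theorem weyl_apply (hθ : θ ≠ 0) (u v : 𝓢(M n, ℂ)) :
    weyl n θ u v = (weylScale n hθ : ℂ) • symbProd n hθ u v := by
  ext x
  rw [isWeyl_weyl hθ u v x, ← isWeyl_smul_symbProd hθ u v x]
  rfl

theorem kappa_weyl (hθ : θ ≠ 0) (u v : 𝓢(M n, ℂ)) :
    kappa n hθ (weyl n θ u v) =
      (weylScale n hθ : ℂ) • compK (kappa n hθ u) (kappa n hθ v) := by
  rw [weyl_apply hθ, map_smul, kappa_symbProd]

theorem kappa_injective (hθ : θ ≠ 0) : Function.Injective (kappa n hθ) :=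
  Function.LeftInverse.injective (kappaInv_kappa hθ)

theorem weyl_assoc (hθ : θ ≠ 0) (u v w : 𝓢(M n, ℂ)) :
    weyl n θ (weyl n θ u v) w = weyl n θ u (weyl n θ v w) := by
  refine kappa_injective hθ ?_
  simp only [kappa_weyl, map_smul, LinearMap.smul_apply, compK_assoc]

theorem star_assoc (hθ : θ ≠ 0) {f : ℝ → ℂ} (hf : IsInvMult f) (a b c : E n θ f) :
    star (star a b) c = star a (star b c) := by
  refine Tinv_injective _ _ ?_
  simp only [Tinv_star hf, weyl_assoc hθ]

theorem continuous_genKernel {ε : ℝ → ℂ} {c ϕ : ℝ → ℝ} {g : ℝ → ℂ} (hε : Continuous ε)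
    (hc : Continuous c) (hϕ : Continuous ϕ) (hg : Continuous g) (a : ℝ) (x : V n) :
    Continuous (genKernel n θ ε c ϕ g a x) := by
  unfold genKernel Om
  fun_prop

end Weyl

section Kernel

variable {n : ℕ} {θ : ℝ} {f : ℝ → ℂ}

theorem pF_eq_zero_of_fst {u : 𝓢(M n, ℂ)} {a : ℝ} (h : ∀ x l, u (a, x, l) = 0) (x : V n) (η : ℝ) :
    pF u (a, x, η) = 0 := by
  rw [pF_apply]
  simp [pFourier, h]

/-- The function `(R ∘ φ_θ⁻¹) · χ(ξ)`. It is the pullback of `R ⊗ χ` by the proper map `x ↦ (φ_θ⁻¹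
x, ξ)`; without the cutoff it need not decay in `ξ`, as `φ_θ⁻¹` grows only logarithmically. -/
def untwistCut (n : ℕ) (θ : ℝ) (χ : 𝓢(ℝ, ℂ)) (R : 𝓢(M n, ℂ)) : 𝓢(M n, ℂ) :=
  compCLM ℂ (g := fun x : M n => ((twist n θ).symm x, x.2.2))
    (hasTemperateGrowth_prodMk (hasTemperateGrowth_twist_symm θ) (coordL n).hasTemperateGrowth)
    ⟨1, 1, fun x => by
      rw [pow_one, one_mul]
      have h1 : ‖x.1‖ ≤ ‖((twist n θ).symm x, x.2.2)‖ :=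
        (norm_fst_le ((twist n θ).symm x)).trans (norm_fst_le ((twist n θ).symm x, x.2.2))
      have h2 : ‖x.2.1‖ ≤ ‖((twist n θ).symm x, x.2.2)‖ := by
        have h3 : ‖x.2.1‖ ≤ ‖((twist n θ).symm x).2.1‖ := by
          change _ ≤ ‖Real.cosh (θ * phiInv θ x.2.2) • x.2.1‖
          rw [norm_smul, Real.norm_of_nonneg (Real.cosh_pos _).le]
          exact le_mul_of_one_le_left (norm_nonneg _) (Real.one_le_cosh _)
        exact h3.trans (((norm_fst_le _).trans (norm_snd_le _)).trans
          (norm_fst_le ((twist n θ).symm x, x.2.2)))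
      have h4 : ‖x.2.2‖ ≤ ‖((twist n θ).symm x, x.2.2)‖ :=
        norm_snd_le ((twist n θ).symm x, x.2.2)
      refine (max_le h1 (max_le h2 h4)).trans ?_
      linarith⟩
    (tens R χ)

theorem untwistCut_apply (χ : 𝓢(ℝ, ℂ)) (R : 𝓢(M n, ℂ)) (x : M n) :
    untwistCut n θ χ R x = R ((twist n θ).symm x) * χ x.2.2 := rfl

/-- If the partial Fourier transform of `R` has bounded support in `ξ`, then `R` is in the range
of `T⁻¹` on `𝓢`. -/
theorem exists_Ti_eq (hf : IsInvMult f) (R : 𝓢(M n, ℂ)) (ρ : ℝ)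
    (hR : ∀ a x η, ρ < |η| → pF R (a, x, η) = 0) : ∃ w, Ti n θ f w = R := by
  obtain ⟨χ, hχ⟩ : ∃ χ : 𝓢(ℝ, ℂ), ∀ η, |η| ≤ ρ → χ (phi θ η) = 1 := by
    -- a bump function equal to `1` on `|ξ| ≤ C`, where `C` bounds `φ_θ` on `[-ρ, ρ]`
    have hcont : Continuous (phi θ) :=
      continuous_iff_continuousAt.2 fun η => (hasDerivAt_phi θ η).continuousAt
    obtain ⟨C, hC⟩ := (isCompact_Icc (a := -ρ) (b := ρ)).exists_bound_of_continuousOn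
      hcont.continuousOn
    let b : ContDiffBump (0 : ℝ) :=
      { rIn := |C| + 1, rOut := |C| + 2, rIn_pos := by positivity, rIn_lt_rOut := by linarith }
    have hb : HasCompactSupport (fun x => (b x : ℂ)) :=
      b.hasCompactSupport.comp_left (g := Complex.ofReal) rfl
    refine ⟨hb.toSchwartzMap (Complex.ofRealCLM.contDiff.comp b.contDiff), fun η hη => ?_⟩
    change (b (phi θ η) : ℂ) = 1
    rw [b.one_of_mem_closedBall, Complex.ofReal_one]
    rw [mem_closedBall_zero_iff]
    have := hC η (abs_le.1 hη)
    change _ ≤ |C| + 1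
    linarith [le_abs_self C]
  refine ⟨pFi (mulL (fun ξ => Complex.exp (f ξ)) (untwistCut n θ χ (pF R))), pF_injective ?_⟩
  ext x
  rw [pF_Ti hf, pF_pFi, mulL_apply hf.mult, untwistCut_apply, Equiv.symm_apply_apply, ← mul_assoc,
    ← Complex.exp_add]
  change Complex.exp (-f (phi θ x.2.2) + f (phi θ x.2.2)) * (pF R x * χ (phi θ x.2.2)) = _
  rw [neg_add_cancel, Complex.exp_zero, one_mul]
  rcases le_or_gt |x.2.2| ρ with h | h
  · rw [hχ _ h, mul_one]
  · have h0 : pF R x = 0 := hR x.1 x.2.1 x.2.2 h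
    rw [h0, zero_mul]

theorem exists_bound_fst {u : 𝓢(M n, ℂ)} (hu : HasCompactSupport u) :
    ∃ ρ : ℝ, ∀ (a : ℝ) (x : V n) (l : ℝ), ρ < |a| → u (a, x, l) = 0 := by
  obtain ⟨ρ, hρ⟩ := hu.isCompact.isBounded.exists_norm_le
  refine ⟨ρ, fun a x l ha => ?_⟩
  by_contra hne
  have h1 := hρ _ (subset_tsupport _ hne)
  have h2 : ‖a‖ ≤ ‖((a, x, l) : M n)‖ := norm_fst_le (a, x, l)
  rw [Real.norm_eq_abs] at h2
  linarith

/-- The product of functions with bounded support in `a` has bounded frequencies. -/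
theorem pF_symbProd_eq_zero (hθ : θ ≠ 0) {U V' : 𝓢(M n, ℂ)} {ρ : ℝ}
    (hU : ∀ a x η, ρ < |a| → pF U (a, x, η) = 0) (hV : ∀ a x η, ρ < |a| → pF V' (a, x, η) = 0)
    (a : ℝ) (x : V n) (η : ℝ) (hη : 2 * |θ⁻¹| * |ρ| < |η|) :
    pF (symbProd n hθ U V') (a, x, η) = 0 := by
  obtain ⟨c, -, hc⟩ := exists_pF_symbProd (n := n) hθ
  rw [hc]
  have h0 : ∀ (r : ℝ) (w : V n × V n),
      (pF U (2⁻¹ * (a - θ * η + r), w.1, (2 * θ)⁻¹ * (r - (a - θ * η))) *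
          pF V' (2⁻¹ * (r + (a + θ * η)), w.2, (2 * θ)⁻¹ * (a + θ * η - r))) = 0 := by
    intro r w
    rcases lt_or_ge ρ |2⁻¹ * (a - θ * η + r)| with h | h
    · rw [hU _ _ _ h, zero_mul]
    rcases lt_or_ge ρ |2⁻¹ * (r + (a + θ * η))| with h' | h'
    · rw [hV _ _ _ h', mul_zero]
    exfalso
    have e : η = θ⁻¹ * (2⁻¹ * (r + (a + θ * η)) - 2⁻¹ * (a - θ * η + r)) := by field_simp; ring
    have h1 : |η| ≤ |θ⁻¹| * (|ρ| + |ρ|) := by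
      rw [e, abs_mul]
      refine mul_le_mul_of_nonneg_left ((abs_sub _ _).trans ?_) (abs_nonneg _)
      exact add_le_add (h'.trans (le_abs_self _)) (h.trans (le_abs_self _))
    linarith
  simp only [h0, mul_zero, integral_zero]

theorem integral_phi (θ : ℝ) (G : ℝ → ℂ) :
    ∫ t, G t = ∫ ξ, (Real.cosh (2 * θ * ξ) : ℂ) * G (phi θ ξ) := by
  have hinj : Function.Injective (phi θ) := Function.LeftInverse.injective (phiInv_phi θ)
  have hsurj : Function.Surjective (phi θ) := fun t => ⟨_, phi_phiInv θ t⟩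
  have h := integral_image_eq_integral_abs_deriv_smul MeasurableSet.univ
    (fun x _ => (hasDerivAt_phi θ x).hasDerivWithinAt) hinj.injOn G
  rw [Set.image_univ, hsurj.range_eq] at h
  simpa only [setIntegral_univ, abs_of_pos (Real.cosh_pos _), Complex.real_smul] using h

theorem deltaOp_cochain (P : ℝ → ℂ) (x₀ x₁ x₂ : M n) :
    deltaOp (sigma12 (cochain P)) ![x₀, x₁, x₂] =
      P (x₂.1 - x₁.1) - P (x₂.1 - x₀.1) - P (x₀.1 - x₁.1) := by
  have h2 : (Equiv.swap 0 1) (2 : Fin 3) = 2 := by decide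
  simp [deltaOp, sigma12, coboundary, cochain, Fin.sum_univ_succ, Fin.succAbove, h2]
  ring

end Kernel

/-! ### The kernel on compactly supported functions -/

section Kernel

variable {n : ℕ} {θ : ℝ} {f : ℝ → ℂ}

/-- The kernel of the transported product, in the notation of `genKernel`. -/
theorem genKernel_eq_ampA1 (hθ : θ ≠ 0) (x : M n) (P : M n × M n) :
    genKernel n θ (fun η => Complex.exp (-f (phi θ η))) (fun η => Real.cosh (θ * η)) (phi θ)
      (fun ξ => Real.cosh (2 * θ * ξ) * (Complex.exp (f (phi θ ξ)) *
        Complex.exp (Complex.I * x.2.2 * phi θ ξ))) x.1 x.2.1 P =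
    (ampA1 ![x, P.1, P.2] : ℂ)
          * Complex.exp (Complex.I / (2 * θ) * (phaseS ![x, P.1, P.2] : ℝ)
              + deltaOp (sigma12 (cochain (pullScale θ f))) ![x, P.1, P.2]) := by
  have hcancel : ∀ t : ℝ, θ * (θ⁻¹ * t) = t := fun t => mul_inv_cancel_left₀ hθ t
  have hcancel2 : ∀ t : ℝ, 2 * θ * (θ⁻¹ * t) = 2 * t := fun t => by
    rw [mul_assoc, hcancel]
  have hphi : ∀ t : ℝ, phi θ (θ⁻¹ * t) = Real.sinh (2 * t) / (2 * θ) := fun t => by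
    rw [phi, if_neg hθ, hcancel2]
  have hc1 : Real.cosh (P.1.1 - P.2.1) = Real.cosh (P.2.1 - P.1.1) := by
    rw [← Real.cosh_neg, neg_sub]
  have hc2 : Real.cosh (2 * (P.1.1 - P.2.1)) = Real.cosh (2 * (P.2.1 - P.1.1)) := by
    rw [← Real.cosh_neg]; ring_nf
  have hs : Real.sinh (2 * (P.1.1 - P.2.1)) = -Real.sinh (2 * (P.2.1 - P.1.1)) := by
    rw [← Real.sinh_neg]; ring_nf
  have hO : ∀ u v w : V n, Om (u - w) (v - w) = Om w u + Om u v + Om v w := by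
    intro u v w
    simp only [Om, Prod.fst_sub, Prod.snd_sub, inner_sub_left, inner_sub_right,
      real_inner_comm w.1 w.2, real_inner_comm u.1 w.2, real_inner_comm w.1 u.2,
      real_inner_comm w.1 v.2, real_inner_comm v.1 w.2]
    ring
  have hpull : ∀ t, pullScale θ f t = f (phi θ (θ⁻¹ * t)) := fun t => by
    rw [pullScale, div_eq_inv_mul]
  have hA : ampA1 ![x, P.1, P.2] = Real.cosh (2 * (P.2.1 - P.1.1)) *
      (Real.cosh (P.2.1 - x.1) ^ (2 * n) * Real.cosh (x.1 - P.1.1) ^ (2 * n)) := by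
    simp [ampA1, hc2, mul_pow]
  have hS : phaseS ![x, P.1, P.2] =
      Om (Real.cosh (P.2.1 - x.1) • P.1.2.1 - Real.cosh (P.2.1 - P.1.1) • x.2.1)
        (Real.cosh (x.1 - P.1.1) • P.2.2.1 - Real.cosh (P.2.1 - P.1.1) • x.2.1)
      + Real.sinh (2 * (P.2.1 - P.1.1)) * x.2.2 - Real.sinh (2 * (P.2.1 - x.1)) * P.1.2.2
      - Real.sinh (2 * (x.1 - P.1.1)) * P.2.2.2 := by
    rw [hO]
    simp only [phaseS, Matrix.cons_val_zero, Matrix.cons_val_one, Matrix.cons_val, hc1, hs]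
    ring
  rw [hA, hS, deltaOp_cochain]
  simp only [genKernel, hcancel, hcancel2, hpull]
  have hexp : Complex.exp (Complex.I / (2 * θ) * ((Om (Real.cosh (P.2.1 - x.1) • P.1.2.1 -
          Real.cosh (P.2.1 - P.1.1) • x.2.1)
        (Real.cosh (x.1 - P.1.1) • P.2.2.1 - Real.cosh (P.2.1 - P.1.1) • x.2.1)
      + Real.sinh (2 * (P.2.1 - P.1.1)) * x.2.2 - Real.sinh (2 * (P.2.1 - x.1)) * P.1.2.2
      - Real.sinh (2 * (x.1 - P.1.1)) * P.2.2.2 : ℝ) : ℂ) + (f (phi θ (θ⁻¹ * (P.2.1 - P.1.1))) -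
        f (phi θ (θ⁻¹ * (P.2.1 - x.1))) - f (phi θ (θ⁻¹ * (x.1 - P.1.1))))) =
      (Complex.exp (f (phi θ (θ⁻¹ * (P.2.1 - P.1.1)))) *
        Complex.exp (Complex.I * x.2.2 * phi θ (θ⁻¹ * (P.2.1 - P.1.1)))) *
      (Complex.exp (-f (phi θ (θ⁻¹ * (P.2.1 - x.1)))) *
        Complex.exp (-f (phi θ (θ⁻¹ * (x.1 - P.1.1))))) *
      Complex.exp (Complex.I * ((2 * θ)⁻¹ *
        Om (Real.cosh (P.2.1 - x.1) • P.1.2.1 - Real.cosh (P.2.1 - P.1.1) • x.2.1)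
        (Real.cosh (x.1 - P.1.1) • P.2.2.1 - Real.cosh (P.2.1 - P.1.1) • x.2.1) : ℝ)) *
      (Complex.exp (-(Complex.I * phi θ (θ⁻¹ * (P.2.1 - x.1)) * P.1.2.2)) *
        Complex.exp (-(Complex.I * phi θ (θ⁻¹ * (x.1 - P.1.1)) * P.2.2.2))) := by
    simp only [← Complex.exp_add]
    congr 1
    simp only [hphi]
    have : (θ : ℂ) ≠ 0 := Complex.ofReal_ne_zero.2 hθ
    push_cast
    field_simp
    ring
  rw [hexp]
  push_cast
  ring

/-- The kernel of the transported product on compactly supported functions.  The product of the two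
images under `T⁻¹` has bounded frequencies, so it is the image of a Schwartz function `w`, which the
kernel formula computes by Fourier inversion and the substitution `ξ = φ_θ(η)`. -/
theorem hasKernel_ampA1 (hθ : θ ≠ 0) (hf : IsInvMult f) :
    HasKernel (n := n) θ f ampA1 f := by
  intro u v hu hv
  obtain ⟨ρ₁, h₁⟩ := exists_bound_fst hu
  obtain ⟨ρ₂, h₂⟩ := exists_bound_fst hv
  have hTi : ∀ (u : 𝓢(M n, ℂ)) (ρ : ℝ), (∀ a x l, ρ < |a| → u (a, x, l) = 0) →
      ∀ a x η, max ρ₁ ρ₂ < |a| → ρ ≤ max ρ₁ ρ₂ → pF (Ti n θ f u) (a, x, η) = 0 := by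
    intro u ρ h a x η ha hρ
    rw [pF_Ti hf]
    have h0 := pF_eq_zero_of_fst (fun x l => h a x l (hρ.trans_lt ha))
      ((Real.cosh (θ * η))⁻¹ • x) (phi θ η)
    change _ * pF u (a, (Real.cosh (θ * η))⁻¹ • x, phi θ η) = 0
    rw [h0, mul_zero]
  obtain ⟨w, hw⟩ : ∃ w, Ti n θ f w = weyl n θ (Ti n θ f u) (Ti n θ f v) := by
    refine exists_Ti_eq hf _ (2 * |θ⁻¹| * |max ρ₁ ρ₂|) fun a x η hη => ?_
    rw [weyl_apply hθ, map_smul, smul_apply, pF_symbProd_eq_zero hθ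
      (fun a x η h => hTi u ρ₁ h₁ a x η h (le_max_left _ _))
      (fun a x η h => hTi v ρ₂ h₂ a x η h (le_max_right _ _)) a x η hη, smul_zero]
  refine ⟨toDist_mem_E hf u, toDist_mem_E hf v, w, ?_, fun x => ?_⟩
  · change T n θ f (weyl n θ (Tinv _) (Tinv _)) = _
    rw [Tinv_toDist hf, Tinv_toDist hf, ← hw, T_Ti hf]
  have hphi : Continuous (phi θ) :=
    continuous_iff_continuousAt.2 fun η => (hasDerivAt_phi θ η).continuousAt
  have hc : Continuous fun η => Real.cosh (θ * η) := by fun_prop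
  have he : Continuous fun η => Complex.exp (-f (phi θ η)) := hf.mult_inv.1.continuous.comp hphi
  have he' : Continuous fun η => Complex.exp (f (phi θ η)) := hf.mult.1.continuous.comp hphi
  have hcs : HasCompactSupport fun P : M n × M n => u P.1 * v P.2 := by
    refine HasCompactSupport.intro (hu.isCompact.prod hv.isCompact) fun P hP => ?_
    rw [Set.mem_prod, not_and_or] at hP
    rcases hP with h | h
    · rw [image_eq_zero_of_notMem_tsupport h, zero_mul]
    · rw [image_eq_zero_of_notMem_tsupport h, mul_zero]
  have hU : ∀ (u : 𝓢(M n, ℂ)) a x η, pF (Ti n θ f u) (a, x, η) =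
      Complex.exp (-f (phi θ η)) * pF u (a, (Real.cosh (θ * η))⁻¹ • x, phi θ η) :=
    fun u a x η => pF_Ti hf u (a, x, η)
  have h := integral_pF_symbProd hθ (Ti n θ f u) (Ti n θ f v) u v
    (fun η => Complex.exp (-f (phi θ η))) (fun η => Real.cosh (θ * η)) (phi θ)
    (fun η => Real.cosh_pos _) (hU u) (hU v)
    (fun ξ => Real.cosh (2 * θ * ξ) * (Complex.exp (f (phi θ ξ)) *
        Complex.exp (Complex.I * x.2.2 * phi θ ξ))) x.1 x.2.1
    (Continuous.integrable_of_hasCompactSupport ((continuous_genKernel he hc hphi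
      (by fun_prop) _ _).mul (by fun_prop)) hcs.mul_left)
  simp only [genKernel_eq_ampA1 hθ] at h
  have h3 : w x = (2 * Real.pi : ℂ)⁻¹ * ∫ t : ℝ, Complex.exp (Complex.I * x.2.2 * t) *
      pF w (x.1, x.2.1, t) := by
    conv_lhs => rw [← pFi_pF w, pFi_apply]
    rfl
  have h4 : ∀ ξ, pF w (x.1, x.2.1, phi θ ξ) = weylScale n hθ * (Complex.exp (f (phi θ ξ)) *
      pF (symbProd n hθ (Ti n θ f u) (Ti n θ f v)) (x.1, Real.cosh (θ * ξ) • x.2.1, ξ)) := by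
    intro ξ
    have h5 := hU w x.1 (Real.cosh (θ * ξ) • x.2.1) ξ
    rw [smul_smul, inv_mul_cancel₀ (Real.cosh_pos _).ne', one_smul, hw, weyl_apply hθ, map_smul,
      smul_apply, smul_eq_mul] at h5
    rw [mul_left_comm, h5, ← mul_assoc, ← Complex.exp_add, add_neg_cancel, Complex.exp_zero,
      one_mul]
  rw [h3, integral_phi θ]
  simp only [h4]
  have h6 : ∀ P : M n × M n, (ampA1 ![x, P.1, P.2] : ℂ)
          * Complex.exp (Complex.I / (2 * θ) * (phaseS ![x, P.1, P.2] : ℝ)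
              + deltaOp (sigma12 (cochain (pullScale θ f))) ![x, P.1, P.2]) * u P.1 * v P.2 =
      (ampA1 ![x, P.1, P.2] : ℂ)
          * Complex.exp (Complex.I / (2 * θ) * (phaseS ![x, P.1, P.2] : ℝ)
              + deltaOp (sigma12 (cochain (pullScale θ f))) ![x, P.1, P.2]) * (u P.1 * v P.2) :=
    fun P => mul_assoc _ _ _
  simp only [h6]
  rw [← h, ← integral_const_mul, ← integral_const_mul, ← integral_const_mul]
  congr 1
  ext ξ
  ring

/-- The norm of `exp τ` in the tracial case. -/
theorem norm_exp_of_tracial (h : ∀ x : M n, ‖Complex.exp (f x.2.2)‖ ^ 2 = jacInv n θ x) (ξ : ℝ) :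
    Real.exp (f ξ).re = chi θ ξ ^ n / √(rho θ ξ) := by
  have h1 := h (0, 0, ξ)
  rw [jacInv_eq, Complex.norm_exp] at h1
  have hr := rho_pos θ ξ
  have hc := chi_pos θ ξ
  have h2 : (chi θ ξ ^ n / √(rho θ ξ)) ^ 2 = (twistDet n θ ξ)⁻¹ := by
    rw [div_pow, Real.sq_sqrt hr.le, twistDet, mul_inv, inv_pow, inv_inv, ← pow_mul, mul_comm n 2]
    field_simp
  refine (pow_left_inj₀ (Real.exp_pos _).le (by positivity) two_ne_zero).1 ?_
  rw [h2]
  exact h1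

/-- In the tracial case, the real part of `τ` turns `A₁` into `A_can`. -/
theorem ampA1_mul_exp_eq (hθ : θ ≠ 0)
    (h : ∀ x : M n, ‖Complex.exp (f x.2.2)‖ ^ 2 = jacInv n θ x) (x : M n) (P : M n × M n) :
    (ampA1 ![x, P.1, P.2] : ℂ)
          * Complex.exp (Complex.I / (2 * θ) * (phaseS ![x, P.1, P.2] : ℝ)
              + deltaOp (sigma12 (cochain (pullScale θ f))) ![x, P.1, P.2]) =
    (ampCan ![x, P.1, P.2] : ℂ)
          * Complex.exp (Complex.I / (2 * θ) * (phaseS ![x, P.1, P.2] : ℝ)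
              + deltaOp (sigma12 (cochain (pullScale θ fun ξ => Complex.I * ((f ξ).im : ℂ))))
                ![x, P.1, P.2]) := by
  have hre : ∀ t, Real.exp (pullScale θ f t).re = Real.cosh t ^ n / √(Real.cosh (2 * t)) := by
    intro t
    have e1 : θ * (t / θ) = t := by field_simp
    have e2 : 2 * θ * (t / θ) = 2 * t := by field_simp
    rw [pullScale, norm_exp_of_tracial h, chi_phi, rho_phi, e1, e2]
  have hsplit : ∀ t, Complex.exp (pullScale θ f t) = (Real.cosh t ^ n / √(Real.cosh (2 * t)) : ℝ) *
      Complex.exp (pullScale θ (fun ξ => Complex.I * ((f ξ).im : ℂ)) t) := by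
    intro t
    rw [← hre, Complex.ofReal_exp, ← Complex.exp_add]
    congr 1
    simp only [pullScale]
    rw [mul_comm Complex.I, Complex.re_add_im]
  rw [deltaOp_cochain, deltaOp_cochain, Complex.exp_add, Complex.exp_add _ (_ - _), Complex.exp_sub,
    Complex.exp_sub, Complex.exp_sub, Complex.exp_sub, hsplit, hsplit, hsplit]
  have hc1 : Real.cosh (P.1.1 - P.2.1) = Real.cosh (P.2.1 - P.1.1) := by
    rw [← Real.cosh_neg, neg_sub]
  have hc2 : Real.cosh (2 * (P.1.1 - P.2.1)) = Real.cosh (2 * (P.2.1 - P.1.1)) := by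
    rw [← Real.cosh_neg]; ring_nf
  have hA : ampA1 ![x, P.1, P.2] = Real.cosh (2 * (P.2.1 - P.1.1)) *
      (Real.cosh (P.2.1 - x.1) * Real.cosh (x.1 - P.1.1)) ^ (2 * n) := by
    simp [ampA1, hc2]
  have hB : ampCan ![x, P.1, P.2] = √(Real.cosh (2 * (x.1 - P.1.1))) *
      √(Real.cosh (2 * (P.2.1 - P.1.1))) * √(Real.cosh (2 * (P.2.1 - x.1))) *
      (Real.cosh (x.1 - P.1.1) * Real.cosh (P.2.1 - P.1.1) * Real.cosh (P.2.1 - x.1)) ^ n := by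
    simp only [ampCan, Matrix.cons_val_zero, Matrix.cons_val_one, Matrix.cons_val, hc1, hc2]
    rw [Real.sqrt_mul (by positivity), Real.sqrt_mul (by positivity)]
  have hpos : ∀ t, 0 < Real.cosh t := Real.cosh_pos
  have hAB : ampA1 ![x, P.1, P.2] *
      ((Real.cosh (P.2.1 - P.1.1) ^ n / √(Real.cosh (2 * (P.2.1 - P.1.1)))) /
       (Real.cosh (P.2.1 - x.1) ^ n / √(Real.cosh (2 * (P.2.1 - x.1)))) /
       (Real.cosh (x.1 - P.1.1) ^ n / √(Real.cosh (2 * (x.1 - P.1.1))))) =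
      ampCan ![x, P.1, P.2] := by
    rw [hA, hB]
    have hq1 := Real.mul_self_sqrt (hpos (2 * (P.2.1 - P.1.1))).le
    have q1 := Real.sqrt_pos.2 (hpos (2 * (P.2.1 - P.1.1)))
    have q2 := Real.sqrt_pos.2 (hpos (2 * (P.2.1 - x.1)))
    have q3 := Real.sqrt_pos.2 (hpos (2 * (x.1 - P.1.1)))
    have r1 := hpos (P.2.1 - P.1.1)
    have r2 := hpos (P.2.1 - x.1)
    have r3 := hpos (x.1 - P.1.1)
    generalize √(Real.cosh (2 * (P.2.1 - P.1.1))) = s₁ at *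
    generalize √(Real.cosh (2 * (P.2.1 - x.1))) = s₂ at *
    generalize √(Real.cosh (2 * (x.1 - P.1.1))) = s₃ at *
    rw [← hq1, two_mul n, pow_add, mul_pow, mul_pow, mul_pow]
    field_simp
  rw [← hAB]
  push_cast
  field_simp

/-- In the tracial case the kernel depends on `τ` through its imaginary part only. -/
theorem hasKernel_ampCan (hθ : θ ≠ 0) (hf : IsInvMult f)
    (h : ∀ x : M n, ‖Complex.exp (f x.2.2)‖ ^ 2 = jacInv n θ x) :
    HasKernel (n := n) θ f ampCan (fun ξ => Complex.I * ((f ξ).im : ℂ)) := by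
  intro u v hu hv
  obtain ⟨h1, h2, w, h3, h4⟩ := hasKernel_ampA1 hθ hf u v hu hv
  refine ⟨h1, h2, w, h3, fun x => ?_⟩
  rw [h4]
  simp only [ampA1_mul_exp_eq hθ h]

end Kernel

/-! ### Density of compactly supported functions -/

section Cutoff

variable {D : Type} [NormedAddCommGroup D] [NormedSpace ℝ D] [FiniteDimensional ℝ D]

theorem exists_cutoff : ∃ χ : 𝓢(D, ℂ), HasCompactSupport χ ∧ ∀ x, ‖x‖ ≤ 1 → χ x = 1 := by
  let b : ContDiffBump (0 : D) := { rIn := 1, rOut := 2, rIn_pos := one_pos, rIn_lt_rOut := one_lt_two }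
  have hb : HasCompactSupport (fun x => (b x : ℂ)) :=
    b.hasCompactSupport.comp_left (g := Complex.ofReal) rfl
  refine ⟨hb.toSchwartzMap (Complex.ofRealCLM.contDiff.comp b.contDiff), hb, fun x hx => ?_⟩
  change (b x : ℂ) = 1
  rw [b.one_of_mem_closedBall (by rwa [mem_closedBall_zero_iff]), Complex.ofReal_one]

/-- The dilation `x ↦ x / (j + 1)`. -/
def shrink (D : Type) [NormedAddCommGroup D] [NormedSpace ℝ D] (j : ℕ) : D →L[ℝ] D :=
  ((j + 1 : ℝ)⁻¹) • ContinuousLinearMap.id ℝ D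

theorem shrink_apply (j : ℕ) (x : D) : shrink D j x = ((j + 1 : ℝ)⁻¹) • x := rfl

theorem norm_shrink_le (j : ℕ) : ‖shrink D j‖ ≤ 1 := by
  refine ContinuousLinearMap.opNorm_le_bound _ zero_le_one fun x => ?_
  rw [shrink_apply, norm_smul, Real.norm_of_nonneg (by positivity)]
  refine mul_le_mul_of_nonneg_right (inv_le_one_of_one_le₀ ?_) (norm_nonneg _)
  linarith [(Nat.cast_nonneg j : (0 : ℝ) ≤ j)]

/-- The products of a Schwartz function with dilated cutoff functions converge to it: the error is
supported in `‖x‖ ≥ j + 1`, where one more power of `‖x‖` gives a factor `1 / (j + 1)`. -/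
theorem dense_hasCompactSupport : Dense {f : 𝓢(D, ℂ) | HasCompactSupport f} := by
  obtain ⟨χ, hχ, hχ1⟩ := exists_cutoff (D := D)
  intro f
  have hsm : ∀ j, ContDiff ℝ ∞ (fun x => χ (shrink D j x)) := fun j =>
    (χ.smooth ⊤).comp (shrink D j).contDiff
  have hcs : ∀ j, HasCompactSupport (fun x => χ (shrink D j x) * f x) := by
    intro j
    refine HasCompactSupport.mul_right ?_
    have hj : (j + 1 : ℝ)⁻¹ ≠ 0 := by positivity
    exact hχ.comp_homeomorph (Homeomorph.smulOfNeZero _ hj)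
  let F : ℕ → 𝓢(D, ℂ) := fun j => (hcs j).toSchwartzMap ((hsm j).mul (f.smooth ⊤))
  have hF : ∀ j x, F j x = χ (shrink D j x) * f x := fun _ _ => rfl
  refine mem_closure_of_tendsto (f := F) (b := Filter.atTop) ?_ (.of_forall fun j => hcs j)
  rw [(schwartz_withSeminorms ℝ D ℂ).tendsto_nhds_atTop]
  rintro ⟨k, m⟩ ε hε
  set C : ℝ := ∑ i ∈ Finset.range (m + 1), (m.choose i : ℝ) *
    SchwartzMap.seminorm ℝ 0 i χ * SchwartzMap.seminorm ℝ (k + 1) (m - i) f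
    + SchwartzMap.seminorm ℝ (k + 1) m f with hC
  have hC0 : 0 ≤ C := by positivity
  have key : ∀ j, SchwartzMap.seminorm ℝ k m (F j - f) ≤ (j + 1 : ℝ)⁻¹ * C := by
    intro j
    refine seminorm_le_bound ℝ k m _ (by positivity) fun x => ?_
    rcases lt_or_ge ‖x‖ (j + 1) with hx | hx
    · -- near `x` the cutoff is `1`
      have h0 : ⇑(F j - f) =ᶠ[nhds x] fun _ => (0 : ℂ) := by
        filter_upwards [(continuous_norm.tendsto x).eventually_lt_const hx] with y hy
        have : ‖shrink D j y‖ ≤ 1 := by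
          rw [shrink_apply, norm_smul, Real.norm_of_nonneg (by positivity),
            inv_mul_le_iff₀ (by positivity), mul_one]
          exact hy.le
        rw [sub_apply, hF, hχ1 _ this, one_mul, sub_self]
      rw [(Filter.EventuallyEq.iteratedFDeriv (𝕜 := ℝ) h0 m).eq_of_nhds]
      have : iteratedFDeriv ℝ m (fun _ : D => (0 : ℂ)) x = 0 := by
        have := iteratedFDeriv_fun_zero (𝕜 := ℝ) (E := D) (F := ℂ) (n := m)
        exact congrFun this x
      rw [this, norm_zero, mul_zero]
      positivity
    · have h1 : iteratedFDeriv ℝ m (F j - f : 𝓢(D, ℂ)) x =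
          iteratedFDeriv ℝ m (fun x => χ (shrink D j x) * f x) x - iteratedFDeriv ℝ m f x := by
        have : ((F j - f : 𝓢(D, ℂ)) : D → ℂ) = (fun x => χ (shrink D j x) * f x) - f := by
          ext x; rfl
        rw [this]
        exact iteratedFDeriv_sub_apply (((hsm j).mul (f.smooth ⊤)).contDiffAt.of_le (mod_cast le_top))
          ((f.smooth ⊤).contDiffAt.of_le (mod_cast le_top))
      have h2 : ‖iteratedFDeriv ℝ m (fun x => χ (shrink D j x) * f x) x‖ ≤
          ∑ i ∈ Finset.range (m + 1), (m.choose i : ℝ) * SchwartzMap.seminorm ℝ 0 i χ *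
            ‖iteratedFDeriv ℝ (m - i) f x‖ := by
        refine (norm_iteratedFDeriv_mul_le (N := ∞) (hsm j) (f.smooth ⊤) x (mod_cast le_top)).trans ?_
        refine Finset.sum_le_sum fun i _ => ?_
        gcongr
        refine (norm_iteratedFDeriv_comp_clm_le _ (norm_shrink_le j) χ i x).trans ?_
        simpa using le_seminorm ℝ 0 i χ (shrink D j x)
      have h3 : ‖x‖ ^ k ≤ (j + 1 : ℝ)⁻¹ * ‖x‖ ^ (k + 1) := by
        rw [le_inv_mul_iff₀ (by positivity), pow_succ, mul_comm]
        gcongr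
      calc ‖x‖ ^ k * ‖iteratedFDeriv ℝ m (F j - f : 𝓢(D, ℂ)) x‖
          ≤ ((j + 1 : ℝ)⁻¹ * ‖x‖ ^ (k + 1)) *
            (∑ i ∈ Finset.range (m + 1), (m.choose i : ℝ) * SchwartzMap.seminorm ℝ 0 i χ *
              ‖iteratedFDeriv ℝ (m - i) f x‖ + ‖iteratedFDeriv ℝ m f x‖) := by
            rw [h1]
            gcongr
            exact (norm_sub_le _ _).trans (add_le_add_left h2 _)
        _ = (j + 1 : ℝ)⁻¹ * (∑ i ∈ Finset.range (m + 1), (m.choose i : ℝ) *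
              SchwartzMap.seminorm ℝ 0 i χ * (‖x‖ ^ (k + 1) * ‖iteratedFDeriv ℝ (m - i) f x‖)
              + ‖x‖ ^ (k + 1) * ‖iteratedFDeriv ℝ m f x‖) := by
            rw [mul_assoc, mul_add, Finset.mul_sum]
            congr 3
            ext i
            ring
        _ ≤ _ := by
            rw [hC]
            gcongr
            · exact le_seminorm ℝ (k + 1) _ f x
            · exact le_seminorm ℝ (k + 1) _ f x
  obtain ⟨N, hN⟩ := exists_nat_gt (C / ε)
  refine ⟨N, fun j hj => (key j).trans_lt ?_⟩
  rw [inv_mul_lt_iff₀ (by positivity)]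
  rw [div_lt_iff₀ hε] at hN
  refine hN.trans_le (mul_le_mul_of_nonneg_right ?_ hε.le)
  have : (N : ℝ) ≤ j := Nat.cast_le.2 hj
  linarith

end Cutoff

section TestFunctions

variable {n : ℕ} {θ : ℝ} {f : ℝ → ℂ}

/-- `Ti` has dense range, since the range contains all functions with compactly supported partial
Fourier transform. -/
theorem denseRange_Ti (hf : IsInvMult f) : DenseRange (Ti n θ f) := by
  have hs : Function.Surjective (pFi (n := n)) := fun u => ⟨pF u, pFi_pF u⟩
  refine (hs.denseRange.dense_image pFi.continuous (dense_hasCompactSupport (D := M n))).mono ?_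
  rintro _ ⟨Q, hQ, rfl⟩
  obtain ⟨ρ, hρ⟩ := (show HasCompactSupport Q from hQ).isCompact.isBounded.exists_norm_le
  refine exists_Ti_eq hf (pFi Q) ρ fun a x η hη => ?_
  rw [pF_pFi]
  by_contra hne
  have h1 := hρ _ (subset_tsupport _ hne)
  have h2 : ‖η‖ ≤ ‖((a, x, η) : M n)‖ := (norm_snd_le (x, η)).trans (norm_snd_le (a, x, η))
  rw [Real.norm_eq_abs] at h2
  linarith

/-- The images under `T⁻¹` of the compactly supported functions are dense in `𝓢`. -/
theorem dense_Ti_hasCompactSupport (hf : IsInvMult f) :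
    Dense (Ti n θ f '' {w | HasCompactSupport w}) :=
  (denseRange_Ti hf).dense_image (Ti n θ f).continuous dense_hasCompactSupport

end TestFunctions

/-! ### The Hilbert completion -/

section Completion

variable {n : ℕ} {θ : ℝ} {f : ℝ → ℂ}

/-- Plancherel: `kappa` is isometric up to a constant. -/
theorem exists_inner_kappa (n : ℕ) (hθ : θ ≠ 0) : ∃ k : ℝ, 0 < k ∧ ∀ u v : 𝓢(M n, ℂ),
    ⟪incl (Cf n) (kappa n hθ v), incl (Cf n) (kappa n hθ u)⟫_ℂ =
      k * ∫ x, u x * (starRingEnd ℂ) (v x) := by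
  obtain ⟨c, hc, h⟩ := exists_integral_comp_linearEquiv (volume : Measure (Cf n × Cf n))
    (volume : Measure (M n)) (kerCoord n hθ)
  have hq := ftConst_pos (W := EuclideanSpace ℝ (Fin n))
  have hl := ftConst_pos (W := ℝ)
  refine ⟨c / (ftConst (EuclideanSpace ℝ (Fin n)) * ftConst ℝ), by positivity, fun u v => ?_⟩
  have h1 := integral_FT_mul_conj_FT (splitQ n) (volume : Measure (M n)) (pF u) (pF v)
  have h2 := integral_FT_mul_conj_FT (splitL n) (volume : Measure (M n)) u v
  have h3 := inner_toL2_toL2_eq (kappa n hθ v) (kappa n hθ u) (volume : Measure (Cf n × Cf n))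
  refine h3.trans ?_
  have h4 := h fun x => FT (splitQ n) (pF u) x * (starRingEnd ℂ) (FT (splitQ n) (pF v) x)
  have h5 : ∫ z, ⟪kappa n hθ v z, kappa n hθ u z⟫_ℂ =
      c * ∫ x, FT (splitQ n) (pF u) x * (starRingEnd ℂ) (FT (splitQ n) (pF v) x) := h4
  rw [h5, ← h2]
  change _ = _ * ((ftConst ℝ : ℂ) * ∫ x, pF u x * (starRingEnd ℂ) (pF v x))
  rw [← h1]
  push_cast
  have e1 : (ftConst (EuclideanSpace ℝ (Fin n)) : ℂ) ≠ 0 := Complex.ofReal_ne_zero.2 hq.ne'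
  have e2 : (ftConst ℝ : ℂ) ≠ 0 := Complex.ofReal_ne_zero.2 hl.ne'
  field_simp

/-- The normalization which makes `kappa` isometric for the `L²` norms. -/
def kappaNorm (n : ℕ) (hθ : θ ≠ 0) : ℝ := (Real.sqrt (exists_inner_kappa n hθ).choose)⁻¹

theorem kappaNorm_pos (n : ℕ) (hθ : θ ≠ 0) : 0 < kappaNorm n hθ :=
  inv_pos.2 (Real.sqrt_pos.2 (exists_inner_kappa n hθ).choose_spec.1)

theorem inner_kappa (hθ : θ ≠ 0) (u v : 𝓢(M n, ℂ)) :
    ⟪(kappaNorm n hθ : ℂ) • incl (Cf n) (kappa n hθ v),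
      (kappaNorm n hθ : ℂ) • incl (Cf n) (kappa n hθ u)⟫_ℂ = ∫ x, u x * (starRingEnd ℂ) (v x) := by
  rw [inner_smul_left, inner_smul_right, (exists_inner_kappa n hθ).choose_spec.2 u v, kappaNorm]
  have hk := (exists_inner_kappa n hθ).choose_spec.1
  generalize (exists_inner_kappa n hθ).choose = k at hk ⊢
  have h1 : Real.sqrt k * Real.sqrt k = k := Real.mul_self_sqrt hk.le
  have h2 : (Real.sqrt k)⁻¹ * ((Real.sqrt k)⁻¹ * k) = 1 := by
    have : Real.sqrt k ≠ 0 := (Real.sqrt_pos.2 hk).ne'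
    nth_rewrite 3 [← h1]
    field_simp
  rw [Complex.conj_ofReal, ← mul_assoc, ← mul_assoc]
  have h3 : ((Real.sqrt k : ℝ) : ℂ)⁻¹ * (((Real.sqrt k : ℝ) : ℂ)⁻¹ * k) = 1 := by exact_mod_cast h2
  push_cast
  rw [← mul_assoc] at h3
  rw [h3, one_mul]

/-- The embedding of `E` into the Hilbert–Schmidt kernels. -/
def iota (hθ : θ ≠ 0) (hf : IsInvMult f) : E n θ f →ₗ[ℂ] HS (Cf n) :=
  (kappaNorm n hθ : ℂ) • ((incl (Cf n)) ∘ₗ (kappa n hθ).toLinearMap ∘ₗ (TinvEquiv hf).toLinearMap)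

theorem iota_apply (hθ : θ ≠ 0) (hf : IsInvMult f) (a : E n θ f) :
    iota hθ hf a = (kappaNorm n hθ : ℂ) • incl (Cf n) (kappa n hθ (Tinv a)) := by
  rw [← TinvEquiv_apply hf]
  rfl

theorem inner_iota (hθ : θ ≠ 0) (hf : IsInvMult f) (a b : E n θ f) :
    ⟪iota hθ hf b, iota hθ hf a⟫_ℂ = pairing a b := by
  rw [iota_apply, iota_apply, inner_kappa]
  rfl

theorem denseRange_smul_incl_kappa (hθ : θ ≠ 0) :
    DenseRange fun u : 𝓢(M n, ℂ) => (kappaNorm n hθ : ℂ) • incl (Cf n) (kappa n hθ u) := by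
  have h0 : (kappaNorm n hθ : ℂ) ≠ 0 := Complex.ofReal_ne_zero.2 (kappaNorm_pos n hθ).ne'
  have h1 : Function.Surjective (kappa n hθ) := fun K => ⟨_, kappa_kappaInv hθ K⟩
  have h2 : Function.Surjective fun z : HS (Cf n) => (kappaNorm n hθ : ℂ) • z := fun z =>
    ⟨(kappaNorm n hθ : ℂ)⁻¹ • z, by simp only [smul_smul, mul_inv_cancel₀ h0, one_smul]⟩
  have h3 : DenseRange (incl (Cf n)) := denseRange_incl
  have h4 : DenseRange (incl (Cf n) ∘ kappa n hθ) :=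
    h3.comp h1.denseRange (toLpCLM ℂ ℂ 2 volume).continuous
  exact h2.denseRange.comp h4 (continuous_const_smul (kappaNorm n hθ : ℂ))

theorem continuous_smul_incl_kappa (hθ : θ ≠ 0) :
    Continuous fun u : 𝓢(M n, ℂ) => (kappaNorm n hθ : ℂ) • incl (Cf n) (kappa n hθ u) :=
  ((toLpCLM ℂ ℂ 2 (volume : Measure (Cf n × Cf n))).continuous.comp
    (kappa n hθ).continuous).const_smul (kappaNorm n hθ : ℂ)

/-- The Hilbert–Schmidt kernels are the completion of `E`, because `T⁻¹` maps `E` onto `𝓢`. -/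
theorem isHilbertCompletion_iota (hθ : θ ≠ 0) (hf : IsInvMult f) :
    IsHilbertCompletion (iota (n := n) hθ hf) where
  dense := by
    have h := (denseRange_smul_incl_kappa (n := n) hθ).comp
      (TinvEquiv (n := n) (θ := θ) hf).surjective.denseRange (continuous_smul_incl_kappa hθ)
    exact h
  inner_eq := inner_iota hθ hf

/-- The elements of `E` given by compactly supported functions are dense in the completion. -/
theorem dense_iota_hasCompactSupport (hθ : θ ≠ 0) (hf : IsInvMult f) :
    Dense (Set.range fun w : {w : 𝓢(M n, ℂ) // HasCompactSupport w} =>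
      iota hθ hf ⟨toDist w.1, toDist_mem_E hf w.1⟩) := by
  have h := (denseRange_smul_incl_kappa (n := n) hθ).dense_image
    (continuous_smul_incl_kappa hθ) (dense_Ti_hasCompactSupport (θ := θ) hf)
  refine h.mono ?_
  rintro _ ⟨_, ⟨w, hw, rfl⟩, rfl⟩
  refine ⟨⟨w, hw⟩, ?_⟩
  simp only [iota_apply, Tinv_toDist hf]

/-- The constant relating the product of `E` to the composition of kernels. -/
def mulScale (n : ℕ) (hθ : θ ≠ 0) : ℝ := weylScale n hθ / kappaNorm n hθ

theorem mulScale_pos (n : ℕ) (hθ : θ ≠ 0) : 0 < mulScale n hθ :=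
  div_pos (weylScale_pos n hθ) (kappaNorm_pos n hθ)

/-- The product of the completion. -/
def hmul (n : ℕ) (hθ : θ ≠ 0) : HS (Cf n) →L[ℂ] HS (Cf n) →L[ℂ] HS (Cf n) :=
  (mulScale n hθ : ℂ) • mulHS (Cf n)

/-- The involution of the completion. -/
def hinv (n : ℕ) : HS (Cf n) →ₗ⋆[ℂ] HS (Cf n) := (adjHS (Cf n)).toLinearMap

theorem hmul_iota (hθ : θ ≠ 0) (hf : IsInvMult f) (a b : E n θ f) :
    hmul n hθ (iota hθ hf a) (iota hθ hf b) = iota hθ hf (star a b) := by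
  simp only [hmul, iota_apply, smul_apply, map_smul, mulHS_incl, Tinv_star hf, kappa_weyl,
    smul_smul]
  congr 1
  rw [mulScale]
  have : (kappaNorm n hθ : ℂ) ≠ 0 := Complex.ofReal_ne_zero.2 (kappaNorm_pos n hθ).ne'
  push_cast
  field_simp

/-- Complex conjugation of symbols corresponds to the adjoint of kernels. -/
theorem adjK_kappa (hθ : θ ≠ 0) (u : 𝓢(M n, ℂ)) :
    adjK (kappa n hθ u) = kappa n hθ (conjSchwartz u) := by
  ext z
  rw [adjK_apply, kappa_apply, kappa_apply, ← integral_conj]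
  congr 1
  ext q
  rw [map_mul, ← Complex.exp_conj, pF_apply, pF_apply, pFourier, pFourier, ← integral_conj]
  congr 1
  · congr 1
    simp only [map_neg, map_mul, Complex.conj_I, Complex.conj_ofReal, inner_smul_right,
      inner_sub_right]
    push_cast
    ring
  · simp only [add_comm z.2.1 z.1.1, add_comm z.2.2 z.1.2]
    congr 1
    ext l
    rw [map_mul, ← Complex.exp_conj, conjSchwartz_apply]
    congr 2
    simp only [map_neg, map_mul, Complex.conj_I, Complex.conj_ofReal]
    push_cast
    ring

theorem hinv_iota (hθ : θ ≠ 0) (hf : IsInvMult f) (a b : E n θ f)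
    (h : Tinv b = conjS (Tinv a)) : hinv n (iota hθ hf a) = iota hθ hf b := by
  rw [iota_apply, iota_apply, h]
  change adjHS (Cf n) _ = _
  rw [map_smulₛₗ, adjHS_incl, adjK_kappa, Complex.conj_ofReal]
  rfl

theorem exists_Tinv_eq (hf : IsInvMult f) (u : 𝓢(M n, ℂ)) : ∃ b : E n θ f, Tinv b = u :=
  ⟨⟨T n θ f u, LinearMap.mem_range_self _ _⟩, Tinv_eq hf rfl⟩

theorem isHilbertAlgebra_hmul (n : ℕ) (hθ : θ ≠ 0) : IsHilbertAlgebra (hmul n hθ) (hinv n) :=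
  isHilbertAlgebra_smul_mulHS _ (mulScale_pos n hθ).ne'

theorem phi_neg (θ ξ : ℝ) : phi θ (-ξ) = -phi θ ξ := by
  unfold phi
  split_ifs
  · rfl
  · rw [mul_neg, Real.sinh_neg, neg_div]

theorem twistDet_neg (n : ℕ) (θ ξ : ℝ) : twistDet n θ (-ξ) = twistDet n θ ξ := by
  have h : phiInv θ (-ξ) = -phiInv θ ξ := by
    conv_lhs => rw [← phi_phiInv θ ξ, ← phi_neg, phiInv_phi]
  simp only [twistDet, rho, chi, h, mul_neg, Real.cosh_neg, neg_sq]

theorem pFi_conj_reflect (g : 𝓢(M n, ℂ)) (a : ℝ) (v : V n) (ξ : ℝ) :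
    pFi (conjS g) (a, v, -ξ) = (starRingEnd ℂ) (pFi g (a, v, ξ)) := by
  rw [pFi_apply, pFi_apply, pFourierInv, pFourierInv, map_mul, ← integral_conj]
  congr 1
  · rw [map_inv₀, map_mul, Complex.conj_ofReal, map_ofNat]
  · congr 1
    ext t
    rw [map_mul, ← Complex.exp_conj]
    refine congrArg₂ (· * ·) (congrArg Complex.exp ?_) rfl
    simp only [map_mul, Complex.conj_I, Complex.conj_ofReal]
    push_cast
    ring

theorem pF_eq_conj_of_reflect {h h' : 𝓢(M n, ℂ)}
    (H : ∀ a v ξ, h' (a, v, -ξ) = (starRingEnd ℂ) (h (a, v, ξ))) (x : M n) :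
    pF h' x = (starRingEnd ℂ) (pF h x) := by
  rw [pF_apply, pF_apply, pFourier, pFourier, ← integral_conj, ← integral_neg_eq_self]
  congr 1
  ext l
  rw [H, map_mul, ← Complex.exp_conj]
  congr 2
  simp only [map_neg, map_mul, Complex.conj_I, Complex.conj_ofReal]
  push_cast
  ring

theorem Tt_conj (hf : IsInvMult f) (hc : ∀ ξ, f (-ξ) = (starRingEnd ℂ) (f ξ)) (g : 𝓢(M n, ℂ))
    (x : M n) : Tt n θ f (conjS g) x = (starRingEnd ℂ) (Tt n θ f g x) := by
  have hm : (fun ξ => Complex.exp (f ξ) * (twistDet n θ ξ : ℂ)).HasTemperateGrowth :=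
    hf.mult.fun_mul
      (Function.Complex.hasTemperateGrowth_ofReal.comp (hasTemperateGrowth_twistDet n θ))
  refine pF_eq_conj_of_reflect (fun a v ξ => ?_) x
  change mulL (fun ξ => Complex.exp (f ξ) * (twistDet n θ ξ : ℂ)) (pFi (conjS g))
    (twist n θ (a, v, -ξ)) = (starRingEnd ℂ) (mulL (fun ξ => Complex.exp (f ξ) *
      (twistDet n θ ξ : ℂ)) (pFi g) (twist n θ (a, v, ξ)))
  rw [mulL_apply hm, mulL_apply hm]
  have h1 : twist n θ (a, v, -ξ) = ((twist n θ (a, v, ξ)).1, (twist n θ (a, v, ξ)).2.1,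
      -(twist n θ (a, v, ξ)).2.2) := by
    simp only [twist, Equiv.coe_fn_mk, mul_neg, Real.cosh_neg, phi_neg]
  rw [h1, pFi_conj_reflect, map_mul]
  congr 1
  simp only [hc, Complex.exp_conj, map_mul, Complex.conj_ofReal, twistDet_neg]

/-- If `τ_θ(-ξ)` is the conjugate of `τ_θ(ξ)`, then `T` commutes with complex conjugation. -/
theorem T_conj (hf : IsInvMult f) (hc : ∀ ξ, f (-ξ) = (starRingEnd ℂ) (f ξ)) (u g : 𝓢(M n, ℂ)) :
    T n θ f (conjS u) g = (starRingEnd ℂ) (T n θ f u (conjS g)) := by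
  rw [T_apply_eq_integral_Tt hf, T_apply_eq_integral_Tt hf, ← integral_conj]
  congr 1
  ext x
  rw [Tt_conj hf hc, map_mul, Complex.conj_conj]
  rfl

end Completion

/-! ### Unitary automorphisms induced by transformations of kernels -/

section Twisted

variable {X : Type} [NormedAddCommGroup X] [NormedSpace ℝ X] [FiniteDimensional ℝ X]
  [MeasureSpace X] [BorelSpace X] [SecondCountableTopology X]
  [(volume : Measure X).IsAddHaarMeasure]

/-- `K'` is the conjugate of the kernel `K` by the unitary operator `u ↦ φ · (u ∘ σ)`. -/
def Twisted (σ : X → X) (φ : X → ℂ) (K K' : 𝓢(X × X, ℂ)) : Prop :=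
  ∀ s t, K' (s, t) = φ s * (starRingEnd ℂ) (φ t) * K (σ s, σ t)

variable {σ : X → X} {φ : X → ℂ}

theorem Twisted.adjK {K K' : 𝓢(X × X, ℂ)} (h : Twisted σ φ K K') :
    Twisted σ φ (adjK K) (adjK K') := by
  intro s t
  rw [adjK_apply, adjK_apply]
  simp only [h t s, map_mul, Complex.conj_conj]
  ring

theorem conj_mul_self_of_norm_one {z : ℂ} (h : ‖z‖ = 1) : (starRingEnd ℂ) z * z = 1 := by
  rw [Complex.conj_mul', h]
  simp

theorem Twisted.compK (hσ : ∀ F : X → ℂ, ∫ r, F (σ r) = ∫ r, F r) (hφ : ∀ r, ‖φ r‖ = 1)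
    {K K' L L' : 𝓢(X × X, ℂ)} (hK : Twisted σ φ K K') (hL : Twisted σ φ L L') :
    Twisted σ φ (compK K L) (compK K' L') := by
  intro s t
  rw [compK_apply, compK_apply, ← hσ fun r => K (σ s, r) * L (r, σ t), ← integral_const_mul]
  congr 1
  ext r
  simp only [hK s r, hL r t]
  linear_combination (φ s * (starRingEnd ℂ) (φ t) * K (σ s, σ r) * L (σ r, σ t)) *
    conj_mul_self_of_norm_one (hφ r)

theorem Twisted.inner_incl (hσ : ∀ F : X → ℂ, ∫ r, F (σ r) = ∫ r, F r) (hφ : ∀ r, ‖φ r‖ = 1)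
    {K K' L L' : 𝓢(X × X, ℂ)} (hK : Twisted σ φ K K') (hL : Twisted σ φ L L') :
    ⟪incl X K', incl X L'⟫_ℂ = ⟪incl X K, incl X L⟫_ℂ := by
  rw [inner_incl_eq_trace, inner_incl_eq_trace,
    ← hσ (fun t => RicciQuant.compK (RicciQuant.adjK K) L (t, t))]
  congr 1
  ext t
  rw [hK.adjK.compK hσ hφ hL t t, mul_comm (φ t), conj_mul_self_of_norm_one (hφ t), one_mul]

end Twisted

section Equivariance

variable {n : ℕ} {θ : ℝ} {f : ℝ → ℂ}

/-- The space of compactly supported functions. -/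
def testFn (n : ℕ) : Submodule ℂ 𝓢(M n, ℂ) where
  carrier := {u | HasCompactSupport u}
  add_mem' hu hv := HasCompactSupport.add hu hv
  zero_mem' := HasCompactSupport.zero
  smul_mem' c _ hu := HasCompactSupport.smul_left (f := fun _ => c) hu

/-- The restriction to `𝓢` of the embedding `iota`. -/
def iotaS (n : ℕ) (hθ : θ ≠ 0) (f : ℝ → ℂ) : 𝓢(M n, ℂ) →ₗ[ℂ] HS (Cf n) :=
  (kappaNorm n hθ : ℂ) • (incl (Cf n) ∘ₗ (kappa n hθ).toLinearMap ∘ₗ (Ti n θ f).toLinearMap)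

theorem iotaS_apply (hθ : θ ≠ 0) (u : 𝓢(M n, ℂ)) :
    iotaS n hθ f u = (kappaNorm n hθ : ℂ) • incl (Cf n) (kappa n hθ (Ti n θ f u)) := rfl

theorem iota_toDist (hθ : θ ≠ 0) (hf : IsInvMult f) (u : 𝓢(M n, ℂ)) (hu : toDist u ∈ E n θ f) :
    iota hθ hf ⟨toDist u, hu⟩ = iotaS n hθ f u := by
  rw [iota_apply, Tinv_toDist hf, iotaS_apply]

theorem denseRange_iotaS (hθ : θ ≠ 0) (hf : IsInvMult f) :
    DenseRange ((iotaS n hθ f) ∘ₗ (testFn n).subtype) := by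
  refine (dense_iota_hasCompactSupport (n := n) hθ hf).mono ?_
  rintro _ ⟨w, rfl⟩
  exact ⟨⟨w.1, w.2⟩, (iota_toDist hθ hf _ _).symm⟩

theorem exists_translate {g : Equiv.Perm (M n)} (h1 : ContDiff ℝ ∞ g) (h2 : ContDiff ℝ ∞ g.symm)
    {u : 𝓢(M n, ℂ)} (hu : HasCompactSupport u) :
    ∃ w : 𝓢(M n, ℂ), HasCompactSupport w ∧ ∀ x, w x = u (g.symm x) := by
  let e : M n ≃ₜ M n :=
    { toEquiv := g.symm
      continuous_toFun := h2.continuous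
      continuous_invFun := h1.continuous }
  have hc : HasCompactSupport (fun x => u (g.symm x)) := hu.comp_homeomorph e
  exact ⟨hc.toSchwartzMap ((u.smooth ⊤).comp h2), hc, fun x => rfl⟩

/-- Translation of compactly supported functions by a diffeomorphism. -/
def translateFn (g : Equiv.Perm (M n)) (h1 : ContDiff ℝ ∞ g) (h2 : ContDiff ℝ ∞ g.symm)
    (u : testFn n) : testFn n :=
  ⟨(exists_translate h1 h2 u.2).choose, (exists_translate h1 h2 u.2).choose_spec.1⟩

theorem translateFn_apply (g : Equiv.Perm (M n)) (h1 : ContDiff ℝ ∞ g) (h2 : ContDiff ℝ ∞ g.symm)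
    (u : testFn n) (x : M n) : (translateFn g h1 h2 u).1 x = u.1 (g.symm x) :=
  (exists_translate h1 h2 u.2).choose_spec.2 x

/-- `translateFn` as a linear equivalence. -/
def translate (g : Equiv.Perm (M n)) (h1 : ContDiff ℝ ∞ g) (h2 : ContDiff ℝ ∞ g.symm) :
    testFn n ≃ₗ[ℂ] testFn n where
  toFun := translateFn g h1 h2
  invFun := translateFn g.symm h2 h1
  map_add' u v := Subtype.ext (SchwartzMap.ext fun x => by
    rw [translateFn_apply]
    change _ = (translateFn g h1 h2 u).1 x + (translateFn g h1 h2 v).1 x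
    rw [translateFn_apply, translateFn_apply]
    rfl)
  map_smul' c u := Subtype.ext (SchwartzMap.ext fun x => by
    rw [translateFn_apply]
    change _ = c • (translateFn g h1 h2 u).1 x
    rw [translateFn_apply]
    rfl)
  left_inv u := Subtype.ext (SchwartzMap.ext fun x => by
    rw [translateFn_apply, translateFn_apply, Equiv.symm_symm, Equiv.symm_apply_apply])
  right_inv u := Subtype.ext (SchwartzMap.ext fun x => by
    rw [translateFn_apply, translateFn_apply, Equiv.symm_symm, Equiv.apply_symm_apply])

theorem translate_apply (g : Equiv.Perm (M n)) (h1 : ContDiff ℝ ∞ g) (h2 : ContDiff ℝ ∞ g.symm)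
    (u : testFn n) (x : M n) : (translate g h1 h2 u).1 x = u.1 (g.symm x) :=
  translateFn_apply g h1 h2 u x

/-- The diffeomorphism `g` of `M` is implemented on kernels by a unitary operator
`h ↦ φ · (h ∘ σ)` of `L²(Cf n)`, where `σ` preserves integrals and `φ` has modulus one. -/
structure IsImplemented (hθ : θ ≠ 0) (f : ℝ → ℂ) (g : Equiv.Perm (M n)) : Prop where
  contDiff : ContDiff ℝ ∞ g
  contDiff_symm : ContDiff ℝ ∞ g.symm
  exists_twisted : ∃ (σ : Cf n ≃ Cf n) (φ : Cf n → ℂ),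
    (∀ F : Cf n → ℂ, ∫ r, F (σ r) = ∫ r, F r) ∧ (∀ r, ‖φ r‖ = 1) ∧
    ∀ u w : 𝓢(M n, ℂ), HasCompactSupport u → HasCompactSupport w → (∀ x, w x = u (g.symm x)) →
      Twisted σ φ (kappa n hθ (Ti n θ f u)) (kappa n hθ (Ti n θ f w))

theorem IsImplemented.one (hθ : θ ≠ 0) : IsImplemented hθ f (1 : Equiv.Perm (M n)) where
  contDiff := contDiff_id
  contDiff_symm := contDiff_id
  exists_twisted := by
    refine ⟨Equiv.refl _, fun _ => 1, fun _ => rfl, fun _ => norm_one, fun u w _ _ h s t => ?_⟩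
    have : w = u := SchwartzMap.ext h
    simp [this]

theorem IsImplemented.mul {hθ : θ ≠ 0} {g₁ g₂ : Equiv.Perm (M n)} (h₁ : IsImplemented hθ f g₁)
    (h₂ : IsImplemented hθ f g₂) : IsImplemented hθ f (g₁ * g₂) where
  contDiff := h₁.contDiff.comp h₂.contDiff
  contDiff_symm := h₂.contDiff_symm.comp h₁.contDiff_symm
  exists_twisted := by
    obtain ⟨σ₁, φ₁, i₁, n₁, t₁⟩ := h₁.exists_twisted
    obtain ⟨σ₂, φ₂, i₂, n₂, t₂⟩ := h₂.exists_twisted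
    refine ⟨σ₁.trans σ₂, fun r => φ₁ r * φ₂ (σ₁ r), fun F => ?_, fun r => ?_,
      fun u w hu hw h s t => ?_⟩
    · exact (i₁ fun r => F (σ₂ r)).trans (i₂ F)
    · rw [norm_mul, n₁, n₂, one_mul]
    · obtain ⟨v, hv, hvu⟩ := exists_translate h₂.contDiff h₂.contDiff_symm hu
      rw [t₁ v w hv hw (fun x => (h x).trans (hvu _).symm) s t, t₂ u v hu hv hvu]
      simp only [map_mul, Equiv.coe_trans, Function.comp_apply]
      ring

theorem IsImplemented.inv {hθ : θ ≠ 0} {g : Equiv.Perm (M n)} (h : IsImplemented hθ f g) :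
    IsImplemented hθ f g⁻¹ where
  contDiff := h.contDiff_symm
  contDiff_symm := h.contDiff
  exists_twisted := by
    obtain ⟨σ, φ, hσ, hφ, ht⟩ := h.exists_twisted
    refine ⟨σ.symm, fun r => (starRingEnd ℂ) (φ (σ.symm r)), fun F => ?_, fun r => ?_,
      fun u w hu hw h s t => ?_⟩
    · rw [← hσ]
      simp only [Equiv.symm_apply_apply]
    · rw [RCLike.norm_conj, hφ]
    · have hx : ∀ x, u x = w (g.symm x) := fun x => by
        rw [h]
        exact congrArg u (g.apply_symm_apply x).symm
      rw [ht w u hw hu hx (σ.symm s) (σ.symm t)]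
      simp only [Equiv.apply_symm_apply, Complex.conj_conj]
      linear_combination (-kappa n hθ (Ti n θ f w) (s, t) * (starRingEnd ℂ) (φ (σ.symm s)) *
        φ (σ.symm s)) * conj_mul_self_of_norm_one (hφ (σ.symm t)) -
        kappa n hθ (Ti n θ f w) (s, t) * conj_mul_self_of_norm_one (hφ (σ.symm s))

/-- The unitary `V` extends translation by `g` on test functions. -/
def Extends (hθ : θ ≠ 0) (f : ℝ → ℂ) (g : Equiv.Perm (M n)) (V : HS (Cf n) ≃ₗᵢ[ℂ] HS (Cf n)) :
    Prop :=
  ∀ u w : 𝓢(M n, ℂ), HasCompactSupport u → HasCompactSupport w → (∀ x, w x = u (g.symm x)) →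
    V (iotaS n hθ f u) = iotaS n hθ f w

theorem hmul_iotaS (hθ : θ ≠ 0) (u v : 𝓢(M n, ℂ)) :
    hmul n hθ (iotaS n hθ f u) (iotaS n hθ f v) =
      ((mulScale n hθ * kappaNorm n hθ ^ 2 : ℝ) : ℂ) •
        incl (Cf n) (compK (kappa n hθ (Ti n θ f u)) (kappa n hθ (Ti n θ f v))) := by
  simp only [hmul, iotaS_apply, smul_apply, map_smul, mulHS_incl, smul_smul]
  congr 1
  push_cast
  ring

theorem hinv_iotaS (hθ : θ ≠ 0) (u : 𝓢(M n, ℂ)) :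
    hinv n (iotaS n hθ f u) = (kappaNorm n hθ : ℂ) • incl (Cf n) (adjK (kappa n hθ (Ti n θ f u))) := by
  rw [iotaS_apply]
  change adjHS (Cf n) _ = _
  rw [map_smulₛₗ, adjHS_incl, Complex.conj_ofReal]

theorem inner_iotaS (hθ : θ ≠ 0) (u v : 𝓢(M n, ℂ)) :
    ⟪iotaS n hθ f u, iotaS n hθ f v⟫_ℂ = (kappaNorm n hθ : ℂ) * ((kappaNorm n hθ : ℂ) *
      ⟪incl (Cf n) (kappa n hθ (Ti n θ f u)), incl (Cf n) (kappa n hθ (Ti n θ f v))⟫_ℂ) := by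
  rw [iotaS_apply, iotaS_apply, inner_smul_left, inner_smul_right, Complex.conj_ofReal]

theorem Twisted.inner_iotaS {hθ : θ ≠ 0} {σ : Cf n → Cf n} {φ : Cf n → ℂ}
    (hσ : ∀ F : Cf n → ℂ, ∫ r, F (σ r) = ∫ r, F r) (hφ : ∀ r, ‖φ r‖ = 1) {u u' v v' : 𝓢(M n, ℂ)}
    (hu : Twisted σ φ (kappa n hθ (Ti n θ f u)) (kappa n hθ (Ti n θ f u')))
    (hv : Twisted σ φ (kappa n hθ (Ti n θ f v)) (kappa n hθ (Ti n θ f v'))) :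
    ⟪iotaS n hθ f u', iotaS n hθ f v'⟫_ℂ = ⟪iotaS n hθ f u, iotaS n hθ f v⟫_ℂ := by
  rw [RicciQuant.inner_iotaS, RicciQuant.inner_iotaS, hu.inner_incl hσ hφ hv]

/-- An implemented diffeomorphism extends to a unitary automorphism of the completion.  Products and
adjoints of test functions are not test functions, so compatibility is verified through inner
products with translated test functions. -/
theorem IsImplemented.exists_unitary {hθ : θ ≠ 0} (hf : IsInvMult f) {g : Equiv.Perm (M n)}
    (h : IsImplemented hθ f g) : ∃ V : HS (Cf n) ≃ₗᵢ[ℂ] HS (Cf n), Extends hθ f g V ∧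
      (∀ a b, V (hmul n hθ a b) = hmul n hθ (V a) (V b)) ∧ ∀ a, V (hinv n a) = hinv n (V a) := by
  obtain ⟨σ, φ, hσ, hφ, ht⟩ := h.exists_twisted
  obtain ⟨e, he⟩ : ∃ e : testFn n ≃ₗ[ℂ] testFn n, ∀ u x, (e u).1 x = u.1 (g.symm x) :=
    ⟨translate g h.contDiff h.contDiff_symm, translate_apply g _ _⟩
  obtain ⟨ι, hι⟩ : ∃ ι : testFn n →ₗ[ℂ] HS (Cf n), ι = (iotaS n hθ f) ∘ₗ (testFn n).subtype :=
    ⟨_, rfl⟩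
  have hιa : ∀ u, ι u = iotaS n hθ f u.1 := fun u => by rw [hι]; rfl
  have hd : DenseRange ι := by rw [hι]; exact denseRange_iotaS hθ hf
  have het : ∀ u : testFn n, Twisted σ φ (kappa n hθ (Ti n θ f u.1))
      (kappa n hθ (Ti n θ f (e u).1)) := fun u => ht u.1 (e u).1 u.2 (e u).2 (he u)
  have hnorm : ∀ u, ‖ι (e u)‖ = ‖ι u‖ := by
    intro u
    rw [hιa, hιa, @norm_eq_sqrt_re_inner ℂ, @norm_eq_sqrt_re_inner ℂ _ _ _ _ (iotaS n hθ f u.1),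
      (het u).inner_iotaS hσ hφ (het u)]
  obtain ⟨V, hV⟩ : ∃ V : HS (Cf n) ≃ₗᵢ[ℂ] HS (Cf n), ∀ u, V (ι u) = ι (e u) :=
    ⟨e.extendOfIsometry ι ι hd hd hnorm, e.extendOfIsometry_eq ι ι hd hd hnorm⟩
  -- an element is determined by its inner products with the test functions
  have hext : ∀ a b : HS (Cf n), (∀ w : testFn n, ⟪ι (e w), a⟫_ℂ = ⟪ι (e w), b⟫_ℂ) → a = b := by
    intro a b hab
    refine ext_inner_left ℂ fun c => ?_
    refine hd.induction_on c (isClosed_eq (by fun_prop) (by fun_prop)) fun w => ?_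
    simpa using hab (e.symm w)
  refine ⟨V, fun u w hu hw huw => ?_, fun a b => ?_, fun a => ?_⟩
  · have h1 := hV ⟨u, hu⟩
    have h2 : (e ⟨u, hu⟩).1 = w := SchwartzMap.ext fun x => by rw [he, huw]
    rwa [hιa, hιa, h2] at h1
  · refine DenseRange.induction_on₂ hd ?_ ?_ a b
    · exact isClosed_eq (by fun_prop) (by fun_prop)
    · intro u v
      refine hext _ _ fun w => ?_
      rw [← hV w, LinearIsometryEquiv.inner_map_map, hV, hV, hV]
      simp only [hιa]
      rw [hmul_iotaS, hmul_iotaS, iotaS_apply, iotaS_apply, inner_smul_left, inner_smul_right,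
        inner_smul_left, inner_smul_right,
        (het w).inner_incl hσ hφ ((het u).compK hσ hφ (het v))]
  · refine hd.induction_on a ?_ ?_
    · exact isClosed_eq (V.continuous.comp (adjHS (Cf n)).continuous)
        ((adjHS (Cf n)).continuous.comp V.continuous)
    · intro u
      refine hext _ _ fun w => ?_
      rw [← hV w, LinearIsometryEquiv.inner_map_map, hV, hV]
      simp only [hιa]
      rw [hinv_iotaS, hinv_iotaS, iotaS_apply, iotaS_apply, inner_smul_left, inner_smul_right,
        inner_smul_left, inner_smul_right, (het w).inner_incl hσ hφ (het u).adjK]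

theorem Extends.unique {hθ : θ ≠ 0} (hf : IsInvMult f) {g : Equiv.Perm (M n)}
    (h : IsImplemented hθ f g) {V V' : HS (Cf n) ≃ₗᵢ[ℂ] HS (Cf n)} (hV : Extends hθ f g V)
    (hV' : Extends hθ f g V') : V = V' := by
  refine LinearIsometryEquiv.ext fun a => ?_
  refine (denseRange_iotaS hθ hf).induction_on a (isClosed_eq V.continuous V'.continuous) fun u => ?_
  obtain ⟨w, hw, hwu⟩ := exists_translate h.contDiff h.contDiff_symm u.2
  exact (hV u.1 w u.2 hw hwu).trans (hV' u.1 w u.2 hw hwu).symm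

theorem Extends.mul {hθ : θ ≠ 0} {g₁ g₂ : Equiv.Perm (M n)} (h₂ : IsImplemented hθ f g₂)
    {V₁ V₂ : HS (Cf n) ≃ₗᵢ[ℂ] HS (Cf n)} (hV₁ : Extends hθ f g₁ V₁) (hV₂ : Extends hθ f g₂ V₂) :
    Extends hθ f (g₁ * g₂) (V₁ * V₂) := by
  intro u w hu hw h
  obtain ⟨v, hv, hvu⟩ := exists_translate h₂.contDiff h₂.contDiff_symm hu
  change V₁ (V₂ _) = _
  rw [hV₂ u v hu hv hvu, hV₁ v w hv hw fun x => (h x).trans (hvu _).symm]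

/-- A group of implemented diffeomorphisms acts by unitary automorphisms. -/
theorem actsByUnitaryAutomorphisms (hθ : θ ≠ 0) (hf : IsInvMult f)
    (G : Subgroup (Equiv.Perm (M n))) (hG : ∀ g ∈ G, IsImplemented hθ f g) :
    ActsByUnitaryAutomorphisms G (iota hθ hf) (hmul n hθ) (hinv n) := by
  choose V hV using fun g : G => (hG g.1 g.2).exists_unitary hf
  refine ⟨MonoidHom.mk' V fun g h => ?_, fun g => ⟨(hV g).2.1, (hV g).2.2, fun u hu => ?_⟩⟩
  · exact Extends.unique hf (hG _ (g * h).2) (hV (g * h)).1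
      ((hV g).1.mul (hG _ h.2) (hV h).1)
  · obtain ⟨w, hw, hwu⟩ := exists_translate (hG _ g.2).contDiff (hG _ g.2).contDiff_symm hu
    refine ⟨w, hwu, toDist_mem_E hf u, toDist_mem_E hf w, ?_⟩
    rw [iota_toDist, iota_toDist]
    exact (hV g).1 u w hu hw hwu

end Equivariance

/-! ### The geodesic symmetries on kernels -/

section Symmetries

variable {n : ℕ} {θ : ℝ} {f : ℝ → ℂ}

theorem contDiff_symFun (x : M n) : ContDiff ℝ ∞ (symFun x) := by
  unfold symFun Om
  have h1 : ContDiff ℝ ∞ fun y : M n => x.1 - y.1 := contDiff_const.sub contDiff_fst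
  have h2 : ContDiff ℝ ∞ fun y : M n => y.2.1.1 := by fun_prop
  have h3 : ContDiff ℝ ∞ fun y : M n => y.2.1.2 := by fun_prop
  refine ContDiff.prodMk (by fun_prop) (ContDiff.prodMk ?_ ?_)
  · exact ((contDiff_const.mul (Real.contDiff_cosh.comp h1)).smul contDiff_const).sub (by fun_prop)
  · refine ContDiff.sub (ContDiff.add ?_ ?_) (by fun_prop)
    · exact (contDiff_const.mul (Real.contDiff_cosh.comp (contDiff_const.mul h1))).mul contDiff_const
    · exact ((contDiff_const.inner ℝ h3).sub (contDiff_const.inner ℝ h2)).mul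
        (Real.contDiff_sinh.comp h1)

/-- The action of the symmetry at `x` on the configuration space. -/
def symConf (x : M n) : Cf n ≃ Cf n where
  toFun z := (2 * x.1 - z.1, (2 * Real.cosh (x.1 - z.1)) • x.2.1.1 - z.2)
  invFun z := (2 * x.1 - z.1, (2 * Real.cosh (x.1 - z.1)) • x.2.1.1 - z.2)
  left_inv z := by
    have h : x.1 - (2 * x.1 - z.1) = -(x.1 - z.1) := by ring
    simp only [h, Real.cosh_neg, sub_sub_cancel]
  right_inv z := by
    have h : x.1 - (2 * x.1 - z.1) = -(x.1 - z.1) := by ring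
    simp only [h, Real.cosh_neg, sub_sub_cancel]

theorem symConf_apply (x : M n) (z : Cf n) :
    symConf x z = (2 * x.1 - z.1, (2 * Real.cosh (x.1 - z.1)) • x.2.1.1 - z.2) := rfl

theorem integral_symConf (x : M n) (F : Cf n → ℂ) : ∫ r, F (symConf x r) = ∫ r, F r := by
  have hc : Continuous (symConf x) := by
    change Continuous fun z : Cf n => (2 * x.1 - z.1, (2 * Real.cosh (x.1 - z.1)) • x.2.1.1 - z.2)
    fun_prop
  let e : Cf n ≃ₜ Cf n :=
    { toEquiv := symConf x, continuous_toFun := hc, continuous_invFun := hc }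
  have hp : MeasurePreserving (symConf x) (volume : Measure (Cf n)) volume := by
    refine (Measure.measurePreserving_sub_left (volume : Measure ℝ) (2 * x.1)).skew_product
      (μc := (volume : Measure (EuclideanSpace ℝ (Fin n))))
      (g := fun s p => (2 * Real.cosh (x.1 - s)) • x.2.1.1 - p) ?_ (.of_forall fun s => ?_)
    · exact Continuous.measurable (by fun_prop)
    · exact (Measure.measurePreserving_sub_left volume _).map_eq
  exact hp.integral_comp e.measurableEmbedding F

/-- The phase by which the symmetry at `x` acts on functions on the configuration space. -/
def symPhase (θ : ℝ) (x : M n) (z : Cf n) : ℝ :=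
  (2 * θ)⁻¹ * (Real.cosh (x.1 - z.1) * ⟪x.2.1.2, z.2⟫_ℝ - x.2.2 * Real.sinh (2 * (x.1 - z.1))
    - Real.cosh (x.1 - z.1) ^ 2 * ⟪x.2.1.1, x.2.1.2⟫_ℝ)

/-- The `ℓ`-component of the symmetry at `x`, up to `-ℓ`. -/
def symShift (x : M n) (A : ℝ) (v : V n) : ℝ :=
  2 * Real.cosh (2 * (x.1 - A)) * x.2.2 + Om x.2.1 v * Real.sinh (x.1 - A)

/-- The symmetry at `x` in partial Fourier coordinates: it reflects `ℓ` about a point that depends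
on `(a, v)`, which gives a phase and the sign of the frequency. -/
theorem pF_sym {w w' : 𝓢(M n, ℂ)} {x : M n} (h : ∀ y, w' y = w (symFun x y)) (A : ℝ) (v : V n)
    (ζ : ℝ) : pF w' (A, v, ζ) = Complex.exp (-(Complex.I * (ζ * symShift x A v : ℝ))) *
      pF w (2 * x.1 - A, (2 * Real.cosh (x.1 - A)) • x.2.1 - v, -ζ) := by
  rw [pF_apply, pF_apply, pFourier, pFourier, ← integral_sub_left_eq_self _ _ (symShift x A v),
    ← integral_const_mul]
  congr 1
  ext l
  rw [h, ← mul_assoc, ← Complex.exp_add]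
  refine congrArg₂ (· * ·) (congrArg Complex.exp ?_) (congrArg w ?_)
  · push_cast; ring
  · simp only [symFun, symShift]
    refine Prod.ext rfl (Prod.ext rfl ?_)
    simp

/-- The factor by which the symmetries fail to be implemented when `τ_θ` is not even. -/
def oddFactor (f : ℝ → ℂ) (θ η : ℝ) : ℂ := Complex.exp (f (-phi θ η) - f (phi θ η))

theorem oddFactor_neg_mul (f : ℝ → ℂ) (θ η : ℝ) : oddFactor f θ (-η) * oddFactor f θ η = 1 := by
  rw [oddFactor, oddFactor, ← Complex.exp_add, phi_neg, neg_neg]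
  simp

/-- The symmetry at `x`, conjugated by `T⁻¹`, in partial Fourier coordinates. -/
theorem pF_Ti_sym (hf : IsInvMult f) {w w' : 𝓢(M n, ℂ)} {x : M n}
    (h : ∀ y, w' y = w (symFun x y)) (A : ℝ) (v : V n) (η : ℝ) :
    pF (Ti n θ f w') (A, v, η) = oddFactor f θ η *
      Complex.exp (-(Complex.I * (phi θ η * symShift x A ((Real.cosh (θ * η))⁻¹ • v) : ℝ))) *
      pF (Ti n θ f w) (2 * x.1 - A,
        (2 * Real.cosh (x.1 - A) * Real.cosh (θ * η)) • x.2.1 - v, -η) := by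
  rw [pF_Ti hf, pF_Ti hf]
  have h1 : twist n θ (A, v, η) = (A, (Real.cosh (θ * η))⁻¹ • v, phi θ η) := rfl
  have h2 : twist n θ (2 * x.1 - A, (2 * Real.cosh (x.1 - A) * Real.cosh (θ * η)) • x.2.1 - v, -η) =
      (2 * x.1 - A, (2 * Real.cosh (x.1 - A)) • x.2.1 - (Real.cosh (θ * η))⁻¹ • v, -phi θ η) := by
    have hc := (Real.cosh_pos (θ * η)).ne'
    simp only [twist, Equiv.coe_fn_mk, mul_neg, Real.cosh_neg, phi_neg, smul_sub, smul_smul]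
    rw [show (Real.cosh (θ * η))⁻¹ * (2 * Real.cosh (x.1 - A) * Real.cosh (θ * η)) =
      2 * Real.cosh (x.1 - A) by field_simp]
  rw [h1, h2, pF_sym h]
  simp only [phi_neg, oddFactor]
  rw [sub_eq_add_neg (f _), Complex.exp_add]
  have h3 : Complex.exp (f (-phi θ η)) * Complex.exp (-f (-phi θ η)) = 1 := by
    rw [← Complex.exp_add, add_neg_cancel, Complex.exp_zero]
  linear_combination (-Complex.exp (-f (phi θ η)) * Complex.exp (-(Complex.I *
    (phi θ η * symShift x A ((Real.cosh (θ * η))⁻¹ • v) : ℝ))) *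
    pF w (2 * x.1 - A, (2 * Real.cosh (x.1 - A)) • x.2.1 - (Real.cosh (θ * η))⁻¹ • v, -phi θ η)) * h3

/-- The phases of `pF_Ti_sym` and of the Fourier transformation in `q`, at the kernel coordinates
of the points `(s, p)` and `(t, p')`, differ by `symPhase` at the one point minus `symPhase` at
the other. -/
theorem symPhase_identity (hθ : θ ≠ 0) (x : M n) (s t : ℝ) (p p' q : EuclideanSpace ℝ (Fin n)) :
    -⟪(2 * Real.cosh (x.1 - 2⁻¹ * (s + t)) * Real.cosh (θ * ((2 * θ)⁻¹ * (t - s)))) • x.2.1.2 - q,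
        (4 * θ)⁻¹ • (p' - p)⟫_ℝ - phi θ ((2 * θ)⁻¹ * (t - s)) * symShift x (2⁻¹ * (s + t))
          ((Real.cosh (θ * ((2 * θ)⁻¹ * (t - s))))⁻¹ • ((2 : ℝ)⁻¹ • (p + p'),
            (2 * Real.cosh (x.1 - 2⁻¹ * (s + t)) * Real.cosh (θ * ((2 * θ)⁻¹ * (t - s)))) •
              x.2.1.2 - q)) =
      symPhase θ x (s, p) - symPhase θ x (t, p') -
        ⟪q, (4 * θ)⁻¹ • ((symConf x (t, p')).2 - (symConf x (s, p)).2)⟫_ℝ := by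
  obtain ⟨a, ⟨P, Q⟩, l⟩ := x
  -- the half sum `α` and the half difference `β` of `a - s` and `a - t`
  obtain ⟨α, β, rfl, rfl⟩ : ∃ α β : ℝ, s = a - (α + β) ∧ t = a - (α - β) :=
    ⟨a - 2⁻¹ * (s + t), 2⁻¹ * (t - s), by ring, by ring⟩
  have e1 : a - 2⁻¹ * (a - (α + β) + (a - (α - β))) = α := by ring
  have e2 : θ * ((2 * θ)⁻¹ * (a - (α - β) - (a - (α + β)))) = β := by field_simp; ring
  have e3 : phi θ ((2 * θ)⁻¹ * (a - (α - β) - (a - (α + β)))) =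
      Real.sinh β * Real.cosh β / θ := by
    rw [phi, if_neg hθ, mul_assoc 2 θ, e2, Real.sinh_two_mul]
    field_simp
  have e4 : a - (a - (α + β)) = α + β := by ring
  have e5 : a - (a - (α - β)) = α - β := by ring
  have hc := (Real.cosh_pos β).ne'
  simp only [symShift, symPhase, symConf_apply, Om, e1, e2, e3, e4, e5, Prod.smul_mk]
  simp only [inner_sub_left, inner_sub_right, inner_add_right, inner_smul_left, inner_smul_right,
    RCLike.conj_to_real, real_inner_comm q P]
  rw [Real.sinh_two_mul, Real.sinh_two_mul, Real.cosh_two_mul, Real.cosh_add, Real.cosh_sub,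
    Real.sinh_add, Real.sinh_sub]
  field_simp
  ring

/-- The symmetry at `x` acts on kernels as conjugation by a unitary operator, up to a factor that
depends only on the difference of the first coordinates. -/
theorem kappa_Ti_sym (hθ : θ ≠ 0) (hf : IsInvMult f) {w w' : 𝓢(M n, ℂ)} {x : M n}
    (h : ∀ y, w' y = w (symFun x y)) (z₁ z₂ : Cf n) :
    kappa n hθ (Ti n θ f w') (z₁, z₂) = oddFactor f θ ((2 * θ)⁻¹ * (z₂.1 - z₁.1)) *
      Complex.exp (Complex.I * (symPhase θ x z₁ - symPhase θ x z₂ : ℝ)) *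
        kappa n hθ (Ti n θ f w) (symConf x z₁, symConf x z₂) := by
  obtain ⟨s, p⟩ := z₁
  obtain ⟨t, p'⟩ := z₂
  -- the symmetry maps `q` to `2 cosh(a - (s + t) / 2) cosh((t - s) / 2) x.2.1.2 - q`
  rw [kappa_apply, kappa_apply, ← integral_const_mul, ← integral_sub_left_eq_self _ _
    ((2 * Real.cosh (x.1 - 2⁻¹ * (s + t)) * Real.cosh (θ * ((2 * θ)⁻¹ * (t - s)))) • x.2.1.2)]
  congr 1
  ext q
  rw [pF_Ti_sym hf h]
  have hpt : ((2 * x.1 - 2⁻¹ * (s + t),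
      (2 * Real.cosh (x.1 - 2⁻¹ * (s + t)) * Real.cosh (θ * ((2 * θ)⁻¹ * (t - s)))) • x.2.1 -
      ((2 : ℝ)⁻¹ • (p + p'), (2 * Real.cosh (x.1 - 2⁻¹ * (s + t)) *
        Real.cosh (θ * ((2 * θ)⁻¹ * (t - s)))) • x.2.1.2 - q), -((2 * θ)⁻¹ * (t - s))) : M n) =
      (2⁻¹ * ((symConf x (s, p)).1 + (symConf x (t, p')).1),
        ((2 : ℝ)⁻¹ • ((symConf x (s, p)).2 + (symConf x (t, p')).2), q),
        (2 * θ)⁻¹ * ((symConf x (t, p')).1 - (symConf x (s, p)).1)) := by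
    simp only [symConf_apply]
    refine Prod.ext (by simp only; ring) (Prod.ext (Prod.ext ?_ ?_) (by simp only; ring))
    · have e : 2 * Real.cosh (x.1 - 2⁻¹ * (s + t)) * Real.cosh (θ * ((2 * θ)⁻¹ * (t - s))) =
          Real.cosh (x.1 - s) + Real.cosh (x.1 - t) := by
        have e1 : x.1 - s = (x.1 - 2⁻¹ * (s + t)) + θ * ((2 * θ)⁻¹ * (t - s)) := by
          field_simp; ring
        have e2 : x.1 - t = (x.1 - 2⁻¹ * (s + t)) - θ * ((2 * θ)⁻¹ * (t - s)) := by
          field_simp; ring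
        rw [e1, e2]
        generalize x.1 - 2⁻¹ * (s + t) = A
        rw [Real.cosh_add, Real.cosh_sub]
        ring
      simp only [e, Prod.fst_sub, Prod.smul_fst]
      module
    · simp
  have hph := symPhase_identity hθ x s t p p' q
  simp only [hpt]
  have hexp : Complex.exp (Complex.I * (symPhase θ x (s, p) - symPhase θ x (t, p') : ℝ)) *
      Complex.exp (-(Complex.I * ⟪q, (4 * θ)⁻¹ • ((symConf x (t, p')).2 -
        (symConf x (s, p)).2)⟫_ℝ)) =
      Complex.exp (-(Complex.I * ⟪(2 * Real.cosh (x.1 - 2⁻¹ * (s + t)) *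
        Real.cosh (θ * ((2 * θ)⁻¹ * (t - s)))) • x.2.1.2 - q, (4 * θ)⁻¹ • (p' - p)⟫_ℝ)) *
      Complex.exp (-(Complex.I * (phi θ ((2 * θ)⁻¹ * (t - s)) * symShift x (2⁻¹ * (s + t))
          ((Real.cosh (θ * ((2 * θ)⁻¹ * (t - s))))⁻¹ • ((2 : ℝ)⁻¹ • (p + p'),
            (2 * Real.cosh (x.1 - 2⁻¹ * (s + t)) * Real.cosh (θ * ((2 * θ)⁻¹ * (t - s)))) •
              x.2.1.2 - q)) : ℝ))) := by
    rw [← Complex.exp_add, ← Complex.exp_add]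
    congr 1
    have := congrArg (fun r : ℝ => Complex.I * (r : ℂ)) hph
    simp only [Complex.ofReal_sub, Complex.ofReal_neg] at this ⊢
    linear_combination -this
  linear_combination (-oddFactor f θ ((2 * θ)⁻¹ * (t - s)) * pF (Ti n θ f w)
    (2⁻¹ * ((symConf x (s, p)).1 + (symConf x (t, p')).1),
        ((2 : ℝ)⁻¹ • ((symConf x (s, p)).2 + (symConf x (t, p')).2), q),
        (2 * θ)⁻¹ * ((symConf x (t, p')).1 - (symConf x (s, p)).1))) * hexp

/-- If `τ_θ` is even, the odd factor is `1`. -/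
theorem isImplemented_sym (hθ : θ ≠ 0) (hf : IsInvMult f) (heven : ∀ ξ, f (-ξ) = f ξ) (x : M n) :
    IsImplemented hθ f (sym x) where
  contDiff := contDiff_symFun x
  contDiff_symm := contDiff_symFun x
  exists_twisted := by
    refine ⟨symConf x, fun z => Complex.exp (Complex.I * symPhase θ x z), integral_symConf x,
      fun r => by simp only [mul_comm Complex.I, Complex.norm_exp_ofReal_mul_I], fun u w _ _ h s t => ?_⟩
    rw [kappa_Ti_sym hθ hf (w := u) (w' := w) (x := x) h, oddFactor, heven, sub_self,
      Complex.exp_zero, one_mul, ← Complex.exp_conj, ← Complex.exp_add]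
    congr 2
    simp only [map_mul, Complex.conj_I, Complex.conj_ofReal]
    push_cast
    ring

/-- A product of two symmetries is implemented for every `τ_θ`: `symConf` reverses the difference
of the first coordinates, so the two odd factors cancel. -/
theorem isImplemented_sym_mul_sym (hθ : θ ≠ 0) (hf : IsInvMult f) (x y : M n) :
    IsImplemented hθ f (sym x * sym y) where
  contDiff := (contDiff_symFun x).comp (contDiff_symFun y)
  contDiff_symm := (contDiff_symFun y).comp (contDiff_symFun x)
  exists_twisted := by
    refine ⟨(symConf x).trans (symConf y), fun z => Complex.exp (Complex.I * symPhase θ x z) *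
      Complex.exp (Complex.I * symPhase θ y (symConf x z)), fun F => ?_, fun r => ?_,
      fun u w hu hw h s t => ?_⟩
    · exact (integral_symConf x fun r => F (symConf y r)).trans (integral_symConf y F)
    · simp only [norm_mul, mul_comm Complex.I, Complex.norm_exp_ofReal_mul_I, one_mul]
    obtain ⟨v, hv, hvu⟩ := exists_translate (g := sym y) (contDiff_symFun y) (contDiff_symFun y) hu
    rw [kappa_Ti_sym hθ hf (w := v) (w' := w) (x := x) fun z => (h z).trans (hvu _).symm,
      kappa_Ti_sym hθ hf (w := u) (w' := v) (x := y) hvu]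
    have e : (2 * θ)⁻¹ * ((symConf x t).1 - (symConf x s).1) = -((2 * θ)⁻¹ * (t.1 - s.1)) := by
      simp only [symConf_apply]; ring
    rw [e]
    have h1 := oddFactor_neg_mul f θ ((2 * θ)⁻¹ * (t.1 - s.1))
    generalize (2 * θ)⁻¹ * (t.1 - s.1) = η at h1 ⊢
    simp only [map_mul, ← Complex.exp_conj, Complex.conj_I, Complex.conj_ofReal, Equiv.trans_apply,
      Complex.ofReal_sub, mul_sub, Complex.exp_sub, neg_mul, Complex.exp_neg]
    linear_combination (Complex.exp (Complex.I * symPhase θ x s) *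
      (Complex.exp (Complex.I * symPhase θ x t))⁻¹ *
      Complex.exp (Complex.I * symPhase θ y (symConf x s)) *
      (Complex.exp (Complex.I * symPhase θ y (symConf x t)))⁻¹ *
      kappa n hθ (Ti n θ f u) (symConf y (symConf x s), symConf y (symConf x t))) * h1

theorem actsByUnitaryAutomorphisms_transvectionGroup (hθ : θ ≠ 0) (hf : IsInvMult f) :
    ActsByUnitaryAutomorphisms (transvectionGroup n) (iota hθ hf) (hmul n hθ) (hinv n) := by
  refine actsByUnitaryAutomorphisms hθ hf _ fun g hg => ?_
  refine Subgroup.closure_induction ?_ (IsImplemented.one hθ) (fun _ _ _ _ h1 h2 => h1.mul h2)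
    (fun _ _ h => h.inv) hg
  rintro _ ⟨p, rfl⟩
  exact isImplemented_sym_mul_sym hθ hf p.1 p.2

theorem actsByUnitaryAutomorphisms_symmetryGroup (hθ : θ ≠ 0) (hf : IsInvMult f)
    (heven : ∀ ξ, f (-ξ) = f ξ) :
    ActsByUnitaryAutomorphisms (symmetryGroup n) (iota hθ hf) (hmul n hθ) (hinv n) := by
  refine actsByUnitaryAutomorphisms hθ hf _ fun g hg => ?_
  refine Subgroup.closure_induction ?_ (IsImplemented.one hθ) (fun _ _ _ _ h1 h2 => h1.mul h2)
    (fun _ _ h => h.inv) hg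
  rintro _ ⟨x, rfl⟩
  exact isImplemented_sym hθ hf heven x

end Symmetries

/-! ### Comparison with `L²(M)` -/

section Comparison

variable {n : ℕ} {θ : ℝ} {f : ℝ → ℂ}

/-- The density of the Hilbert space norm of `E` with respect to the `L²` norm, after partial
Fourier transformation. -/
def normDensity (n : ℕ) (θ : ℝ) (f : ℝ → ℂ) (ξ : ℝ) : ℂ :=
  (twistDet n θ ξ : ℂ)⁻¹ * (Complex.exp (-f ξ) * (starRingEnd ℂ) (Complex.exp (-f ξ)))

theorem hasTemperateGrowth_conj {g : ℝ → ℂ} (hg : g.HasTemperateGrowth) :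
    (fun ξ => (starRingEnd ℂ) (g ξ)).HasTemperateGrowth :=
  (Complex.conjCLE : ℂ →L[ℝ] ℂ).hasTemperateGrowth.comp hg

theorem hasTemperateGrowth_normDensity (hf : IsInvMult f) :
    (normDensity n θ f).HasTemperateGrowth := by
  have h1 := Function.Complex.hasTemperateGrowth_ofReal.comp
    ((hasTemperateGrowth_rho_inv θ).fun_mul ((hasTemperateGrowth_chi θ).pow (2 * n)))
  refine Eq.mp (congrArg _ (funext fun ξ => ?_))
    (h1.fun_mul (hf.mult_inv.fun_mul (hasTemperateGrowth_conj hf.mult_inv)))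
  simp [normDensity, twistDet, mul_comm]

theorem normDensity_eq_one_iff (ξ : ℝ) :
    normDensity n θ f ξ = 1 ↔ ‖Complex.exp (f ξ)‖ ^ 2 = (twistDet n θ ξ)⁻¹ := by
  have hd := twistDet_pos n θ ξ
  have he : 0 < ‖Complex.exp (f ξ)‖ := norm_pos_iff.2 (Complex.exp_ne_zero _)
  have h1 : normDensity n θ f ξ =
      (((twistDet n θ ξ)⁻¹ * (‖Complex.exp (f ξ)‖ ^ 2)⁻¹ : ℝ) : ℂ) := by
    rw [normDensity, Complex.mul_conj', Complex.exp_neg, norm_inv]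
    push_cast
    rw [inv_pow]
  rw [h1, Complex.ofReal_eq_one, mul_inv_eq_one₀ (pow_pos he 2).ne', eq_comm]

/-- Plancherel and the change of variables by the twisting map. -/
theorem integral_Ti_mul_conj (hf : IsInvMult f) (u v : 𝓢(M n, ℂ)) :
    ∫ x, Ti n θ f u x * (starRingEnd ℂ) (Ti n θ f v x) =
      ftConst ℝ * ∫ x, normDensity n θ f x.2.2 * (pF u x * (starRingEnd ℂ) (pF v x)) := by
  rw [← integral_FT_mul_conj_FT (splitL n) (volume : Measure (M n)),
    integral_twist θ fun x => normDensity n θ f x.2.2 * (pF u x * (starRingEnd ℂ) (pF v x))]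
  congr 2
  ext y
  change pF (Ti n θ f u) y * (starRingEnd ℂ) (pF (Ti n θ f v) y) = _
  rw [pF_Ti hf, pF_Ti hf]
  have h : (twist n θ y).2.2 = phi θ y.2.2 := rfl
  have hd : (twistDet n θ (phi θ y.2.2) : ℂ) ≠ 0 :=
    Complex.ofReal_ne_zero.2 (twistDet_pos n θ _).ne'
  rw [h, normDensity, map_mul]
  field_simp

theorem exists_schwartz_apply_eq_one (x : M n) : ∃ χ : 𝓢(M n, ℂ), χ x = 1 := by
  obtain ⟨χ, -, h⟩ := exists_cutoff (D := M n)
  have hi : Function.Injective (ContinuousLinearMap.id ℝ (M n)) := fun _ _ h => h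
  refine ⟨affinePull (ContinuousLinearMap.id ℝ (M n)) hi (-x) χ, ?_⟩
  rw [affinePull_apply]
  exact h _ (by simp)

/-- `T⁻¹` is isometric on `𝓢` for the `L²` norm if and only if the norm density is identically
`1`; the density is recovered by testing against products with arbitrary Schwartz functions. -/
theorem tracial_iff (hf : IsInvMult f) :
    (∀ u v : 𝓢(M n, ℂ), ∫ x, Ti n θ f u x * (starRingEnd ℂ) (Ti n θ f v x) =
      ∫ x, u x * (starRingEnd ℂ) (v x)) ↔
    ∀ x : M n, ‖Complex.exp (f x.2.2)‖ ^ 2 = jacInv n θ x := by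
  have hl := ftConst_pos (W := ℝ)
  have hl' : (ftConst ℝ : ℂ) ≠ 0 := Complex.ofReal_ne_zero.2 hl.ne'
  have h2 : ∀ u v : 𝓢(M n, ℂ), ∫ x, u x * (starRingEnd ℂ) (v x) =
      ftConst ℝ * ∫ x, pF u x * (starRingEnd ℂ) (pF v x) := fun u v =>
    (integral_FT_mul_conj_FT (splitL n) (volume : Measure (M n)) u v).symm
  simp only [jacInv_eq, ← normDensity_eq_one_iff]
  constructor
  · intro h x
    obtain ⟨χ, hχ⟩ := exists_schwartz_apply_eq_one x
    have h0 : (fun x : M n => (normDensity n θ f x.2.2 - 1) * χ x) = 0 := by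
      refine eq_zero_of_integral_mul_eq_zero ?_ fun g => ?_
      · have := (hasTemperateGrowth_normDensity (n := n) (θ := θ) hf).1.continuous
        fun_prop
      · have h3 := h (pFi χ) (pFi (conjSchwartz g))
        rw [integral_Ti_mul_conj hf, h2] at h3
        have h4 := mul_left_cancel₀ hl' h3
        simp only [pF_pFi, conjSchwartz_apply, Complex.conj_conj] at h4
        have i1 : Integrable fun x => χ x * g x :=
          (χ.memLp 2 volume).integrable_mul (g.memLp 2 volume)
        have i2 : Integrable fun x : M n => normDensity n θ f x.2.2 * (χ x * g x) := by
          refine ((mulL (normDensity n θ f)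
            (SchwartzMap.pairing (ContinuousLinearMap.mul ℂ ℂ) χ g)).integrable
            (μ := volume)).congr (.of_forall fun x => ?_)
          simp only [mulL_apply (hasTemperateGrowth_normDensity hf)]
          rfl
        simp only [sub_mul, one_mul, mul_assoc]
        rw [integral_sub i2 i1, h4, sub_self]
    have h5 := congrFun h0 x
    simp only [hχ, mul_one, Pi.zero_apply] at h5
    exact sub_eq_zero.1 h5
  · intro h u v
    rw [integral_Ti_mul_conj hf, h2]
    simp only [h, one_mul]

theorem inner_toLp (u v : 𝓢(M n, ℂ)) :
    ⟪v.toLp 2 volume, u.toLp 2 volume⟫_ℂ = ∫ x, u x * (starRingEnd ℂ) (v x) :=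
  inner_toL2_toL2_eq v u volume

theorem norm_eq_of_inner_self_eq {H H' : Type} [NormedAddCommGroup H] [InnerProductSpace ℂ H]
    [NormedAddCommGroup H'] [InnerProductSpace ℂ H'] {a : H} {b : H'}
    (h : ⟪a, a⟫_ℂ = ⟪b, b⟫_ℂ) : ‖a‖ = ‖b‖ := by
  rw [@norm_eq_sqrt_re_inner ℂ, @norm_eq_sqrt_re_inner ℂ _ _ _ _ b, h]

theorem denseRange_toLp : DenseRange (toLpCLM ℂ ℂ 2 (volume : Measure (M n))) :=
  denseRange_toLpCLM (E := M n) (F := ℂ) (p := 2) (μ := volume) (by simp)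

/-- If `T⁻¹` is isometric on `𝓢` for the norm of a Hilbert space in which `𝓢` is continuously and
densely embedded, then `T` extends to a unitary operator onto `L²(M)`. -/
theorem exists_unitary_T {H : Type} [NormedAddCommGroup H] [InnerProductSpace ℂ H]
    [CompleteSpace H] (hf : IsInvMult f) (J : 𝓢(M n, ℂ) →ₗ[ℂ] H) (hJc : Continuous J)
    (hJd : DenseRange J) (hJ : ∀ w, ‖J (Ti n θ f w)‖ = ‖w.toLp 2 (volume : Measure (M n))‖) :
    ∃ U : H ≃ₗᵢ[ℂ] Lp ℂ 2 (volume : Measure (M n)),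
      ∀ u, Lp.toTemperedDistribution (U (J u)) = T n θ f u := by
  have hd : DenseRange (J ∘ₗ (Ti n θ f).toLinearMap) := hJd.comp (denseRange_Ti hf) hJc
  obtain ⟨U, hU⟩ : ∃ U : H ≃ₗᵢ[ℂ] Lp ℂ 2 (volume : Measure (M n)),
      ∀ w, U (J (Ti n θ f w)) = w.toLp 2 volume :=
    ⟨(LinearEquiv.refl ℂ 𝓢(M n, ℂ)).extendOfIsometry (J ∘ₗ (Ti n θ f).toLinearMap)
      (toLpCLM ℂ ℂ 2 (volume : Measure (M n))).toLinearMap hd denseRange_toLp (fun w => (hJ w).symm),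
      LinearEquiv.extendOfIsometry_eq _ _ _ _ _ _⟩
  refine ⟨U, fun u => DFunLike.ext _ _ fun g => ?_⟩
  -- both sides are continuous in `u` for the topology of `𝓢`
  have c1 : Continuous fun u : 𝓢(M n, ℂ) => Lp.toTemperedDistribution (U (J u)) g := by
    have h1 : Continuous fun a : 𝓢'(M n, ℂ) => a g := by fun_prop
    exact h1.comp ((Lp.toTemperedDistributionCLM ℂ volume 2).continuous.comp
      (U.continuous.comp hJc))
  have c2 : Continuous fun u : 𝓢(M n, ℂ) => T n θ f u g := by
    have h1 : Continuous fun a : 𝓢'(M n, ℂ) => a (Tt n θ f g) := by fun_prop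
    have h2 : (fun u : 𝓢(M n, ℂ) => T n θ f u g) = fun u => toDist u (Tt n θ f g) := by
      ext u
      rw [T_apply_eq_integral_Tt hf, toDist_apply]
    rw [h2]
    exact h1.comp (toTemperedDistributionCLM (M n) ℂ volume).continuous
  refine congrFun ((denseRange_Ti (n := n) (θ := θ) hf).equalizer c1 c2 ?_) u
  ext w
  simp only [Function.comp_apply, hU, T_Ti hf]
  rw [Lp.toTemperedDistribution_toLp_eq]

theorem extendsToUnitary (hf : IsInvMult f)
    (h : ∀ x : M n, ‖Complex.exp (f x.2.2)‖ ^ 2 = jacInv n θ x) : ExtendsToUnitary n θ f := by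
  refine exists_unitary_T hf (toLpCLM ℂ ℂ 2 (volume : Measure (M n))).toLinearMap
    (toLpCLM ℂ ℂ 2 (volume : Measure (M n))).continuous denseRange_toLp fun w => ?_
  refine norm_eq_of_inner_self_eq ?_
  change ⟪(Ti n θ f w).toLp 2 volume, (Ti n θ f w).toLp 2 volume⟫_ℂ = _
  rw [inner_toLp, inner_toLp]
  exact (tracial_iff hf).2 h w w

/-- The completion is `L²(M)`, compatibly with the inclusions in `𝓢'`, exactly in the tracial
case: a unitary operator of this kind maps `w ∈ 𝓢` to the class of `w`, which makes `T⁻¹`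
isometric on `𝓢`. -/
theorem equalsL2_iff (hθ : θ ≠ 0) (hf : IsInvMult f) :
    EqualsL2 (iota (n := n) hθ hf) ↔
      ∀ x : M n, ‖Complex.exp (f x.2.2)‖ ^ 2 = jacInv n θ x := by
  constructor
  · rintro ⟨U, hU⟩
    refine (tracial_iff hf).1 fun u v => ?_
    have h1 : ∀ w, U (iotaS n hθ f w) = w.toLp 2 volume := by
      intro w
      have h2 := hU ⟨toDist w, toDist_mem_E hf w⟩
      rw [iota_toDist] at h2
      have h3 := LinearMap.ker_eq_bot.1
        (Lp.ker_toTemperedDistributionCLM_eq_bot (F := ℂ) (μ := (volume : Measure (M n))) (p := 2))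
      refine h3 ?_
      change Lp.toTemperedDistribution _ = Lp.toTemperedDistribution _
      rw [h2, Lp.toTemperedDistribution_toLp_eq]
    rw [← inner_toLp u v, ← h1, ← h1, LinearIsometryEquiv.inner_map_map, iotaS_apply, iotaS_apply,
      inner_kappa]
  · intro h
    obtain ⟨U, hU⟩ := exists_unitary_T (θ := θ) hf
      ((kappaNorm n hθ : ℂ) • (incl (Cf n) ∘ₗ (kappa n hθ).toLinearMap))
      (continuous_smul_incl_kappa hθ) (denseRange_smul_incl_kappa hθ) fun w => by
        refine norm_eq_of_inner_self_eq ?_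
        rw [inner_toLp, ← (tracial_iff hf).2 h w w]
        exact inner_kappa hθ _ _
    refine ⟨U, fun a => ?_⟩
    rw [iota_apply, ← T_Tinv a]
    exact hU _

end Comparison

/-! ### The tracial families -/

section Tracial

theorem IsTheta.isInvMult {τ : ℝ → ℝ → ℂ} (h : IsTheta τ) (θ : ℝ) : IsInvMult (τ θ) :=
  ⟨h.mult θ, h.mult_inv θ⟩

theorem chi_sq (θ ξ : ℝ) : chi θ ξ ^ 2 = 2⁻¹ * (1 + rho θ ξ) := by
  have h1 : rho θ ξ = Real.cosh (2 * (θ * phiInv θ ξ)) := by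
    conv_lhs => rw [← phi_phiInv θ ξ, rho_phi]
    rw [mul_assoc]
  rw [h1, chi, Real.cosh_two_mul, Real.sinh_sq]
  ring

/-- Half the logarithm of the Jacobian of `φ_θ⁻¹`. -/
def halfLogJac (n : ℕ) (θ ξ : ℝ) : ℝ :=
  (n : ℝ) * (2⁻¹ * Real.log (2⁻¹ * (1 + rho θ ξ))) - 2⁻¹ * Real.log (rho θ ξ)

theorem exp_halfLogJac (n : ℕ) (θ ξ : ℝ) :
    Real.exp (halfLogJac n θ ξ) = chi θ ξ ^ n * rho θ ξ ^ (-2⁻¹ : ℝ) := by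
  have h1 : 2⁻¹ * Real.log (chi θ ξ ^ 2) = Real.log (chi θ ξ) := by
    rw [Real.log_pow]; push_cast; ring
  rw [halfLogJac, ← chi_sq, h1, sub_eq_add_neg, Real.exp_add, Real.rpow_def_of_pos (rho_pos θ ξ)]
  congr 1
  · rw [Real.exp_nat_mul, Real.exp_log (chi_pos θ ξ)]
  · congr 1; ring

theorem contDiff_halfLogJac (n : ℕ) : ContDiff ℝ ∞ fun p : ℝ × ℝ => halfLogJac n p.1 p.2 := by
  have h1 : ContDiff ℝ ∞ fun p : ℝ × ℝ => rho p.1 p.2 := by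
    unfold rho
    exact ContDiff.sqrt (by fun_prop) fun p => by positivity
  have h2 : ∀ p : ℝ × ℝ, rho p.1 p.2 ≠ 0 := fun p => (rho_pos _ _).ne'
  have h3 : ∀ p : ℝ × ℝ, 2⁻¹ * (1 + rho p.1 p.2) ≠ 0 := fun p => by
    have := rho_pos p.1 p.2
    positivity
  unfold halfLogJac
  exact (contDiff_const.mul (contDiff_const.mul
    ((contDiff_const.mul (contDiff_const.add h1)).log h3))).sub (contDiff_const.mul (h1.log h2))

/-- The family with imaginary part `ψ` for which `|exp τ_θ|²` is the Jacobian of `φ_θ⁻¹`. -/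
def tracialFamily (n : ℕ) (ψ : ℝ → ℝ → ℝ) (θ ξ : ℝ) : ℂ :=
  (halfLogJac n θ ξ : ℂ) + Complex.I * (ψ θ ξ : ℂ)

theorem exp_tracialFamily (n : ℕ) (ψ : ℝ → ℝ → ℝ) (θ ξ : ℝ) :
    Complex.exp (tracialFamily n ψ θ ξ) =
      ((chi θ ξ ^ n * rho θ ξ ^ (-2⁻¹ : ℝ) : ℝ) : ℂ) * Complex.exp (Complex.I * ψ θ ξ) := by
  rw [tracialFamily, Complex.exp_add, ← exp_halfLogJac, Complex.ofReal_exp]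

/-- The exponential of `tracialFamily` and its inverse are products of `e^{±iψ}` and powers of
temperate functions. -/
theorem isTheta_tracialFamily (n : ℕ) {ψ : ℝ → ℝ → ℝ}
    (hψ : ContDiff ℝ ∞ fun p : ℝ × ℝ => ψ p.1 p.2)
    (h : ∀ θ, (fun ξ => Complex.exp (Complex.I * (ψ θ ξ : ℂ))).HasTemperateGrowth) :
    IsTheta (tracialFamily n ψ) where
  smooth := (Complex.ofRealCLM.contDiff.comp (contDiff_halfLogJac n)).add
    (contDiff_const.mul (Complex.ofRealCLM.contDiff.comp hψ))
  mult θ := by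
    have h1 := Function.Complex.hasTemperateGrowth_ofReal.comp
      (((hasTemperateGrowth_chi θ).pow n).fun_mul (hasTemperateGrowth_rho_rpow θ (-2⁻¹)))
    simp only [exp_tracialFamily]
    exact h1.fun_mul (h θ)
  mult_inv θ := by
    have h1 := Function.Complex.hasTemperateGrowth_ofReal.comp
      (((hasTemperateGrowth_chi_inv θ).pow n).fun_mul (hasTemperateGrowth_rho_rpow θ 2⁻¹))
    refine Eq.mp (congrArg _ (funext fun ξ => ?_)) (h1.fun_mul (hasTemperateGrowth_conj (h θ)))
    have h2 : (starRingEnd ℂ) (Complex.exp (Complex.I * ψ θ ξ)) =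
        (Complex.exp (Complex.I * ψ θ ξ))⁻¹ := by
      rw [← Complex.exp_conj, ← Complex.exp_neg]
      simp
    rw [Complex.exp_neg, exp_tracialFamily, mul_inv, h2]
    congr 1
    rw [Function.comp_apply, ← Complex.ofReal_inv, mul_inv, Real.rpow_neg (rho_pos θ ξ).le, inv_inv]
    simp

theorem norm_exp_tracialFamily_sq (n : ℕ) (ψ : ℝ → ℝ → ℝ) (θ : ℝ) (x : M n) :
    ‖Complex.exp (tracialFamily n ψ θ x.2.2)‖ ^ 2 = jacInv n θ x := by
  rw [jacInv_eq, exp_tracialFamily, norm_mul, mul_comm Complex.I, Complex.norm_exp_ofReal_mul_I,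
    mul_one, Complex.norm_real, Real.norm_eq_abs, sq_abs, mul_pow, ← Real.rpow_mul_natCast
    (rho_pos θ _).le, twistDet, mul_inv, ← pow_mul]
  norm_num
  rw [Real.rpow_neg_one, mul_comm, mul_comm n]

theorem im_tracialFamily (n : ℕ) (ψ : ℝ → ℝ → ℝ) (θ ξ : ℝ) :
    (tracialFamily n ψ θ ξ).im = ψ θ ξ := by
  simp [tracialFamily]

end Tracial

end RicciQuant

end

theorem mainTheorem2 (n : ℕ) :
    (∀ τ : ℝ → ℝ → ℂ, RicciQuant.IsTheta τ →
      -- `T` is a well defined linear injection of `𝓢` into `𝓢'`, and `𝓢 ⊂ E`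
      (∀ θ : ℝ, RicciQuant.IsT (n := n) θ (τ θ) (RicciQuant.T n θ (τ θ)) ∧
        Function.Injective (RicciQuant.T n θ (τ θ)) ∧
        ∀ u : 𝓢(RicciQuant.M n, ℂ), RicciQuant.toDist u ∈ RicciQuant.E n θ (τ θ)) ∧
      ∀ θ : ℝ, θ ≠ 0 →
        -- the Weyl product is well defined on `𝓢`; its transport is associative
        RicciQuant.IsWeyl (n := n) θ (RicciQuant.weyl n θ) ∧
        (∀ a b c : RicciQuant.E n θ (τ θ),
          RicciQuant.star (RicciQuant.star a b) c = RicciQuant.star a (RicciQuant.star b c)) ∧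
        -- the kernel of the transported product
        RicciQuant.HasKernel (n := n) θ (τ θ) RicciQuant.ampA1 (τ θ) ∧
        -- the Hilbert algebra, its equivariance, and the comparison with `L²(M)`
        (∃ (H : Type) (_ : NormedAddCommGroup H) (_ : InnerProductSpace ℂ H)
          (_ : CompleteSpace H) (ι : RicciQuant.E n θ (τ θ) →ₗ[ℂ] H),
          RicciQuant.IsHilbertCompletion ι ∧
          (∃ (mul : H →L[ℂ] H →L[ℂ] H) (inv : H →ₗ⋆[ℂ] H),
            RicciQuant.IsHilbertAlgebra mul inv ∧
            (∀ a b, mul (ι a) (ι b) = ι (RicciQuant.star a b)) ∧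
            (∀ a, ∃ b, RicciQuant.Tinv b = RicciQuant.conjS (RicciQuant.Tinv a) ∧
              inv (ι a) = ι b) ∧
            ((∀ ξ, τ θ (-ξ) = (starRingEnd ℂ) (τ θ ξ)) →
              ∀ a : RicciQuant.E n θ (τ θ), ∃ b : RicciQuant.E n θ (τ θ),
                (∀ g : 𝓢(RicciQuant.M n, ℂ),
                  (b : 𝓢'(RicciQuant.M n, ℂ)) g
                    = (starRingEnd ℂ) ((a : 𝓢'(RicciQuant.M n, ℂ)) (RicciQuant.conjS g))) ∧
                inv (ι a) = ι b) ∧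
            RicciQuant.ActsByUnitaryAutomorphisms (RicciQuant.transvectionGroup n) ι mul inv ∧
            ((∀ ξ, τ θ (-ξ) = τ θ ξ) →
              RicciQuant.ActsByUnitaryAutomorphisms (RicciQuant.symmetryGroup n) ι mul inv)) ∧
          (RicciQuant.EqualsL2 ι ↔
            ∀ x : RicciQuant.M n,
              ‖Complex.exp (τ θ x.2.2)‖ ^ 2 = RicciQuant.jacInv n θ x)) ∧
        -- the tracial case
        ((∀ x : RicciQuant.M n, ‖Complex.exp (τ θ x.2.2)‖ ^ 2 = RicciQuant.jacInv n θ x) →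
          RicciQuant.ExtendsToUnitary n θ (τ θ) ∧
          RicciQuant.HasKernel (n := n) θ (τ θ) RicciQuant.ampCan
            (fun ξ => Complex.I * ((τ θ ξ).im : ℂ)))) ∧
    -- every real phase `ψ` occurs in the tracial case
    (∀ ψ : ℝ → ℝ → ℝ, ContDiff ℝ ∞ (fun p : ℝ × ℝ => ψ p.1 p.2) →
      (∀ θ, (fun ξ => Complex.exp (Complex.I * (ψ θ ξ : ℂ))).HasTemperateGrowth) →
      ∃ τ : ℝ → ℝ → ℂ, RicciQuant.IsTheta τ ∧
        (∀ θ ξ, (τ θ ξ).im = ψ θ ξ) ∧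
        ∀ (θ : ℝ) (x : RicciQuant.M n),
          ‖Complex.exp (τ θ x.2.2)‖ ^ 2 = RicciQuant.jacInv n θ x) := by
  refine ⟨fun τ hτ => ⟨fun θ => ?_, fun θ hθ => ?_⟩, fun ψ hψ h => ?_⟩
  · have hf := hτ.isInvMult θ
    exact ⟨RicciQuant.isT_T hf, RicciQuant.T_injective hf, RicciQuant.toDist_mem_E hf⟩
  · have hf := hτ.isInvMult θ
    refine ⟨RicciQuant.isWeyl_weyl hθ, RicciQuant.star_assoc hθ hf, RicciQuant.hasKernel_ampA1 hθ hf,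
      ⟨RicciQuant.HS (RicciQuant.Cf n), inferInstance, inferInstance, inferInstance,
        RicciQuant.iota hθ hf, RicciQuant.isHilbertCompletion_iota hθ hf,
        ⟨RicciQuant.hmul n hθ, RicciQuant.hinv n, RicciQuant.isHilbertAlgebra_hmul n hθ,
          RicciQuant.hmul_iota hθ hf, fun a => ?_, fun hc a => ?_,
          RicciQuant.actsByUnitaryAutomorphisms_transvectionGroup hθ hf,
          RicciQuant.actsByUnitaryAutomorphisms_symmetryGroup hθ hf⟩,
        RicciQuant.equalsL2_iff hθ hf⟩,
      fun h => ⟨RicciQuant.extendsToUnitary hf h, RicciQuant.hasKernel_ampCan hθ hf h⟩⟩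
    · obtain ⟨b, hb⟩ := RicciQuant.exists_Tinv_eq (θ := θ) hf (RicciQuant.conjS (RicciQuant.Tinv a))
      exact ⟨b, hb, RicciQuant.hinv_iota hθ hf a b hb⟩
    · obtain ⟨b, hb⟩ := RicciQuant.exists_Tinv_eq (θ := θ) hf (RicciQuant.conjS (RicciQuant.Tinv a))
      refine ⟨b, fun g => ?_, RicciQuant.hinv_iota hθ hf a b hb⟩
      rw [← RicciQuant.T_Tinv b, ← RicciQuant.T_Tinv a, hb]
      exact RicciQuant.T_conj hf hc _ g
  · exact ⟨RicciQuant.tracialFamily n ψ, RicciQuant.isTheta_tracialFamily n hψ h,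
      RicciQuant.im_tracialFamily n ψ, RicciQuant.norm_exp_tracialFamily_sq n ψ⟩
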